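/- **Setting.** Consider an episodic $m$-player general-sum Markov game with horizon $H$, measurable state space $\mathcal S$, measurable (possibly infinite) action spaces $\mathcal A_i$, joint actions $\mathbf a=(a_1,\dots,a_m)$, transition kernels $\mathbb P_h(\cdot\mid s,\mathbf a)$, deterministic measurable rewards $r_{i,h}(s,\mathbf a)\in[0,1]$ and a fixed initial state $s_1$. Player $i$ has a finite nonempty class $\Pi_i$ of Markov policies $\pi_i=(\pi_{i,h}(\cdot\mid s))_{h\in[H]}$ and a finite class $\mathcal F_i=\mathcal F_{i,1}\times\dots\times\mathcal F_{i,H}$ of measurable functions $f_h:\mathcal S\times\mathcal A_i\to[0,H]$, so that $|\mathcal F_i|=\prod_h|\mathcal F_{i,h}|$; we set $f_{H+1}=0$ and $\mathcal F_{i,H+1}=\{0\}$. Let $\Pi=\prod_i\Pi_i$ (product policies) and write $g(s,\pi_{i,h}(s))=\mathbb E_{a\sim\pi_{i,h}(\cdot|s)}g(s,a)$. For $\pi\in\Pi$, $V_{i}^{\pi}=\mathbb E_\pi[\sum_{h=1}^H r_{i,h}(s_h,\mathbf a_h)]$ from $s_1$, extended linearly to distributions $\Lambda$ over $\Pi$.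 The Bellman operator is $$[\mathcal T^{\pi}_{i,h}f](s,a_i)=\mathbb E_{\mathbf a_{-i}\sim\pi_{-i,h}(\cdot|s),\,s'\sim\mathbb P_h(\cdot|s,\mathbf a)}\big[r_{i,h}(s,\mathbf a)+f(s',\pi_{i,h+1}(s'))\big].$$ $\Lambda\in\Delta(\Pi)$ is an *$\varepsilon$-approximate $\Pi$-CCE* if $\max_i\big(\max_{\pi_i^\dagger\in\Pi_i}V_i^{\pi_i^\dagger\times\Lambda_{-i}}-V_i^{\Lambda}\big)\le\varepsilon$. **Assumptions.** (1) *$\Pi$-completeness*: for all $i$, $h\in[H]$, $f\in\mathcal F_{i,h+1}$ and $\pi\in\Pi$: $\mathcal T^\pi_{i,h}f\in\mathcal F_{i,h}$. (2) *Bounded Bellman–Eluder dimension*: there are reals $d_i$ such that for all $i$ and $x\in(0,\tfrac12]$, $$\max_{\pi_{-i}\in\Pi_{-i}}\ \min_{\mathcal D}\ \max_{h\in[H]}\ d_{\rm E}\big(\{f_h-\mathcal T_{i,h}^{\pi_i\times\pi_{-i}}f_{h+1}:f\in\mathcal F_i,\pi_i\in\Pi_i\},\mathcal D,x\big)\le d_i\log(1/x),$$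 where $\mathcal D$ is either the family of laws of $(s_h,a_{i,h})$ under $\pi_i\times\pi_{-i}$, $\pi_i\in\Pi_i$, or the family of all point masses on $\mathcal S\times\mathcal A_i$, and $d_{\rm E}(\Phi,\mathcal D,x)$ (distributional Eluder dimension) is the supremum of the $n$ for which there are $\mu_1,\dots,\mu_n\in\mathcal D$ and $x'\ge x$ such that for each $k\le n$ some $\varphi\in\Phi$ has $\big(\sum_{j<k}(\mathbb E_{\mu_j}\varphi)^2\big)^{1/2}\le x'\le|\mathbb E_{\mu_k}\varphi|$. **Algorithm DOPMD** (parameters $T$, $\eta_i$, $K_i$, $\beta_i$). Start with $\Lambda_i^1$ uniform on $\Pi_i$. In round $t=1,\dots,T$, sample $\pi_i^t\sim\Lambda_i^t$ independently over $i$; each player $i$ in turn computes estimates $\overline V_i^{(t)}(\pi_i)$, $\pi_i\in\Pi_i$, by the subroutine APE below against $\pi^t_{-i}$, and sets $\Lambda_i^{t+1}(\pi_i)\propto\Lambda_i^t(\pi_i)\exp(\eta_i\overline V_i^{(t)}(\pi_i))$. Output $\overline\Lambda=\frac1T\sum_t\Lambda_1^t\times\dots\times\Lambda_m^t$. *APE*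 (player $i$, opponents $\pi_{-i}$): $\mathcal B^1=\mathcal F_i\times\Pi_i$. In episode $k=1,\dots,K_i$, let $\overline V^k(\pi_i)$ and $\underline V^k(\pi_i)$ be the maximum and minimum of $f_1(s_1,\pi_{i,1}(s_1))$ over $f$ with $(f,\pi_i)\in\mathcal B^k$ (both $0$ if there is no such $f$); play $\pi_i^k\times\pi_{-i}$ with $\pi_i^k\in\arg\max_{\pi_i\in\Pi_i}(\overline V^k-\underline V^k)(\pi_i)$ (ties broken by an arbitrary fixed rule, a function of the set of maximizers) and observe $(s_h^k,a_{i,h}^k,r_{i,h}^k)_{h\le H}$; let $\mathcal B^{k+1}$ be the set of $(f,\pi_i)\in\mathcal B^k$ with $\mathcal L_h(f_h,f_{h+1},\pi_i)\le\min_{f_h'\in\mathcal F_{i,h}}\mathcal L_h(f'_h,f_{h+1},\pi_i)+\beta_i$ for all $h$, where $\mathcal L_h(g,f_{h+1},\pi_i)=\sum_{j\le k}\big[g(s_h^j,a_{i,h}^j)-r_{i,h}^j-f_{h+1}(s_{h+1}^j,\pi_{i,h+1}(s_{h+1}^j))\big]^2$. Output $\overline V^{K_i}$. Hence $T\sum_iK_i$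 episodes are played in total. **Theorem (Guarantee for DOPMD).** There are absolute constants $C>0$ and $p\in\mathbb N$ such that the following holds. Let $\varepsilon>0$, $\delta\in(0,1)$, $\bar d_i=\max(1,d_i)$ and $$\iota=\log\Big(3+m+H+\tfrac1\varepsilon+\tfrac1\delta+\sum_i\big(\bar d_i+\log|\Pi_i|+\log|\mathcal F_i|\big)\Big).$$ There are integers $T\ge1$, $K_i\ge1$ and reals $\beta_i\ge0$, depending only on $m,H,\varepsilon,\delta$ and $(|\Pi_j|,|\mathcal F_j|,d_j)_j$, with $$T\le\max\Big\{1,\,C\iota^p\frac{H^2\log\sum_i|\Pi_i|}{\varepsilon^2}\Big\},\quad K_i\le\max\Big\{1,\,C\iota^p\frac{H^4\bar d_i\log\sum_j|\Pi_j||\mathcal F_j|}{\varepsilon^2}\Big\},\quad \beta_i\le C\iota^pH^2\log\sum_j|\Pi_j||\mathcal F_j|,$$ $$T\sum_iK_i\le\max\Big\{m,\,C\iota^p\frac{H^6\big(\sum_i\bar d_i\big)\log^2\big(\sum_j|\Pi_j||\mathcal F_j|\big)}{\varepsilon^4}\Big\},$$ such that for every game and all classes with these parameters that satisfy (1) and (2),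 DOPMD run for $T$ rounds with these $K_i,\beta_i$ and $\eta_i=\sqrt{\log|\Pi_i|/(H^2T)}$ outputs an $\varepsilon$-approximate $\Pi$-CCE with probability at least $1-\delta$. -/

import Mathlib

open MeasureTheory ProbabilityTheory

noncomputable section

/-- A Markov policy of one player over `H` steps: a Markov kernel from states to actions for every
step. Steps are numbered from `0` to `H - 1`. -/
structure MarkovPolicy (S A : Type*) [MeasurableSpace S] [MeasurableSpace A] (H : ℕ) where
  kernel : Fin H → Kernel S A
  isMarkov : ∀ h, IsMarkovKernel (kernel h)

/-- Policies are only ever drawn from finite classes, so they carry the discrete sigma-algebra. -/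
instance {S A : Type*} [MeasurableSpace S] [MeasurableSpace A] {H : ℕ} :
    MeasurableSpace (MarkovPolicy S A H) := ⊤

/-- An episodic general-sum Markov game with `m` players, horizon `H`, state space `S` and action
spaces `A i`. -/
structure MarkovGame (m H : ℕ) (S : Type*) [MeasurableSpace S] (A : Fin m → Type*)
    [∀ i, MeasurableSpace (A i)] where
  /-- Transition probabilities. -/
  P : Fin H → Kernel (S × (∀ i, A i)) S
  isMarkov : ∀ h, IsMarkovKernel (P h)
  /-- Deterministic rewards in `[0, 1]`. -/
  r : Fin m → Fin H → S × (∀ i, A i) → ℝ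
  measurable_r : ∀ i h, Measurable (r i h)
  r_mem : ∀ i h x, r i h x ∈ Set.Icc (0 : ℝ) 1
  /-- The fixed initial state. -/
  s₁ : S

/-- `g(s, π_h(s))`, the average of `g(s, a)` over `a ∼ π_h(· | s)`. -/
def MarkovPolicy.avg {S A : Type*} [MeasurableSpace S] [MeasurableSpace A] {H : ℕ}
    (π : MarkovPolicy S A H) (h : Fin H) (g : S × A → ℝ) (s : S) : ℝ :=
  ∫ a, g (s, a) ∂(π.kernel h s)

/-- `g(s, π_{h+1}(s))`, with the convention that the value after the last step is `0`. -/
def MarkovPolicy.avgNext {S A : Type*} [MeasurableSpace S] [MeasurableSpace A] {H : ℕ}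
    (π : MarkovPolicy S A H) (h : Fin H) (g : S × A → ℝ) (s : S) : ℝ :=
  if hh : h.1 + 1 < H then π.avg ⟨h.1 + 1, hh⟩ g s else 0

/-- The component `f_{h+1}` of `f = (f_1, …, f_H)`, with `f_{H+1} = 0`. -/
def nextFn {X : Type*} {H : ℕ} (f : Fin H → X → ℝ) (h : Fin H) : X → ℝ :=
  if hh : h.1 + 1 < H then f ⟨h.1 + 1, hh⟩ else 0

/-- The class `𝓕_{h+1}` of `𝓕 = 𝓕_1 × ⋯ × 𝓕_H`, with `𝓕_{H+1} = {0}`. -/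
def nextClass {X : Type*} {H : ℕ} (F : Fin H → Finset (X → ℝ)) (h : Fin H) : Finset (X → ℝ) :=
  if hh : h.1 + 1 < H then F ⟨h.1 + 1, hh⟩ else {0}

namespace MarkovGame

variable {m H : ℕ} {S : Type*} [MeasurableSpace S] {A : Fin m → Type*}
  [∀ i, MeasurableSpace (A i)]

/-- The law of the last `n` steps `(s_h, 𝐚_h)` of an episode played with the product policy `π`,
when the first of these steps is at state `s`. -/
def rollout (G : MarkovGame m H S A) (π : ∀ i, MarkovPolicy S (A i) H) :
    (n : ℕ) → n ≤ H → S → Measure (Fin n → S × (∀ i, A i))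
  | 0, _, _ => Measure.dirac Fin.elim0
  | n + 1, hn, s =>
    let h : Fin H := ⟨H - (n + 1), by omega⟩
    (Measure.pi fun i => (π i).kernel h s).bind fun a =>
      (G.P h (s, a)).bind fun s' =>
        (G.rollout π n (Nat.le_of_succ_le hn) s').map fun τ =>
          Fin.cons (α := fun _ => S × (∀ i, A i)) (s, a) τ

/-- The law of an episode `(s_1, 𝐚_1, …, s_H, 𝐚_H)` played with the product policy `π`. -/
def episode (G : MarkovGame m H S A) (π : ∀ i, MarkovPolicy S (A i) H) :
    Measure (Fin H → S × (∀ i, A i)) :=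
  G.rollout π H le_rfl G.s₁

/-- The value `V_{i,1}^π(s_1)` of a product policy. -/
def value (G : MarkovGame m H S A) (i : Fin m) (π : ∀ i, MarkovPolicy S (A i) H) : ℝ :=
  ∫ τ, ∑ h, G.r i h (τ h) ∂(G.episode π)

/-- The law `d_h^π` of `(s_h, a_{i,h})` when `π` is played. -/
def occupancy (G : MarkovGame m H S A) (i : Fin m) (π : ∀ i, MarkovPolicy S (A i) H)
    (h : Fin H) : Measure (S × A i) :=
  (G.episode π).map fun τ => ((τ h).1, (τ h).2 i)

/-- What player `i` observes in an episode: `(s_h, a_{i,h}, r_{i,h})` for all `h`. -/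
def obs (G : MarkovGame m H S A) (i : Fin m) (τ : Fin H → S × (∀ i, A i)) :
    Fin H → S × A i × ℝ :=
  fun h => ((τ h).1, (τ h).2 i, G.r i h (τ h))

/-- The Bellman operator `𝓣_{i,h}^π` of player `i`: `𝐚_{-i} ∼ π_{-i,h}(· | s)`,
`s' ∼ P_h(· | s, 𝐚)`, `a_i' ∼ π_{i,h+1}(· | s')`. The `i`-th coordinate of the sampled joint action
is overwritten by the given action. -/
def bellman (G : MarkovGame m H S A) (i : Fin m) (π : ∀ i, MarkovPolicy S (A i) H) (h : Fin H)
    (g : S × A i → ℝ) : S × A i → ℝ := fun x =>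
  ∫ a, (G.r i h (x.1, Function.update a i x.2) +
      ∫ s', (π i).avgNext h g s' ∂(G.P h (x.1, Function.update a i x.2)))
    ∂(Measure.pi fun j => (π j).kernel h x.1)

/-- Completeness of the value classes with respect to all product policies of the policy classes. -/
def Complete (G : MarkovGame m H S A) (F : ∀ i, Fin H → Finset (S × A i → ℝ))
    (Pol : ∀ i, Finset (MarkovPolicy S (A i) H)) : Prop :=
  ∀ i h, ∀ g ∈ nextClass (F i) h, ∀ π : ∀ i, MarkovPolicy S (A i) H, (∀ j, π j ∈ Pol j) →
    G.bellman i π h g ∈ F i h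

end MarkovGame

/-- The distributional Eluder dimension of a class `Φ` of functions with respect to a class `𝓓` of
distributions, at scale `ε`. -/
def distEluderDim {X : Type*} [MeasurableSpace X] (Φ : Set (X → ℝ)) (𝓓 : Set (Measure X))
    (ε : ℝ) : ℕ∞ :=
  sSup {N : ℕ∞ | ∃ n : ℕ, N = n ∧ ∃ μ : Fin n → Measure X, (∀ i, μ i ∈ 𝓓) ∧
    ∃ ε' : ℝ, ε ≤ ε' ∧ ∀ i, ∃ φ ∈ Φ,
      Real.sqrt (∑ j ∈ Finset.univ.filter (· < i), (∫ x, φ x ∂(μ j)) ^ 2) ≤ ε' ∧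
      ε' ≤ |∫ x, φ x ∂(μ i)|}

namespace MarkovGame

variable {m H : ℕ} {S : Type*} [MeasurableSpace S] {A : Fin m → Type*}
  [∀ i, MeasurableSpace (A i)]

/-- The Bellman residuals `f_h - 𝓣_{i,h}^{π_i × π_{-i}} f_{h+1}` over `f ∈ 𝓕_i` and `π_i ∈ Π_i`.
Only the coordinates of `π` other than `i` matter. -/
def residuals (G : MarkovGame m H S A) (i : Fin m) (Fi : Fin H → Finset (S × A i → ℝ))
    (Poli : Finset (MarkovPolicy S (A i) H)) (π : ∀ i, MarkovPolicy S (A i) H) (h : Fin H) :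
    Set (S × A i → ℝ) :=
  {φ | ∃ f ∈ Fintype.piFinset Fi, ∃ ρ ∈ Poli,
    φ = fun x => f h x - G.bellman i (Function.update π i ρ) h (nextFn f h) x}

/-- The Bellman–Eluder dimension of `𝓕_i` against the opponents' policy `π_{-i}`: the smaller of the
dimensions with respect to the roll-in distributions of `Π_i × π_{-i}` and with respect to the point
masses. -/
def bellmanEluderDim (G : MarkovGame m H S A) (i : Fin m) (Fi : Fin H → Finset (S × A i → ℝ))
    (Poli : Finset (MarkovPolicy S (A i) H)) (π : ∀ i, MarkovPolicy S (A i) H) (ε : ℝ) : ℕ∞ :=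
  min
    (⨆ h, distEluderDim (G.residuals i Fi Poli π h)
      {μ | ∃ ρ ∈ Poli, μ = G.occupancy i (Function.update π i ρ) h} ε)
    (⨆ h, distEluderDim (G.residuals i Fi Poli π h)
      {μ | ∃ x : S × A i, μ = Measure.dirac x} ε)

/-- The decentralized Bellman–Eluder dimension `d_i(𝓕_i, Π, ε)`: the maximum over `π_{-i}`. -/
def decBellmanEluderDim (G : MarkovGame m H S A) (F : ∀ i, Fin H → Finset (S × A i → ℝ))
    (Pol : ∀ i, Finset (MarkovPolicy S (A i) H)) (i : Fin m) (ε : ℝ) : ℕ∞ :=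
  ⨆ π : ∀ j, Pol j, G.bellmanEluderDim i (F i) (Pol i) (fun j => (π j).1) ε

/-- The value of the mixture `Λ` of product policies: a profile is drawn from `Λ` before the episode
and then executed. -/
def mixValue (G : MarkovGame m H S A) {Pol : ∀ i, Finset (MarkovPolicy S (A i) H)} (i : Fin m)
    (Λ : (∀ j, Pol j) → ℝ) : ℝ :=
  ∑ π, Λ π * G.value i fun j => (π j).1

/-- The value of `π_i† × Λ_{-i}`. -/
def devValue (G : MarkovGame m H S A) {Pol : ∀ i, Finset (MarkovPolicy S (A i) H)} (i : Fin m)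
    (ρ : Pol i) (Λ : (∀ j, Pol j) → ℝ) : ℝ :=
  ∑ π, Λ π * G.value i (Function.update (fun j => (π j).1) i ρ.1)

/-- The gap of `Λ` as a coarse correlated equilibrium restricted to the policy classes. All suprema
are over finite sets. -/
def cceGap (G : MarkovGame m H S A) {Pol : ∀ i, Finset (MarkovPolicy S (A i) H)}
    (Λ : (∀ j, Pol j) → ℝ) : ℝ :=
  ⨆ i, ((⨆ ρ : Pol i, G.devValue i ρ Λ) - G.mixValue i Λ)

/-- `Λ` is a probability distribution on `Π = ∏ Π_i` and an `ε`-approximate `Π`-CCE. -/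
def IsApproxCCE (G : MarkovGame m H S A) {Pol : ∀ i, Finset (MarkovPolicy S (A i) H)}
    (ε : ℝ) (Λ : (∀ j, Pol j) → ℝ) : Prop :=
  Λ ∈ stdSimplex ℝ (∀ j, Pol j) ∧ G.cceGap Λ ≤ ε

end MarkovGame

/-! Explorative all-policy evaluation, run by one player with action space `A`, value class `F`,
policy class `Pol` and confidence width `β`. Its data are the player's own observations. -/

namespace APE

variable {S A : Type*} [MeasurableSpace S] [MeasurableSpace A] {H : ℕ}

/-- The squared loss `𝓛_h(g, f_{h+1}, π)` over the data `D` of `k` episodes. -/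
def loss {k : ℕ} (D : Fin k → Fin H → S × A × ℝ) (h : Fin H) (g : S × A → ℝ)
    (f : Fin H → S × A → ℝ) (π : MarkovPolicy S A H) : ℝ :=
  ∑ t, (g ((D t h).1, (D t h).2.1) - (D t h).2.2 -
    (if hh : h.1 + 1 < H then
      π.avg ⟨h.1 + 1, hh⟩ (f ⟨h.1 + 1, hh⟩) (D t ⟨h.1 + 1, hh⟩).1 else 0)) ^ 2

/-- The confidence set after `k` episodes (which is used in episode `k + 1`). -/
def confSet (F : Fin H → Finset (S × A → ℝ)) (Pol : Finset (MarkovPolicy S A H)) (β : ℝ) :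
    (k : ℕ) → (Fin k → Fin H → S × A × ℝ) → Set ((Fin H → S × A → ℝ) × MarkovPolicy S A H)
  | 0, _ => {q | q.1 ∈ Fintype.piFinset F ∧ q.2 ∈ Pol}
  | k + 1, D => {q | q.1 ∈ Fintype.piFinset F ∧ q.2 ∈ Pol ∧
      ∀ h, ∀ g ∈ F h, loss D h (q.1 h) q.1 q.2 ≤ loss D h g q.1 q.2 + β} ∩
    confSet F Pol β k (Fin.init D)

/-- `f_1(s_1, π_1(s_1))`. -/
def initValue (s₁ : S) (f : Fin H → S × A → ℝ) (π : MarkovPolicy S A H) : ℝ :=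
  if hh : 0 < H then π.avg ⟨0, hh⟩ (f ⟨0, hh⟩) s₁ else 0

/-- The upper value estimate: a maximum over a finite set (`0` if no `f` is left for `π`). -/
def upper (s₁ : S) (F : Fin H → Finset (S × A → ℝ)) (Pol : Finset (MarkovPolicy S A H)) (β : ℝ)
    {k : ℕ} (D : Fin k → Fin H → S × A × ℝ) (π : MarkovPolicy S A H) : ℝ :=
  ⨆ f : {f : Fin H → S × A → ℝ // (f, π) ∈ confSet F Pol β k D}, initValue s₁ f.1 π

/-- The lower value estimate: a minimum over a finite set (`0` if no `f` is left for `π`). -/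
def lower (s₁ : S) (F : Fin H → Finset (S × A → ℝ)) (Pol : Finset (MarkovPolicy S A H)) (β : ℝ)
    {k : ℕ} (D : Fin k → Fin H → S × A × ℝ) (π : MarkovPolicy S A H) : ℝ :=
  ⨅ f : {f : Fin H → S × A → ℝ // (f, π) ∈ confSet F Pol β k D}, initValue s₁ f.1 π

open Classical in
/-- The policies of largest uncertainty. -/
def candidates (s₁ : S) (F : Fin H → Finset (S × A → ℝ)) (Pol : Finset (MarkovPolicy S A H))
    (β : ℝ) {k : ℕ} (D : Fin k → Fin H → S × A × ℝ) : Finset Pol :=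
  Finset.univ.filter fun π => ∀ π' : Pol,
    upper s₁ F Pol β D π'.1 - lower s₁ F Pol β D π'.1 ≤
      upper s₁ F Pol β D π.1 - lower s₁ F Pol β D π.1

/-- The output after `K` episodes: the upper estimates computed at the start of episode `K`. -/
def output (s₁ : S) (F : Fin H → Finset (S × A → ℝ)) (Pol : Finset (MarkovPolicy S A H)) (β : ℝ)
    {K : ℕ} (D : Fin K → Fin H → S × A × ℝ) (π : Pol) : ℝ :=
  upper s₁ F Pol β (fun j : Fin (K - 1) => D (Fin.castLE (Nat.sub_le K 1) j)) π.1

end APE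

/-- The law of the data that player `i` collects in the first `k` episodes of explorative all-policy
evaluation against the fixed opponents `π_{-i}`. In every episode a policy of largest uncertainty is
played, ties being broken by `sel`. -/
def apeLaw {m H : ℕ} {S : Type*} [MeasurableSpace S] {A : Fin m → Type*}
    [∀ i, MeasurableSpace (A i)] (G : MarkovGame m H S A) (i : Fin m)
    (Fi : Fin H → Finset (S × A i → ℝ)) (Poli : Finset (MarkovPolicy S (A i) H))
    (sel : Finset Poli → Poli) (β : ℝ) (π : ∀ j, MarkovPolicy S (A j) H) :
    (k : ℕ) → Measure (Fin k → Fin H → S × A i × ℝ)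
  | 0 => Measure.dirac Fin.elim0
  | k + 1 => (apeLaw G i Fi Poli sel β π k).bind fun D =>
      (G.episode (Function.update π i (sel (APE.candidates G.s₁ Fi Poli β D)).1)).map fun τ =>
        Fin.snoc (α := fun _ => Fin H → S × A i × ℝ) D (G.obs i τ)

/-- Hedge with learning rate `η` on a finite set: uniform initial weights, then
`Λ^{t+1}(x) ∝ Λ^t(x) exp(η v_t(x))`. -/
def hedge {X : Type*} [Fintype X] (η : ℝ) : (t : ℕ) → (Fin t → X → ℝ) → X → ℝ
  | 0, _ => fun _ => 1 / (Fintype.card X : ℝ)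
  | t + 1, v => fun x =>
      hedge η t (Fin.init v) x * Real.exp (η * v (Fin.last t) x) /
        ∑ y, hedge η t (Fin.init v) y * Real.exp (η * v (Fin.last t) y)

/-- The distribution on a finite set with the given weights. -/
def weightMeasure {X : Type*} [Fintype X] [MeasurableSpace X] (w : X → ℝ) : Measure X :=
  ∑ x, ENNReal.ofReal (w x) • Measure.dirac x

/-! Decentralized optimistic policy mirror descent. -/

namespace DOPMD

variable {m H : ℕ} {S : Type*} [MeasurableSpace S] {A : Fin m → Type*}
  [∀ i, MeasurableSpace (A i)]

/-- The record of one round: the sampled policies, and the data that every player collects in her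
`K i` episodes of policy evaluation. -/
abbrev Round (Pol : ∀ i, Finset (MarkovPolicy S (A i) H)) (K : Fin m → ℕ) : Type _ :=
  (∀ i, Pol i) × (∀ i, Fin (K i) → Fin H → S × A i × ℝ)

/-- The distribution `Λ_i^{t+1}` over `Π_i` after `t` rounds. -/
def mixture (G : MarkovGame m H S A) (F : ∀ i, Fin H → Finset (S × A i → ℝ))
    (Pol : ∀ i, Finset (MarkovPolicy S (A i) H)) (K : Fin m → ℕ) (β η : Fin m → ℝ)
    {t : ℕ} (ω : Fin t → Round Pol K) (i : Fin m) : Pol i → ℝ :=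
  hedge (η i) t fun j => APE.output G.s₁ (F i) (Pol i) (β i) ((ω j).2 i)

/-- The law of the first `t` rounds. In each round every player samples a policy from her current
distribution, and then the players in turn run policy evaluation against the sampled policies of the
others. -/
def law (G : MarkovGame m H S A) (F : ∀ i, Fin H → Finset (S × A i → ℝ))
    (Pol : ∀ i, Finset (MarkovPolicy S (A i) H)) (sel : ∀ i, Finset (Pol i) → Pol i)
    (K : Fin m → ℕ) (β η : Fin m → ℝ) : (t : ℕ) → Measure (Fin t → Round Pol K)
  | 0 => Measure.dirac Fin.elim0
  | t + 1 => (law G F Pol sel K β η t).bind fun ω =>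
      (Measure.pi fun i => weightMeasure (mixture G F Pol K β η ω i)).bind fun π =>
        (Measure.pi fun i =>
          apeLaw G i (F i) (Pol i) (sel i) (β i) (fun j => (π j).1) (K i)).map fun D =>
            Fin.snoc (α := fun _ => Round Pol K) ω (π, D)

/-- The output `(1/T) ∑_t Λ_1^t × ⋯ × Λ_m^t`, as weights on the set of product policies. -/
def output (G : MarkovGame m H S A) (F : ∀ i, Fin H → Finset (S × A i → ℝ))
    (Pol : ∀ i, Finset (MarkovPolicy S (A i) H)) (K : Fin m → ℕ) (β η : Fin m → ℝ)
    {T : ℕ} (ω : Fin T → Round Pol K) : (∀ i, Pol i) → ℝ := fun π =>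
  (1 / (T : ℝ)) * ∑ t : Fin T,
    ∏ i, mixture G F Pol K β η (fun j : Fin t => ω (Fin.castLE t.2.le j)) i (π i)

/-- The logarithm whose powers are hidden in `Õ(·)`: of the sum of `m`, `H`, the dimensions, `1/ε`,
`1/δ`, and the log-cardinalities (`NP i = |Π_i|`, `NF i = |𝓕_i|`); it is at least `1`. -/
def logFactor (m H : ℕ) (NP NF : Fin m → ℕ) (d : Fin m → ℝ) (ε δ : ℝ) : ℝ :=
  Real.log (3 + m + H + 1 / ε + 1 / δ +
    ∑ i, (max 1 (d i) + Real.log (NP i) + Real.log (NF i)))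

end DOPMD

end

/-! The equilibrium gap of the averaged output is, for each fixed deviation, the average over rounds
of the expected advantage of that deviation over the player's current mixture. Three errors separate
it from zero. The opponents are sampled rather than averaged, which costs a martingale term
(`law_large_advantageScore_le`). Hedge sees estimates in place of values, which costs twice the
evaluation error (`apeLaw_error_le`). Hedge has regret on these estimates (`hedge_regret`).
`devValue_sub_mixValue_le` adds the three costs.

The core is the evaluation of all policies against fixed opponents. Given a state and player i's own
action, the law of reward and next state depends only on the opponents, so data collected with one
policy are valid regression data for the Bellman backup of another. The excess squared loss then has
an exponential moment at most 1 (`lintegral_exp_excessLoss_le_one`), and Ville's inequality makes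
the resulting bounds uniform in time. Hence the true value functions, which lie in the class by
completeness (`exists_bellman_solution`), are never eliminated (`exists_mem_confSet`), while every
survivor has a small sum of squared Bellman residuals on the past data
(`sum_sq_residual_le_of_mem`).

It remains to pass from the past to the present. The error of an initial value is the sum of the
mean residuals along the policy's own episodes (`sum_integral_residual`). Small in-sample residuals
can coexist with large new ones only as often as the Eluder dimension permits
(`sum_sq_le_of_distEluderDim_le`). A second exponential supermartingale exchanges empirical and
population squares (`lintegral_exp_sq_le_one`), which serves both the roll-in and the point-mass
form of the dimension (`sum_sq_integral_extremal_le`). The policy played has the widest confidence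
interval and the intervals shrink, so averaging the widths over the episodes bounds the final width
of every policy simultaneously (`abs_upper_sub_value_le`).

Confidence sets, and with them all estimates and mixtures, take finitely many values; this settles
measurability for arbitrary tie-breaking. The numerical part splits ε into four quarters and pays
for all union bounds with powers of exp ι. -/

noncomputable section

/-! ### Products of probability measures -/

section ProductMeasures

variable {ι : Type*} [Fintype ι] {X : ι → Type*} [∀ i, MeasurableSpace (X i)]

/-- A finite product of probability measures depends measurably on its factors. -/
theorem measurable_measure_pi {Y : Type*} [MeasurableSpace Y] (κ : ∀ i, Y → Measure (X i))
    [∀ i y, IsProbabilityMeasure (κ i y)] (hκ : ∀ i, Measurable (κ i)) :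
    Measurable fun y => Measure.pi fun i => κ i y := by
  refine Measurable.measure_of_isPiSystem_of_isProbabilityMeasure generateFrom_pi.symm
    isPiSystem_pi ?_
  rintro _ ⟨s, hs, rfl⟩
  simp only [Measure.pi_pi]
  refine Finset.measurable_prod _ fun i _ => ?_
  exact (Measure.measurable_coe (hs i (Set.mem_univ i))).comp (hκ i)

variable [DecidableEq ι]

/-- Overwriting erases all dependence on the i-th factor. This is why a Bellman backup does not see
which policy player i follows at the current step. -/
theorem map_update_pi (μ : ∀ i, Measure (X i)) [∀ i, IsProbabilityMeasure (μ i)] (i : ι) (x : X i) :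
    (Measure.pi μ).map (fun a => Function.update a i x) =
      Measure.pi (Function.update μ i (Measure.dirac x)) := by
  have : ∀ j, IsProbabilityMeasure (Function.update μ i (Measure.dirac x) j) := by
    intro j
    rcases eq_or_ne j i with rfl | h
    · rw [Function.update_self]; infer_instance
    · rw [Function.update_of_ne h]; infer_instance
  symm
  refine Measure.pi_eq fun s hs => ?_
  rw [Measure.map_apply (by fun_prop) (MeasurableSet.univ_pi hs)]
  by_cases hx : x ∈ s i
  · have : (fun a => Function.update a i x) ⁻¹' Set.univ.pi s =
        Set.univ.pi (Function.update s i Set.univ) := by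
      ext a
      simp only [Set.mem_preimage, Set.mem_univ_pi]
      refine forall_congr' fun j => ?_
      rcases eq_or_ne j i with rfl | h
      · simp [hx]
      · simp [Function.update_of_ne h]
    rw [this, Measure.pi_pi]
    refine Finset.prod_congr rfl fun j _ => ?_
    rcases eq_or_ne j i with rfl | h
    · simp [Measure.dirac_apply' _ (hs j), hx]
    · simp [Function.update_of_ne h]
  · have : (fun a => Function.update a i x) ⁻¹' Set.univ.pi s = ∅ := by
      ext a
      simp only [Set.mem_preimage, Set.mem_univ_pi, Set.mem_empty_iff_false, iff_false, not_forall]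
      exact ⟨i, by simpa using hx⟩
    rw [this, measure_empty]
    symm
    refine Finset.prod_eq_zero (Finset.mem_univ i) ?_
    simp [Measure.dirac_apply' _ (hs i), hx]

/-- Resampling one coordinate of a product distribution does not change it. -/
theorem map_resample_pi (μ : ∀ i, Measure (X i)) [∀ i, IsProbabilityMeasure (μ i)] (i : ι) :
    ((μ i).prod (Measure.pi μ)).map (fun p => Function.update p.2 i p.1) = Measure.pi μ := by
  symm
  have hm : Measurable fun p : X i × (∀ j, X j) => Function.update p.2 i p.1 := by
    rw [measurable_pi_iff]
    intro j
    rcases eq_or_ne j i with rfl | h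
    · simpa using measurable_fst
    · simp only [Function.update_of_ne h]; fun_prop
  refine Measure.pi_eq fun s hs => ?_
  rw [Measure.map_apply hm (MeasurableSet.univ_pi hs)]
  have : (fun p : X i × (∀ j, X j) => Function.update p.2 i p.1) ⁻¹' Set.univ.pi s =
      s i ×ˢ Set.univ.pi (Function.update s i Set.univ) := by
    ext ⟨x, a⟩
    simp only [Set.mem_preimage, Set.mem_univ_pi, Set.mem_prod]
    constructor
    · intro h
      refine ⟨by simpa using h i, fun j => ?_⟩
      rcases eq_or_ne j i with rfl | hj
      · simp
      · simpa [Function.update_of_ne hj] using h j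
    · rintro ⟨h1, h2⟩ j
      rcases eq_or_ne j i with rfl | hj
      · simpa using h1
      · simpa [Function.update_of_ne hj] using h2 j
  rw [this, Measure.prod_prod, Measure.pi_pi, ← Finset.mul_prod_erase _ _ (Finset.mem_univ i),
    ← Finset.mul_prod_erase (s := Finset.univ) (fun j => μ j (s j)) (Finset.mem_univ i)]
  simp only [Function.update_self, measure_univ, one_mul]
  congr 1
  refine Finset.prod_congr rfl fun j hj => ?_
  rw [Function.update_of_ne (Finset.ne_of_mem_erase hj)]

theorem lintegral_pi_resample (μ : ∀ i, Measure (X i)) [∀ i, IsProbabilityMeasure (μ i)] (i : ι)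
    {F : (∀ j, X j) → ENNReal} (hF : Measurable F) :
    ∫⁻ a, F a ∂(Measure.pi μ) =
      ∫⁻ x, ∫⁻ a, F (Function.update a i x) ∂(Measure.pi μ) ∂(μ i) := by
  have hm : Measurable fun p : X i × (∀ j, X j) => Function.update p.2 i p.1 := by
    rw [measurable_pi_iff]
    intro j
    rcases eq_or_ne j i with rfl | h
    · simpa using measurable_fst
    · simp only [Function.update_of_ne h]; fun_prop
  conv_lhs => rw [← map_resample_pi μ i]
  rw [lintegral_map hF hm]
  exact lintegral_prod _ (hF.comp hm).aemeasurable

end ProductMeasures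

/-! ### Episodes as kernels -/

namespace MarkovGame

variable {m H : ℕ} {S : Type*} [MeasurableSpace S] {A : Fin m → Type*}
  [∀ i, MeasurableSpace (A i)]

instance {B : Type*} [MeasurableSpace B] (ρ : MarkovPolicy S B H) (h : Fin H) :
    IsMarkovKernel (ρ.kernel h) := ρ.isMarkov h

instance (G : MarkovGame m H S A) (h : Fin H) : IsMarkovKernel (G.P h) := G.isMarkov h

/-- The kernel of joint actions of a product policy. -/
def actKernel (π : ∀ i, MarkovPolicy S (A i) H) (h : Fin H) : Kernel S (∀ i, A i) :=
  ⟨fun s => Measure.pi fun i => (π i).kernel h s,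
    measurable_measure_pi _ fun i => ((π i).kernel h).measurable⟩

theorem actKernel_apply (π : ∀ i, MarkovPolicy S (A i) H) (h : Fin H) (s : S) :
    actKernel π h s = Measure.pi fun i => (π i).kernel h s := rfl

instance (π : ∀ i, MarkovPolicy S (A i) H) (h : Fin H) : IsMarkovKernel (actKernel π h) :=
  ⟨fun s => by rw [actKernel_apply]; infer_instance⟩

variable (G : MarkovGame m H S A) (π : ∀ i, MarkovPolicy S (A i) H)

/-- The law of the rest of an episode after a state and a joint action. -/
def tailKernel (h : Fin H) {n : ℕ} (R : Kernel S (Fin n → S × (∀ i, A i))) :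
    Kernel (S × (∀ i, A i)) (Fin (n + 1) → S × (∀ i, A i)) :=
  (Kernel.id ×ₖ (G.P h ⊗ₖ Kernel.prodMkLeft _ R)).map
    fun q => Fin.cons (α := fun _ => S × (∀ i, A i)) q.1 q.2.2

theorem measurable_fin_cons {X : Type*} [MeasurableSpace X] {n : ℕ} :
    Measurable fun q : X × (Fin n → X) => (Fin.cons (α := fun _ => X) q.1 q.2 : Fin (n + 1) → X) := by
  rw [measurable_pi_iff]
  intro j
  refine Fin.cases ?_ (fun j => ?_) j
  · simpa using measurable_fst
  · simp only [Fin.cons_succ]; fun_prop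

theorem tailKernel_apply (h : Fin H) {n : ℕ} (R : Kernel S (Fin n → S × (∀ i, A i)))
    [IsMarkovKernel R] (x : S × (∀ i, A i)) :
    G.tailKernel h R x = (G.P h x).bind fun s' => (R s').map fun τ =>
      Fin.cons (α := fun _ => S × (∀ i, A i)) x τ := by
  have hc : Measurable fun τ : Fin n → S × (∀ i, A i) =>
      (Fin.cons (α := fun _ => S × (∀ i, A i)) x τ : Fin (n + 1) → _) :=
    measurable_fin_cons.comp (measurable_const.prodMk measurable_id)
  have hc2 : Measurable fun q : (S × (∀ i, A i)) × S × (Fin n → S × (∀ i, A i)) =>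
      (Fin.cons (α := fun _ => S × (∀ i, A i)) q.1 q.2.2 : Fin (n + 1) → _) :=
    measurable_fin_cons.comp (f := fun q : (S × (∀ i, A i)) × S × (Fin n → S × (∀ i, A i)) =>
      (q.1, q.2.2)) (by fun_prop)
  refine Measure.ext_of_lintegral _ fun f hf => ?_
  have hb : Measurable fun s' => (R s').map fun τ =>
      (Fin.cons (α := fun _ => S × (∀ i, A i)) x τ : Fin (n + 1) → _) :=
    (Measure.measurable_map _ hc).comp R.measurable
  have hc3 : Measurable fun q : S × (Fin n → S × (∀ i, A i)) =>
      f (Fin.cons (α := fun _ => S × (∀ i, A i)) x q.2) := by fun_prop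
  rw [Measure.lintegral_bind hb.aemeasurable hf.aemeasurable, tailKernel, Kernel.map_apply _ hc2, lintegral_map hf hc2,
    Kernel.lintegral_id_prod (by fun_prop), Kernel.lintegral_compProd _ _ _ hc3]
  refine lintegral_congr fun s' => ?_
  rw [lintegral_map hf hc]
  simp

/-- `rollout` as a kernel. -/
def rollKernel : (n : ℕ) → n ≤ H → Kernel S (Fin n → S × (∀ i, A i))
  | 0, _ => Kernel.const _ (Measure.dirac Fin.elim0)
  | n + 1, hn =>
    G.tailKernel ⟨H - (n + 1), by omega⟩ (rollKernel n (Nat.le_of_succ_le hn)) ∘ₖ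
      (Kernel.id ×ₖ actKernel π ⟨H - (n + 1), by omega⟩)

instance (h : Fin H) {n : ℕ} (R : Kernel S (Fin n → S × (∀ i, A i))) [IsMarkovKernel R] :
    IsMarkovKernel (G.tailKernel h R) := by
  refine Kernel.IsMarkovKernel.map _ ?_
  exact measurable_fin_cons.comp (f := fun q : (S × (∀ i, A i)) × S × (Fin n → S × (∀ i, A i)) =>
      (q.1, q.2.2)) (by fun_prop)

instance isMarkovKernel_rollKernel : (n : ℕ) → (hn : n ≤ H) → IsMarkovKernel (G.rollKernel π n hn)
  | 0, _ => by rw [rollKernel]; infer_instance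
  | n + 1, hn => by
    have := isMarkovKernel_rollKernel n (Nat.le_of_succ_le hn)
    rw [rollKernel]; infer_instance

/-- `rollout` is a nested `bind`, which can be integrated iteratively only when its integrands are
measurable. The kernel form carries that measurability through the recursion. -/
theorem rollKernel_apply (n : ℕ) (hn : n ≤ H) (s : S) :
    G.rollKernel π n hn s = G.rollout π n hn s := by
  induction n generalizing s with
  | zero => rfl
  | succ n ih =>
    rw [rollKernel, rollout]
    refine Measure.ext_of_lintegral _ fun f hf => ?_
    rw [Kernel.lintegral_comp _ _ _ hf, Kernel.lintegral_id_prod (by fun_prop)]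
    have : (fun a => (G.P ⟨H - (n + 1), by omega⟩ (s, a)).bind fun s' =>
        (G.rollout π n (Nat.le_of_succ_le hn) s').map fun τ =>
          (Fin.cons (α := fun _ => S × (∀ i, A i)) (s, a) τ : Fin (n + 1) → _)) =
        fun a => G.tailKernel ⟨H - (n + 1), by omega⟩
          (G.rollKernel π n (Nat.le_of_succ_le hn)) (s, a) := by
      funext a
      rw [tailKernel_apply]
      simp only [ih]
    simp only [this]
    rw [Measure.lintegral_bind (by fun_prop) hf.aemeasurable]
    rfl

theorem lintegral_rollout_succ (n : ℕ) (hn : n + 1 ≤ H) (s : S)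
    {f : (Fin (n + 1) → S × (∀ i, A i)) → ENNReal} (hf : Measurable f) :
    ∫⁻ τ, f τ ∂(G.rollout π (n + 1) hn s) =
      ∫⁻ a, ∫⁻ s', ∫⁻ τ, f (Fin.cons (α := fun _ => S × (∀ i, A i)) (s, a) τ)
          ∂(G.rollout π n (Nat.le_of_succ_le hn) s')
        ∂(G.P ⟨H - (n + 1), by omega⟩ (s, a))
      ∂(actKernel π ⟨H - (n + 1), by omega⟩ s) := by
  rw [← rollKernel_apply, rollKernel, Kernel.lintegral_comp _ _ _ hf,
    Kernel.lintegral_id_prod (by fun_prop)]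
  refine lintegral_congr fun a => ?_
  have hc : Measurable fun τ : Fin n → S × (∀ i, A i) =>
      (Fin.cons (α := fun _ => S × (∀ i, A i)) (s, a) τ : Fin (n + 1) → _) :=
    measurable_fin_cons.comp (measurable_const.prodMk measurable_id)
  have hb : Measurable fun s' => (G.rollKernel π n (Nat.le_of_succ_le hn) s').map fun τ =>
      (Fin.cons (α := fun _ => S × (∀ i, A i)) (s, a) τ : Fin (n + 1) → _) :=
    (Measure.measurable_map _ hc).comp (Kernel.measurable _)
  rw [tailKernel_apply, Measure.lintegral_bind hb.aemeasurable hf.aemeasurable]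
  refine lintegral_congr fun s' => ?_
  rw [lintegral_map hf hc, rollKernel_apply]

instance (n : ℕ) (hn : n ≤ H) (s : S) : IsProbabilityMeasure (G.rollout π n hn s) := by
  rw [← rollKernel_apply]; infer_instance

instance : IsProbabilityMeasure (G.episode π) := by
  rw [episode]; infer_instance

/-- The Markov property of an episode: given the state at a step, the joint action and the next
state follow the policy and the transition kernel. -/
theorem lintegral_rollout_step (n : ℕ) (hn : n ≤ H) (s : S) (j : Fin n) (h : Fin H)
    (hh : h.1 = H - n + j.1) (W : S → ℝ) (hWm : Measurable W) (hW : ¬ (h.1 + 1 < H) → ∀ s, W s = 0)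
    {Ψ : (S × (∀ i, A i)) × ℝ → ENNReal} (hΨ : Measurable Ψ) :
    ∫⁻ τ, Ψ (τ j, if hj : j.1 + 1 < n then W (τ ⟨j.1 + 1, hj⟩).1 else 0)
        ∂(G.rollout π n hn s) =
      ∫⁻ τ, ∫⁻ a, ∫⁻ s', Ψ (((τ j).1, a), W s') ∂(G.P h ((τ j).1, a))
        ∂(actKernel π h (τ j).1) ∂(G.rollout π n hn s) := by
  have hm1 : ∀ n (j : Fin n), Measurable fun τ : Fin n → S × (∀ i, A i) =>
      Ψ (τ j, if hj : j.1 + 1 < n then W (τ ⟨j.1 + 1, hj⟩).1 else 0) := by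
    intro n j
    refine hΨ.comp (Measurable.prodMk (by fun_prop) ?_)
    split_ifs <;> fun_prop
  have hm0 : Measurable fun s => ∫⁻ a, ∫⁻ s', Ψ ((s, a), W s') ∂(G.P h (s, a))
        ∂(actKernel π h s) := by
    refine Measurable.lintegral_kernel_prod_right ?_
    refine Measurable.lintegral_kernel_prod_right
      (f := fun (x : S × (∀ i, A i)) s' => Ψ (x, W s')) ?_
    fun_prop
  induction n generalizing s with
  | zero => exact j.elim0
  | succ n ih =>
    have hm2 : Measurable fun τ : Fin (n + 1) → S × (∀ i, A i) => ∫⁻ a, ∫⁻ s',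
        Ψ (((τ j).1, a), W s') ∂(G.P h ((τ j).1, a)) ∂(actKernel π h (τ j).1) :=
      hm0.comp (f := fun τ : Fin (n + 1) → S × (∀ i, A i) => (τ j).1) (by fun_prop)
    rw [lintegral_rollout_succ _ _ _ _ _ (hm1 (n + 1) j), lintegral_rollout_succ _ _ _ _ _ hm2]
    revert hh
    refine Fin.cases ?_ (fun j => ?_) j
    · intro hh
      have he : (⟨H - (n + 1), by omega⟩ : Fin H) = h := Fin.ext (by simpa using hh.symm)
      rw [he]
      simp only [Fin.cons_zero, lintegral_const, measure_univ, mul_one]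
      refine lintegral_congr fun a => lintegral_congr fun s' => ?_
      -- With no steps left, `h` is the last step of the game, and the vanishing of `W` there
      -- matches the default 0. Otherwise the next state is the first state of the remaining
      -- rollout.
      cases n with
      | zero =>
        have : W s' = 0 := hW (by simp; omega) s'
        simp [this]
      | succ n =>
        have hc : ∀ τ : Fin (n + 1) → S × (∀ i, A i),
          Ψ ((s, a), if hj : ((0 : Fin (n + 2)) : ℕ) + 1 < n + 1 + 1 then
            W ((Fin.cons (α := fun _ => S × (∀ i, A i)) (s, a) τ :
              Fin (n + 2) → S × (∀ i, A i)) ⟨((0 : Fin (n + 2)) : ℕ) + 1, hj⟩).1 else 0) =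
            Ψ ((s, a), W (τ 0).1) := by
          intro τ
          rw [dif_pos (by simp)]
          rfl
        simp only [hc]
        rw [lintegral_rollout_succ _ _ _ _ _ (by fun_prop)]
        simp
    · intro hh
      refine lintegral_congr fun a => lintegral_congr fun s' => ?_
      have := ih (Nat.le_of_succ_le hn) s' j (by simp at hh; omega)
      simp only [Fin.cons_succ]
      rw [← this]
      refine lintegral_congr fun τ => ?_
      congr 2
      by_cases hj : j.1 + 1 < n
      · rw [dif_pos hj, dif_pos (by simpa using hj)]
        rfl
      · rw [dif_neg hj, dif_neg (by simpa using hj)]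

theorem lintegral_episode_step (h : Fin H) (W : S → ℝ) (hWm : Measurable W)
    (hW : ¬ (h.1 + 1 < H) → ∀ s, W s = 0)
    {Ψ : (S × (∀ i, A i)) × ℝ → ENNReal} (hΨ : Measurable Ψ) :
    ∫⁻ τ, Ψ (τ h, if hj : h.1 + 1 < H then W (τ ⟨h.1 + 1, hj⟩).1 else 0) ∂(G.episode π) =
      ∫⁻ τ, ∫⁻ a, ∫⁻ s', Ψ (((τ h).1, a), W s') ∂(G.P h ((τ h).1, a))
        ∂(actKernel π h (τ h).1) ∂(G.episode π) :=
  G.lintegral_rollout_step π H le_rfl G.s₁ h h (by simp) W hWm hW hΨ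

theorem lintegral_episode_action (h : Fin H) {Ψ : S × (∀ i, A i) → ENNReal} (hΨ : Measurable Ψ) :
    ∫⁻ τ, Ψ (τ h) ∂(G.episode π) =
      ∫⁻ τ, ∫⁻ a, Ψ ((τ h).1, a) ∂(actKernel π h (τ h).1) ∂(G.episode π) := by
  have := G.lintegral_episode_step π h (fun _ => 0) measurable_const (fun _ _ => rfl)
    (Ψ := fun p => Ψ p.1) (by fun_prop)
  simpa using this

theorem lintegral_episode_start (hH : 0 < H) {Ψ : S → ENNReal} (hΨ : Measurable Ψ) :
    ∫⁻ τ, Ψ (τ ⟨0, hH⟩).1 ∂(G.episode π) = Ψ G.s₁ := by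
  rw [episode]
  generalize G.s₁ = s
  obtain ⟨n, rfl⟩ : ∃ n, H = n + 1 := ⟨H - 1, by omega⟩
  have hz : (⟨0, hH⟩ : Fin (n + 1)) = 0 := rfl
  rw [hz, lintegral_rollout_succ _ _ _ _ _ (by fun_prop)]
  simp

end MarkovGame

/-! ### Averages of functions under a single policy -/

namespace MarkovPolicy

variable {S A : Type*} [MeasurableSpace S] [MeasurableSpace A] {H : ℕ}

theorem measurable_avg (ρ : MarkovPolicy S A H) (h : Fin H) {g : S × A → ℝ} (hg : Measurable g) :
    Measurable (ρ.avg h g) :=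
  (StronglyMeasurable.integral_kernel_prod_right' (κ := ρ.kernel h)
    hg.stronglyMeasurable).measurable

theorem avg_mem_Icc (ρ : MarkovPolicy S A H) (h : Fin H) {g : S × A → ℝ} (hg : Measurable g)
    {B : ℝ} (hB : ∀ x, g x ∈ Set.Icc 0 B) (s : S) : ρ.avg h g s ∈ Set.Icc 0 B := by
  have hi : Integrable (fun a => g (s, a)) (ρ.kernel h s) :=
    Integrable.of_mem_Icc 0 B (by fun_prop) (ae_of_all _ fun a => hB _)
  refine ⟨integral_nonneg fun a => (hB _).1, ?_⟩
  calc ρ.avg h g s ≤ ∫ _, B ∂(ρ.kernel h s) :=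
        integral_mono hi (integrable_const _) fun a => (hB _).2
    _ = B := by simp

theorem ofReal_avg (ρ : MarkovPolicy S A H) (h : Fin H) {g : S × A → ℝ} (hg : Measurable g)
    {B : ℝ} (hB : ∀ x, g x ∈ Set.Icc 0 B) (s : S) :
    ENNReal.ofReal (ρ.avg h g s) = ∫⁻ a, ENNReal.ofReal (g (s, a)) ∂(ρ.kernel h s) :=
  ofReal_integral_eq_lintegral_ofReal
    (Integrable.of_mem_Icc 0 B (by fun_prop) (ae_of_all _ fun a => hB _))
    (ae_of_all _ fun a => (hB _).1)

theorem measurable_avgNext (ρ : MarkovPolicy S A H) (h : Fin H) {g : S × A → ℝ}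
    (hg : Measurable g) : Measurable (ρ.avgNext h g) := by
  unfold avgNext
  split_ifs with hh
  · exact ρ.measurable_avg _ hg
  · exact measurable_const

theorem avgNext_mem_Icc (ρ : MarkovPolicy S A H) (h : Fin H) {g : S × A → ℝ} (hg : Measurable g)
    {B : ℝ} (hB : ∀ x, g x ∈ Set.Icc 0 B) (s : S) (hB0 : 0 ≤ B) :
    ρ.avgNext h g s ∈ Set.Icc 0 B := by
  unfold avgNext
  split_ifs with hh
  · exact ρ.avg_mem_Icc _ hg hB s
  · exact ⟨le_rfl, hB0⟩

theorem avgNext_eq_zero (ρ : MarkovPolicy S A H) (h : Fin H) (g : S × A → ℝ)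
    (hh : ¬ h.1 + 1 < H) (s : S) : ρ.avgNext h g s = 0 := by
  simp [avgNext, hh]

end MarkovPolicy

/-! ### The Bellman operator: exponential moments and telescoping -/

namespace MarkovGame

variable {m H : ℕ} {S : Type*} [MeasurableSpace S] {A : Fin m → Type*}
  [∀ i, MeasurableSpace (A i)]
variable (G : MarkovGame m H S A) (i : Fin m)

/-- The joint law of the opponents' actions and the next state after the action `x.2` of player `i`
in the state `x.1`; the `i`-th coordinate is redundant. -/
def reaction (π : ∀ i, MarkovPolicy S (A i) H) (h : Fin H) (x : S × A i) :
    Measure ((∀ i, A i) × S) :=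
  (actKernel π h x.1) ⊗ₘ ((G.P h).comap (fun a => (x.1, Function.update a i x.2)) (by fun_prop))

instance (π : ∀ i, MarkovPolicy S (A i) H) (h : Fin H) (x : S × A i) :
    IsProbabilityMeasure (G.reaction i π h x) := by
  unfold reaction; infer_instance

theorem lintegral_reaction (π : ∀ i, MarkovPolicy S (A i) H) (h : Fin H) (x : S × A i)
    {f : (∀ i, A i) × S → ENNReal} (hf : Measurable f) :
    ∫⁻ q, f q ∂(G.reaction i π h x) =
      ∫⁻ a, ∫⁻ s', f (a, s') ∂(G.P h (x.1, Function.update a i x.2)) ∂(actKernel π h x.1) := by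
  rw [reaction, Measure.lintegral_compProd hf]
  rfl

/-- The regression target `r_{i,h}(s, 𝐚) + W(s')`. -/
def target (h : Fin H) (W : S → ℝ) (x : S × A i) (q : (∀ i, A i) × S) : ℝ :=
  G.r i h (x.1, Function.update q.1 i x.2) + W q.2

variable {i}

theorem measurable_target (h : Fin H) {W : S → ℝ} (hW : Measurable W) (x : S × A i) :
    Measurable (G.target i h W x) := by
  unfold target
  exact ((G.measurable_r i h).comp (f := fun q : (∀ i, A i) × S =>
    (x.1, Function.update q.1 i x.2)) (by fun_prop)).add (by fun_prop)

theorem target_mem_Icc (h : Fin H) {W : S → ℝ} {B : ℝ} (hW : ∀ s, W s ∈ Set.Icc 0 B)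
    (x : S × A i) (q : (∀ i, A i) × S) : G.target i h W x q ∈ Set.Icc 0 (B + 1) := by
  have h1 := G.r_mem i h (x.1, Function.update q.1 i x.2)
  have h2 := hW q.2
  exact ⟨add_nonneg h1.1 h2.1, by unfold target; linarith [h1.2, h2.2]⟩

/-- The backup averages over the opponents' actions and the transition only, so `π'` may differ from
`π` in player i's policy. This legitimizes off-policy regression: `π'` generates the data, while `π
i` is evaluated and enters only through the average at the next step. -/
theorem bellman_eq_integral_reaction {π π' : ∀ i, MarkovPolicy S (A i) H}
    (hπ : ∀ j, j ≠ i → π' j = π j) (h : Fin H) {g : S × A i → ℝ} (hg : Measurable g)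
    {B : ℝ} (hB : ∀ x, g x ∈ Set.Icc 0 B) (hB0 : 0 ≤ B) (x : S × A i) :
    G.bellman i π h g x = ∫ q, G.target i h ((π i).avgNext h g) x q ∂(G.reaction i π' h x) := by
  obtain ⟨s, x⟩ := x
  set W := (π i).avgNext h g with hWdef
  have hWm : Measurable W := (π i).measurable_avgNext h hg
  have hWb : ∀ s, W s ∈ Set.Icc 0 B := fun s => (π i).avgNext_mem_Icc h hg hB s hB0
  have hWi : ∀ y, Integrable W (G.P h y) := fun y =>
    Integrable.of_mem_Icc 0 B hWm.aemeasurable (ae_of_all _ hWb)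
  have hΦ : Measurable fun b : ∀ i, A i => G.r i h (s, b) + ∫ s', W s' ∂(G.P h (s, b)) := by
    refine ((G.measurable_r i h).comp measurable_prodMk_left).add ?_
    have : Measurable fun y => ∫ s', W s' ∂(G.P h y) :=
      (StronglyMeasurable.integral_kernel (κ := G.P h) hWm.stronglyMeasurable).measurable
    exact this.comp measurable_prodMk_left
  have hu : Measurable fun a : ∀ i, A i => Function.update a i x := by fun_prop
  have hmap : (Measure.pi fun j => (π j).kernel h s).map (fun a => Function.update a i x) =
      (Measure.pi fun j => (π' j).kernel h s).map (fun a => Function.update a i x) := by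
    rw [map_update_pi, map_update_pi]
    congr 1
    funext j
    rcases eq_or_ne j i with rfl | hj
    · simp
    · simp [Function.update_of_ne hj, hπ j hj]
  have h1 : G.bellman i π h g (s, x) = ∫ b, (G.r i h (s, b) + ∫ s', W s' ∂(G.P h (s, b)))
      ∂((Measure.pi fun j => (π' j).kernel h s).map (fun a => Function.update a i x)) := by
    rw [← hmap, integral_map hu.aemeasurable hΦ.aestronglyMeasurable]
    rfl
  rw [h1, integral_map hu.aemeasurable hΦ.aestronglyMeasurable, reaction,
    Measure.integral_compProd]
  · refine integral_congr_ae (ae_of_all _ fun a => ?_)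
    simp only [target, Kernel.comap_apply]
    rw [integral_add (integrable_const _) (hWi _)]
    simp
  · exact Integrable.of_mem_Icc 0 (B + 1) (G.measurable_target h hWm (s, x)).aemeasurable
      (ae_of_all _ fun q => G.target_mem_Icc h hWb (s, x) q)

theorem ofReal_bellman {π π' : ∀ i, MarkovPolicy S (A i) H}
    (hπ : ∀ j, j ≠ i → π' j = π j) (h : Fin H) {g : S × A i → ℝ} (hg : Measurable g)
    {B : ℝ} (hB : ∀ x, g x ∈ Set.Icc 0 B) (hB0 : 0 ≤ B) (x : S × A i) :
    ENNReal.ofReal (G.bellman i π h g x) =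
      ∫⁻ q, ENNReal.ofReal (G.target i h ((π i).avgNext h g) x q) ∂(G.reaction i π' h x) := by
  have hW := fun s => (π i).avgNext_mem_Icc h hg hB s hB0
  rw [G.bellman_eq_integral_reaction hπ h hg hB hB0 x]
  refine ofReal_integral_eq_lintegral_ofReal (Integrable.of_mem_Icc 0 (B + 1)
    (G.measurable_target h ((π i).measurable_avgNext h hg) x).aemeasurable
      (ae_of_all _ fun q => G.target_mem_Icc h hW x q))
    (ae_of_all _ fun q => (G.target_mem_Icc h hW x q).1)

/-- Hoeffding's lemma for the regression noise: the target lies in an interval of length `B + 1` and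
its conditional mean is the Bellman backup. -/
theorem lintegral_exp_target_le {π π' : ∀ i, MarkovPolicy S (A i) H}
    (hπ : ∀ j, j ≠ i → π' j = π j) (h : Fin H) {g : S × A i → ℝ} (hg : Measurable g)
    {B : ℝ} (hB : ∀ x, g x ∈ Set.Icc 0 B) (hB0 : 0 ≤ B) (x : S × A i) (t : ℝ) :
    ∫⁻ q, ENNReal.ofReal (Real.exp
        (t * (G.target i h ((π i).avgNext h g) x q - G.bellman i π h g x)))
        ∂(G.reaction i π' h x) ≤ ENNReal.ofReal (Real.exp (t ^ 2 * (B + 1) ^ 2 / 8)) := by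
  have hW := fun s => (π i).avgNext_mem_Icc h hg hB s hB0
  have hm := G.measurable_target h ((π i).measurable_avgNext h hg) x
  have hs := hasSubgaussianMGF_of_mem_Icc (μ := G.reaction i π' h x) hm.aemeasurable
    (ae_of_all _ fun q => G.target_mem_Icc h hW x q)
  have h1 := hs.mgf_le t
  rw [← G.bellman_eq_integral_reaction hπ h hg hB hB0 x] at h1
  rw [← ofReal_integral_eq_lintegral_ofReal]
  · refine ENNReal.ofReal_le_ofReal (h1.trans (le_of_eq ?_))
    congr 1
    simp only [sub_zero, NNReal.coe_pow, NNReal.coe_div, coe_nnnorm, NNReal.coe_ofNat,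
      Real.norm_eq_abs, div_pow, sq_abs]
    ring
  · have := hs.integrable_exp_mul t
    rwa [← G.bellman_eq_integral_reaction hπ h hg hB hB0 x] at this
  · exact ae_of_all _ fun q => (Real.exp_pos _).le

variable (i)

theorem lintegral_actKernel_coord (π : ∀ i, MarkovPolicy S (A i) H) (h : Fin H) (s : S)
    {F : A i → ENNReal} (hF : Measurable F) :
    ∫⁻ a, F (a i) ∂(actKernel π h s) = ∫⁻ x, F x ∂((π i).kernel h s) := by
  rw [actKernel_apply, lintegral_pi_resample _ i (F := fun a => F (a i)) (by fun_prop)]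
  simp

/-- The law of an episode at step `h`, with the action of player `i` singled out. -/
theorem lintegral_episode_resample (π : ∀ i, MarkovPolicy S (A i) H) (h : Fin H) (W : S → ℝ)
    (hWm : Measurable W) (hW : ¬ (h.1 + 1 < H) → ∀ s, W s = 0)
    {Ψ : (S × (∀ i, A i)) × ℝ → ENNReal} (hΨ : Measurable Ψ) :
    ∫⁻ τ, Ψ (τ h, if hj : h.1 + 1 < H then W (τ ⟨h.1 + 1, hj⟩).1 else 0) ∂(G.episode π) =
      ∫⁻ τ, ∫⁻ x, ∫⁻ q, Ψ (((τ h).1, Function.update q.1 i x), W q.2)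
        ∂(G.reaction i π h ((τ h).1, x)) ∂((π i).kernel h (τ h).1) ∂(G.episode π) := by
  rw [G.lintegral_episode_step π h W hWm hW hΨ]
  refine lintegral_congr fun τ => ?_
  have hm : Measurable fun a => ∫⁻ s', Ψ (((τ h).1, a), W s') ∂(G.P h ((τ h).1, a)) := by
    have : Measurable fun y : S × (∀ i, A i) => ∫⁻ s', Ψ (y, W s') ∂(G.P h y) := by
      refine Measurable.lintegral_kernel_prod_right
        (f := fun (y : S × (∀ i, A i)) s' => Ψ (y, W s')) ?_
      fun_prop
    exact this.comp measurable_prodMk_left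
  rw [actKernel_apply, lintegral_pi_resample _ i hm]
  refine lintegral_congr fun x => ?_
  rw [lintegral_reaction]
  · rfl
  · exact hΨ.comp (Measurable.prodMk (by fun_prop) (by fun_prop))

variable {i}

/-- The exponential moment behind least-squares confidence sets. -/
theorem lintegral_exp_excessLoss_le_one {π π' : ∀ i, MarkovPolicy S (A i) H}
    (hπ : ∀ j, j ≠ i → π' j = π j) (h : Fin H) {g : S × A i → ℝ} (hg : Measurable g)
    (hB : ∀ x, g x ∈ Set.Icc (0 : ℝ) H) {f : S × A i → ℝ} (hf : Measurable f)
    (hb : Measurable (G.bellman i π h g)) {c : ℝ} (hc : c = 1 / (4 * (H : ℝ) ^ 2)) :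
    ∫⁻ τ, ENNReal.ofReal (Real.exp
      (-c * ((f ((τ h).1, (τ h).2 i) - G.r i h (τ h) -
          (if hj : h.1 + 1 < H then (π i).avgNext h g (τ ⟨h.1 + 1, hj⟩).1 else 0)) ^ 2 -
        (G.bellman i π h g ((τ h).1, (τ h).2 i) - G.r i h (τ h) -
          (if hj : h.1 + 1 < H then (π i).avgNext h g (τ ⟨h.1 + 1, hj⟩).1 else 0)) ^ 2) +
        c / 2 * (f ((τ h).1, (τ h).2 i) - G.bellman i π h g ((τ h).1, (τ h).2 i)) ^ 2))
      ∂(G.episode π') ≤ 1 := by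
  have hH : (1 : ℝ) ≤ H := by exact_mod_cast Nat.one_le_iff_ne_zero.2 (by have := h.2; omega)
  have hr := G.measurable_r i h
  have key := G.lintegral_episode_resample i π' h ((π i).avgNext h g)
    ((π i).measurable_avgNext h hg) (fun hh s => (π i).avgNext_eq_zero h g hh s)
    (Ψ := fun p => ENNReal.ofReal (Real.exp
      (-c * ((f (p.1.1, p.1.2 i) - G.r i h p.1 - p.2) ^ 2 -
        (G.bellman i π h g (p.1.1, p.1.2 i) - G.r i h p.1 - p.2) ^ 2) +
        c / 2 * (f (p.1.1, p.1.2 i) - G.bellman i π h g (p.1.1, p.1.2 i)) ^ 2))) (by fun_prop)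
  refine (le_of_eq key).trans ?_
  have hle : ∀ x : S × A i, ∫⁻ q, ENNReal.ofReal (Real.exp
      (-c * ((f x - G.r i h (x.1, Function.update q.1 i x.2) - (π i).avgNext h g q.2) ^ 2 -
        (G.bellman i π h g x - G.r i h (x.1, Function.update q.1 i x.2) -
          (π i).avgNext h g q.2) ^ 2) + c / 2 * (f x - G.bellman i π h g x) ^ 2))
        ∂(G.reaction i π' h x) ≤ 1 := by
    intro x
    set b := G.bellman i π h g x with hbdef
    set d := f x - b with hd
    have hfx : f x = b + d := by rw [hd]; ring
    -- The difference of squares is d² − 2d(target − b), linear in the noise, so the exponent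
    -- becomes −(c/2)d² plus 2cd times the centred target. Hoeffding's lemma adds c²d²(H+1)²/2,
    -- which is absorbed because c(H+1)² ≤ 1.
    have h1 : ∀ q : (∀ i, A i) × S, Real.exp
      (-c * ((f x - G.r i h (x.1, Function.update q.1 i x.2) - (π i).avgNext h g q.2) ^ 2 -
        (b - G.r i h (x.1, Function.update q.1 i x.2) -
          (π i).avgNext h g q.2) ^ 2) + c / 2 * d ^ 2) =
        Real.exp (-(c / 2) * d ^ 2) *
          Real.exp ((2 * c * d) * (G.target i h ((π i).avgNext h g) x q - b)) := by
      intro q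
      rw [← Real.exp_add, target, hfx]
      congr 1
      ring
    simp only [h1, ENNReal.ofReal_mul (Real.exp_pos _).le]
    rw [lintegral_const_mul' _ _ ENNReal.ofReal_ne_top]
    refine (mul_le_mul_right (G.lintegral_exp_target_le hπ h hg hB (by positivity) x _) _).trans ?_
    rw [← ENNReal.ofReal_mul (Real.exp_pos _).le, ← Real.exp_add, ← ENNReal.ofReal_one]
    refine ENNReal.ofReal_le_ofReal (Real.exp_le_one_iff.2 ?_)
    have h2 : ((H : ℝ) + 1) ^ 2 ≤ 4 * (H : ℝ) ^ 2 := by nlinarith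
    have h3 : c * (4 * (H : ℝ) ^ 2) = 1 := by rw [hc]; field_simp
    have hc0 : 0 < c := by rw [hc]; positivity
    have h4 : c * ((H : ℝ) + 1) ^ 2 ≤ 1 :=
      (mul_le_mul_of_nonneg_left h2 hc0.le).trans h3.le
    have h5 : 0 ≤ c * d ^ 2 := by positivity
    nlinarith
  calc _ ≤ ∫⁻ τ, ∫⁻ _, 1 ∂((π' i).kernel h (τ h).1) ∂(G.episode π') := by
        refine lintegral_mono fun τ => lintegral_mono fun x => ?_
        simpa using hle ((τ h).1, x)
    _ = 1 := by simp

theorem measurable_obs_coord (h : Fin H) :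
    Measurable fun τ : Fin H → S × (∀ i, A i) => ((τ h).1, (τ h).2 i) := by fun_prop

instance (π : ∀ i, MarkovPolicy S (A i) H) (h : Fin H) :
    IsProbabilityMeasure (G.occupancy i π h) :=
  Measure.isProbabilityMeasure_map (measurable_obs_coord h).aemeasurable

theorem integral_occupancy (π : ∀ i, MarkovPolicy S (A i) H) (h : Fin H) {φ : S × A i → ℝ}
    (hφ : Measurable φ) :
    ∫ x, φ x ∂(G.occupancy i π h) = ∫ τ, φ ((τ h).1, (τ h).2 i) ∂(G.episode π) :=
  integral_map (measurable_obs_coord h).aemeasurable hφ.aestronglyMeasurable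

/-- Tower property: along an episode of `π`, the backup is the conditional expectation of reward
plus next value given the state and the player's own action. All quantities are nonnegative, so the
identity is read off from lower Lebesgue integrals. -/
theorem integral_bellman_episode (π : ∀ i, MarkovPolicy S (A i) H) (h : Fin H)
    {g : S × A i → ℝ} (hg : Measurable g) (hB : ∀ x, g x ∈ Set.Icc (0 : ℝ) H)
    (hb : Measurable (G.bellman i π h g)) :
    ∫ τ, G.bellman i π h g ((τ h).1, (τ h).2 i) ∂(G.episode π) =
      ∫ τ, (G.r i h (τ h) +
        (if hj : h.1 + 1 < H then (π i).avgNext h g (τ ⟨h.1 + 1, hj⟩).1 else 0))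
        ∂(G.episode π) := by
  have hr := G.measurable_r i h
  have hWm := (π i).measurable_avgNext h hg
  have hW := fun s => (π i).avgNext_mem_Icc h hg hB s (by positivity)
  have hnn : ∀ x, 0 ≤ G.bellman i π h g x := by
    intro x
    rw [G.bellman_eq_integral_reaction (π' := π) (fun _ _ => rfl) h hg hB (by positivity)]
    exact integral_nonneg fun q => (G.target_mem_Icc h hW x q).1
  have hnm : Measurable fun τ : Fin H → S × (∀ i, A i) =>
      (if hj : h.1 + 1 < H then (π i).avgNext h g (τ ⟨h.1 + 1, hj⟩).1 else 0) := by
    split_ifs <;> fun_prop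
  rw [integral_eq_lintegral_of_nonneg_ae (ae_of_all _ fun τ => hnn _)
      (hb.comp (measurable_obs_coord h)).aestronglyMeasurable, integral_eq_lintegral_of_nonneg_ae]
  · congr 1
    rw [G.lintegral_episode_resample i π h _ hWm
      (fun hh s => (π i).avgNext_eq_zero h g hh s)
      (Ψ := fun p => ENNReal.ofReal (G.r i h p.1 + p.2)) (by fun_prop),
      G.lintegral_episode_action π h
        (Ψ := fun y => ENNReal.ofReal (G.bellman i π h g (y.1, y.2 i))) (by fun_prop)]
    refine lintegral_congr fun τ => ?_
    rw [lintegral_actKernel_coord i π h _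
      (F := fun x => ENNReal.ofReal (G.bellman i π h g ((τ h).1, x))) (by fun_prop)]
    refine lintegral_congr fun x => ?_
    rw [G.ofReal_bellman (π' := π) (fun _ _ => rfl) h hg hB (by positivity)]
    rfl
  · refine ae_of_all _ fun τ => add_nonneg (G.r_mem i h _).1 ?_
    split_ifs
    · exact (hW _).1
    · exact le_rfl
  · exact ((hr.comp (measurable_pi_apply h)).add hnm).aestronglyMeasurable

theorem integral_avg_episode (π : ∀ i, MarkovPolicy S (A i) H) (h : Fin H)
    {g : S × A i → ℝ} (hg : Measurable g) (hB : ∀ x, g x ∈ Set.Icc (0 : ℝ) H) :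
    ∫ τ, g ((τ h).1, (τ h).2 i) ∂(G.episode π) =
      ∫ τ, (π i).avg h g (τ h).1 ∂(G.episode π) := by
  have hm := (π i).measurable_avg h hg
  have hm2 : Measurable fun τ : Fin H → S × (∀ i, A i) => (π i).avg h g (τ h).1 := by fun_prop
  rw [integral_eq_lintegral_of_nonneg_ae (ae_of_all _ fun τ => (hB _).1)
      (hg.comp (measurable_obs_coord h)).aestronglyMeasurable,
    integral_eq_lintegral_of_nonneg_ae
      (ae_of_all _ fun τ => ((π i).avg_mem_Icc h hg hB _).1)
      hm2.aestronglyMeasurable]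
  congr 1
  rw [G.lintegral_episode_action π h
        (Ψ := fun y => ENNReal.ofReal (g (y.1, y.2 i))) (by fun_prop)]
  refine lintegral_congr fun τ => ?_
  rw [lintegral_actKernel_coord i π h _
      (F := fun x => ENNReal.ofReal (g ((τ h).1, x))) (by fun_prop),
    (π i).ofReal_avg h hg hB]

theorem integrable_episode_of_mem_Icc (π : ∀ i, MarkovPolicy S (A i) H)
    {f : (Fin H → S × (∀ i, A i)) → ℝ} (hf : Measurable f) {a b : ℝ}
    (hab : ∀ τ, f τ ∈ Set.Icc a b) : Integrable f (G.episode π) :=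
  Integrable.of_mem_Icc a b hf.aemeasurable (ae_of_all _ hab)

/-- The error of the value estimate of `f` is the sum of the Bellman residuals along an episode. -/
theorem sum_integral_residual (π : ∀ i, MarkovPolicy S (A i) H) {f : Fin H → S × A i → ℝ}
    (hf : ∀ h, Measurable (f h)) (hB : ∀ h x, f h x ∈ Set.Icc (0 : ℝ) H)
    (hb : ∀ h, Measurable (G.bellman i π h (nextFn f h)))
    (hbB : ∀ h x, G.bellman i π h (nextFn f h) x ∈ Set.Icc (0 : ℝ) H) :
    ∑ h, ∫ x, (f h x - G.bellman i π h (nextFn f h) x) ∂(G.occupancy i π h) =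
      APE.initValue G.s₁ f (π i) - G.value i π := by
  -- The expected value of `f` at each step, extended by 0 from step `H` on. A mean residual is then
  -- e h − e (h+1) minus a mean reward, and the sum telescopes.
  set e : ℕ → ℝ := fun k => if hk : k < H then
    ∫ τ, f ⟨k, hk⟩ ((τ ⟨k, hk⟩).1, (τ ⟨k, hk⟩).2 i) ∂(G.episode π) else 0 with he
  have hnf : ∀ h, Measurable (nextFn f h) ∧ ∀ x, nextFn f h x ∈ Set.Icc (0 : ℝ) H := by
    intro h
    unfold nextFn
    split_ifs with hh
    · exact ⟨hf _, hB _⟩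
    · exact ⟨measurable_const, fun x => ⟨le_rfl, by simp⟩⟩
  have hr : ∀ h, Integrable (fun τ => G.r i h (τ h)) (G.episode π) := fun h =>
    G.integrable_episode_of_mem_Icc π ((G.measurable_r i h).comp (measurable_pi_apply h))
      (fun τ => G.r_mem i h _)
  have hterm : ∀ h : Fin H,
      ∫ x, (f h x - G.bellman i π h (nextFn f h) x) ∂(G.occupancy i π h) =
        (e h - e (h + 1)) - ∫ τ, G.r i h (τ h) ∂(G.episode π) := by
    intro h
    have hfh := hf h
    have hbh := hb h
    rw [G.integral_occupancy π h (by fun_prop), integral_sub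
      (G.integrable_episode_of_mem_Icc π (by fun_prop) (fun τ => hB h _))
      (G.integrable_episode_of_mem_Icc π (by fun_prop) (fun τ => hbB h _)),
      G.integral_bellman_episode π h (hnf h).1 (hnf h).2 hbh]
    have h1 : e h = ∫ τ, f h ((τ h).1, (τ h).2 i) ∂(G.episode π) := by simp [he]
    have h2 : ∫ τ, (G.r i h (τ h) + (if hj : h.1 + 1 < H then
        (π i).avgNext h (nextFn f h) (τ ⟨h.1 + 1, hj⟩).1 else 0)) ∂(G.episode π) =
        ∫ τ, G.r i h (τ h) ∂(G.episode π) + e (h + 1) := by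
      by_cases hj : h.1 + 1 < H
      · have h3 : nextFn f h = f ⟨h.1 + 1, hj⟩ := by simp [nextFn, hj]
        have h4 : (π i).avgNext h (nextFn f h) = (π i).avg ⟨h.1 + 1, hj⟩ (f ⟨h.1 + 1, hj⟩) := by
          funext s; simp [MarkovPolicy.avgNext, hj, h3]
        have h5 := (π i).measurable_avg ⟨h.1 + 1, hj⟩ (hf ⟨h.1 + 1, hj⟩)
        simp only [hj, dif_pos, h4]
        rw [integral_add (hr h) (G.integrable_episode_of_mem_Icc π (by fun_prop)
          (fun τ => (π i).avg_mem_Icc _ (hf _) (hB _) _)),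
          ← G.integral_avg_episode π _ (hf _) (hB _)]
        simp [he, hj]
      · simp [he, hj]
    rw [h2, ← h1]
    ring
  rw [Finset.sum_congr rfl fun h _ => hterm h, Finset.sum_sub_distrib,
    Fin.sum_univ_eq_sum_range (fun k => e k - e (k + 1)) H, Finset.sum_range_sub',
    value, integral_finsetSum _ fun h _ => hr h]
  have h0 : e H = 0 := by simp [he]
  rw [h0, sub_zero]
  congr 1
  unfold APE.initValue
  by_cases hH : 0 < H
  · rw [dif_pos hH]
    simp only [he, hH, dif_pos]
    have hm := (π i).measurable_avg ⟨0, hH⟩ (hf ⟨0, hH⟩)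
    have hm2 : Measurable fun τ : Fin H → S × (∀ i, A i) =>
        (π i).avg ⟨0, hH⟩ (f ⟨0, hH⟩) (τ ⟨0, hH⟩).1 := by fun_prop
    have hmem := (π i).avg_mem_Icc ⟨0, hH⟩ (hf ⟨0, hH⟩) (hB ⟨0, hH⟩)
    rw [G.integral_avg_episode π _ (hf _) (hB _), integral_eq_lintegral_of_nonneg_ae
      (ae_of_all _ fun τ => (hmem _).1)
      hm2.aestronglyMeasurable,
      G.lintegral_episode_start π hH (Ψ := fun s => ENNReal.ofReal
        ((π i).avg ⟨0, hH⟩ (f ⟨0, hH⟩) s)) (by fun_prop), ENNReal.toReal_ofReal (hmem _).1]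
  · simp [he, hH]

theorem value_mem_Icc (π : ∀ i, MarkovPolicy S (A i) H) : G.value i π ∈ Set.Icc (0 : ℝ) H := by
  have hm : Measurable fun τ : Fin H → S × (∀ i, A i) => ∑ h, G.r i h (τ h) :=
    Finset.measurable_sum _ fun h _ => (G.measurable_r i h).comp (measurable_pi_apply h)
  have hmem : ∀ τ : Fin H → S × (∀ i, A i), ∑ h, G.r i h (τ h) ∈ Set.Icc (0 : ℝ) H := by
    intro τ
    refine ⟨Finset.sum_nonneg fun h _ => (G.r_mem i h _).1, ?_⟩
    calc ∑ h, G.r i h (τ h) ≤ ∑ _h : Fin H, (1 : ℝ) :=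
          Finset.sum_le_sum fun h _ => (G.r_mem i h _).2
      _ = H := by simp
  refine ⟨integral_nonneg fun τ => (hmem τ).1, ?_⟩
  calc G.value i π ≤ ∫ _, (H : ℝ) ∂(G.episode π) :=
        integral_mono (G.integrable_episode_of_mem_Icc π hm hmem) (integrable_const _)
          fun τ => (hmem τ).2
    _ = H := by simp

end MarkovGame

/-! ### Sequentially generated data -/

section SequentialLaw

variable {X : Type*}

/-- The accumulated score of a data sequence. -/
def score (Z : ∀ n, (Fin n → X) → X → ℝ) (n : ℕ) (ω : Fin n → X) : ℝ :=
  ∑ j : Fin n, Z j (fun l => ω (Fin.castLE j.2.le l)) (ω j)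

theorem score_snoc (Z : ∀ n, (Fin n → X) → X → ℝ) (n : ℕ) (ω : Fin n → X) (x : X) :
    score Z (n + 1) (Fin.snoc (α := fun _ => X) ω x) = score Z n ω + Z n ω x := by
  unfold score
  rw [Fin.sum_univ_castSucc]
  congr 1
  · refine Finset.sum_congr rfl fun j _ => ?_
    rw [Fin.snoc_castSucc]
    congr 1
    funext l
    have : Fin.castLE j.castSucc.2.le l = Fin.castSucc (Fin.castLE j.2.le l) := rfl
    rw [this, Fin.snoc_castSucc]
  · rw [Fin.snoc_last]
    congr 1
    funext l
    exact Fin.snoc_castSucc (α := fun _ => X) x ω l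

theorem score_init (Z : ∀ n, (Fin n → X) → X → ℝ) (n : ℕ) (ω : Fin (n + 1) → X) :
    score Z (n + 1) ω = score Z n (Fin.init ω) + Z n (Fin.init ω) (ω (Fin.last n)) := by
  conv_lhs => rw [← Fin.snoc_init_self (α := fun _ => X) ω]
  rw [score_snoc]

variable [MeasurableSpace X]

theorem measurable_fin_snoc {n : ℕ} :
    Measurable fun q : (Fin n → X) × X => (Fin.snoc (α := fun _ => X) q.1 q.2 : Fin (n + 1) → X) := by
  rw [measurable_pi_iff]
  intro j
  refine Fin.lastCases ?_ (fun j => ?_) j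
  · simpa using measurable_snd
  · simp only [Fin.snoc_castSucc]; fun_prop

/-- The laws `μ n` of the first `n` data points are generated by the conditional laws `κ n` of the
next data point. -/
structure IsSequentialLaw (μ : ∀ n, Measure (Fin n → X)) (κ : ∀ n, Kernel (Fin n → X) X) : Prop where
  zero : μ 0 = Measure.dirac Fin.elim0
  succ : ∀ n, μ (n + 1) = (μ n).bind fun ω => (κ n ω).map fun x =>
    Fin.snoc (α := fun _ => X) ω x
  markov : ∀ n, IsMarkovKernel (κ n)

theorem measurable_score {Z : ∀ n, (Fin n → X) → X → ℝ}
    (hZ : ∀ n, Measurable fun q : (Fin n → X) × X => Z n q.1 q.2) (n : ℕ) :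
    Measurable (score Z n) := by
  unfold score
  refine Finset.measurable_sum _ fun j _ => ?_
  exact (hZ j).comp (f := fun ω : Fin n → X => (fun l => ω (Fin.castLE j.2.le l), ω j))
    (by fun_prop)

namespace IsSequentialLaw

variable {μ : ∀ n, Measure (Fin n → X)} {κ : ∀ n, Kernel (Fin n → X) X}

theorem lintegral_succ (h : IsSequentialLaw μ κ) (n : ℕ) {f : (Fin (n + 1) → X) → ENNReal}
    (hf : Measurable f) :
    ∫⁻ ω, f ω ∂(μ (n + 1)) =
      ∫⁻ ω, ∫⁻ x, f (Fin.snoc (α := fun _ => X) ω x) ∂(κ n ω) ∂(μ n) := by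
  have := h.markov n
  have hs : ∀ ω : Fin n → X, Measurable fun x =>
      (Fin.snoc (α := fun _ => X) ω x : Fin (n + 1) → X) := fun ω =>
    measurable_fin_snoc.comp measurable_prodMk_left
  have he : (fun ω => (κ n ω).map fun x => (Fin.snoc (α := fun _ => X) ω x : Fin (n + 1) → X)) =
      ((Kernel.id ×ₖ κ n).map fun q => (Fin.snoc (α := fun _ => X) q.1 q.2 : Fin (n + 1) → X)) := by
    funext ω
    refine Measure.ext_of_lintegral _ fun g hg => ?_
    have hg2 : Measurable fun q : (Fin n → X) × X =>
        g (Fin.snoc (α := fun _ => X) q.1 q.2) := hg.comp measurable_fin_snoc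
    rw [lintegral_map hg (hs ω), Kernel.map_apply _ measurable_fin_snoc,
      lintegral_map hg measurable_fin_snoc, Kernel.lintegral_id_prod hg2]
  have hm : Measurable fun ω => (κ n ω).map fun x =>
      (Fin.snoc (α := fun _ => X) ω x : Fin (n + 1) → X) := by
    rw [he]; exact Kernel.measurable _
  rw [h.succ, Measure.lintegral_bind hm.aemeasurable hf.aemeasurable]
  refine lintegral_congr fun ω => ?_
  rw [lintegral_map hf (hs ω)]

theorem isProbabilityMeasure (h : IsSequentialLaw μ κ) (n : ℕ) : IsProbabilityMeasure (μ n) := by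
  induction n with
  | zero => rw [h.zero]; infer_instance
  | succ n ih =>
    have := h.markov n
    refine ⟨?_⟩
    rw [← lintegral_one, h.lintegral_succ n measurable_const]
    simp

/-- Ville's maximal inequality for an exponential supermartingale. -/
theorem measure_exists_le_score_le (h : IsSequentialLaw μ κ) {Z : ∀ n, (Fin n → X) → X → ℝ}
    (hZ : ∀ n, Measurable fun q : (Fin n → X) × X => Z n q.1 q.2)
    (hexp : ∀ n ω, ∫⁻ x, ENNReal.ofReal (Real.exp (Z n ω x)) ∂(κ n ω) ≤ 1) {a : ℝ} (ha : 0 < a)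
    (N : ℕ) :
    μ N {ω | ∃ n, ∃ hn : n ≤ N, a ≤ score Z n (fun j => ω (Fin.castLE hn j))} ≤
      ENNReal.ofReal (Real.exp (-a)) := by
  classical
  set C : ∀ N, Set (Fin N → X) := fun N =>
    {ω | ∃ n, ∃ hn : n ≤ N, a ≤ score Z n (fun j => ω (Fin.castLE hn j))} with hC
  have hCm : ∀ N, MeasurableSet (C N) := by
    intro N
    simp only [hC, Set.ofPred_exists]
    refine MeasurableSet.iUnion fun n => MeasurableSet.iUnion fun hn => ?_
    exact measurableSet_le measurable_const ((measurable_score hZ n).comp (by fun_prop))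
  -- The exponential process frozen at exp a once the level has been reached. Stopping it turns a
  -- bound at the final time into one for all times up to `N`.
  set F : ∀ N, (Fin N → X) → ENNReal := fun N ω =>
    if ω ∈ C N then ENNReal.ofReal (Real.exp a) else ENNReal.ofReal (Real.exp (score Z N ω)) with hF
  have hFm : ∀ N, Measurable (F N) := fun N => by
    have := measurable_score hZ N
    exact Measurable.ite (hCm N) measurable_const (by fun_prop)
  have hmono : ∀ N (ω : Fin N → X) x, ω ∈ C N → Fin.snoc (α := fun _ => X) ω x ∈ C (N + 1) := by
    rintro N ω x ⟨n, hn, h1⟩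
    refine ⟨n, hn.trans (Nat.le_succ N), h1.trans (le_of_eq ?_)⟩
    congr 1
    funext j
    exact (Fin.snoc_castSucc (α := fun _ => X) x ω (Fin.castLE hn j)).symm
  -- Frozen paths get the factor 1. On a path that crosses just now, freezing replaces exp of the
  -- new score by the smaller number exp a.
  have hstep : ∀ N (ω : Fin N → X) x, F (N + 1) (Fin.snoc (α := fun _ => X) ω x) ≤
      F N ω * (if ω ∈ C N then 1 else ENNReal.ofReal (Real.exp (Z N ω x))) := by
    intro N ω x
    by_cases h1 : ω ∈ C N
    · simp [hF, h1, hmono N ω x h1]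
    · have h2 : F N ω * (if ω ∈ C N then 1 else ENNReal.ofReal (Real.exp (Z N ω x))) =
          ENNReal.ofReal (Real.exp (score Z (N + 1) (Fin.snoc (α := fun _ => X) ω x))) := by
        simp only [hF, h1, if_false]
        rw [← ENNReal.ofReal_mul (Real.exp_pos _).le, ← Real.exp_add, score_snoc]
      rw [h2]
      by_cases h3 : Fin.snoc (α := fun _ => X) ω x ∈ C (N + 1)
      · simp only [hF, h3, if_true]
        obtain ⟨n, hn, h4⟩ := h3
        rcases Nat.lt_or_ge N n with h5 | h5
        · obtain rfl : n = N + 1 := by omega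
          exact ENNReal.ofReal_le_ofReal (Real.exp_le_exp.2 h4)
        · exfalso
          refine h1 ⟨n, h5, h4.trans (le_of_eq ?_)⟩
          congr 1
          funext j
          exact Fin.snoc_castSucc (α := fun _ => X) x ω (Fin.castLE h5 j)
      · simp only [hF, h3, if_false, le_refl]
  have hle : ∀ N, ∫⁻ ω, F N ω ∂(μ N) ≤ 1 := by
    intro N
    induction N with
    | zero =>
      rw [h.zero, lintegral_dirac' _ (hFm 0)]
      have : (Fin.elim0 : Fin 0 → X) ∉ C 0 := by
        rintro ⟨n, hn, h1⟩
        obtain rfl : n = 0 := by omega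
        simp only [score, Finset.univ_eq_empty, Finset.sum_empty] at h1
        linarith
      simp [hF, this, score]
    | succ N ih =>
      have := h.markov N
      rw [h.lintegral_succ N (hFm _)]
      refine le_trans (lintegral_mono fun ω => ?_) ih
      refine (lintegral_mono fun x => hstep N ω x).trans ?_
      by_cases h1 : ω ∈ C N
      · simp [h1]
      · simp only [h1, if_false]
        rw [lintegral_const_mul' _ _ (by simp [hF, h1])]
        exact mul_le_of_le_one_right' (hexp N ω)
  have hpos : ENNReal.ofReal (Real.exp a) ≠ 0 := by simp [Real.exp_pos]
  -- Markov's inequality for the stopped process, which equals exp a on `C N`.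
  have h1 : ENNReal.ofReal (Real.exp a) * μ N (C N) ≤ 1 := by
    rw [← setLIntegral_const]
    refine le_trans ?_ (hle N)
    rw [← lintegral_indicator (hCm N)]
    refine lintegral_mono fun ω => ?_
    by_cases h1 : ω ∈ C N <;> simp [hF, h1]
  rw [Real.exp_neg, ENNReal.ofReal_inv_of_pos (Real.exp_pos a)]
  rw [ENNReal.le_inv_iff_mul_le, mul_comm]
  exact h1

/-- A union bound over the data points with conditional probabilities: the bound holds for every
history, so conditioning on the past costs nothing. -/
theorem measure_exists_mem_le (h : IsSequentialLaw μ κ) {B : Set X} (hB : MeasurableSet B)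
    {δ : ENNReal} (hδ : ∀ n ω, κ n ω B ≤ δ) (N : ℕ) :
    μ N {ω | ∃ j, ω j ∈ B} ≤ N * δ := by
  classical
  have hm : ∀ N, MeasurableSet {ω : Fin N → X | ∃ j, ω j ∈ B} := by
    intro N
    simp only [Set.ofPred_exists]
    exact MeasurableSet.iUnion fun j => measurable_pi_apply j hB
  induction N with
  | zero => simp
  | succ N ih =>
    have := h.isProbabilityMeasure N
    rw [← lintegral_indicator_one (hm _), h.lintegral_succ N (measurable_one.indicator (hm _))]
    calc _ ≤ ∫⁻ ω, ({ω : Fin N → X | ∃ j, ω j ∈ B}.indicator 1 ω + δ) ∂(μ N) := by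
          refine lintegral_mono fun ω => ?_
          have := h.markov N
          calc _ ≤ ∫⁻ x, ({ω : Fin N → X | ∃ j, ω j ∈ B}.indicator 1 ω + B.indicator 1 x)
                ∂(κ N ω) := by
                refine lintegral_mono fun x => ?_
                by_cases hx : Fin.snoc (α := fun _ => X) ω x ∈
                  {ω : Fin (N + 1) → X | ∃ j, ω j ∈ B}
                swap
                · rw [Set.indicator_of_notMem hx]; exact zero_le
                rw [Set.indicator_of_mem hx]
                obtain ⟨j, hj⟩ := hx
                revert hj
                refine Fin.lastCases ?_ (fun j => ?_) j
                · intro hj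
                  rw [Fin.snoc_last] at hj
                  simp [hj]
                · intro hj
                  rw [Fin.snoc_castSucc] at hj
                  have : ω ∈ {ω : Fin N → X | ∃ j, ω j ∈ B} := ⟨j, hj⟩
                  rw [Set.indicator_of_mem this]
                  simp
            _ ≤ _ := by
                rw [lintegral_add_left measurable_const, lintegral_const, measure_univ, mul_one,
                  lintegral_indicator_one hB]
                exact add_le_add le_rfl (hδ N ω)
      _ ≤ _ := by
          rw [lintegral_add_right _ measurable_const, lintegral_indicator_one (hm N)]
          simp only [lintegral_const, measure_univ, mul_one]
          push_cast
          rw [add_mul, one_mul]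
          gcongr

end IsSequentialLaw

end SequentialLaw

/-! ### The distributional Eluder dimension -/

section Eluder

/-- If all column sums above the diagonal are at most `β < L * w`, then the indices have a
colouring with `L` colours for which the sums over earlier indices of the same colour are at
most `w`. -/
theorem exists_coloring (a : ℕ → ℕ → ℝ) {L : ℕ} {w β : ℝ}
    (hL : β < L * w) (hβ0 : 0 ≤ β) (K : ℕ) (hβ : ∀ t < K, ∑ j ∈ Finset.range t, a j t ≤ β) :
    ∃ c : ℕ → Fin L, ∀ t < K, ∑ j ∈ Finset.range t with c j = c t, a j t ≤ w := by
  have hL0 : 0 < L := by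
    rcases Nat.eq_zero_or_pos L with h | h
    · subst h; simp at hL; linarith
    · exact h
  induction K with
  | zero => exact ⟨fun _ => ⟨0, hL0⟩, by simp⟩
  | succ K ih =>
    obtain ⟨c, hc⟩ := ih fun t ht => hβ t (by omega)
    -- Greedy colouring by pigeonhole: if all `L` classes exceeded w, the whole column would be at
    -- least L·w > β.
    obtain ⟨l, hl⟩ : ∃ l, ∑ j ∈ Finset.range K with c j = l, a j K ≤ w := by
      by_contra! hcon
      have h1 : ∑ l : Fin L, w ≤ ∑ l, ∑ j ∈ Finset.range K with c j = l, a j K :=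
        Finset.sum_le_sum fun l _ => (hcon l).le
      rw [Finset.sum_fiberwise] at h1
      simp only [Finset.sum_const, Finset.card_univ, Fintype.card_fin, nsmul_eq_mul] at h1
      linarith [hβ K (by omega)]
    refine ⟨Function.update c K l, fun t ht => ?_⟩
    have hu : ∀ j < K, Function.update c K l j = c j := fun j hj =>
      Function.update_of_ne (by omega) _ _
    rcases Nat.lt_succ_iff_lt_or_eq.1 ht with h | rfl
    · convert hc t h using 2
      refine Finset.filter_congr fun j hj => ?_
      rw [hu j (by have := Finset.mem_range.1 hj; omega), hu t h]
    · convert hl using 2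
      refine Finset.filter_congr fun j hj => ?_
      rw [hu j (Finset.mem_range.1 hj), Function.update_self]

variable {X : Type*} [MeasurableSpace X] {Φ : Set (X → ℝ)} {𝓓 : Set (Measure X)} {w₀ D : ℝ}

theorem length_le_of_distEluderDim_le (hdim : (distEluderDim Φ 𝓓 w₀ : ENNReal) ≤ ENNReal.ofReal D)
    (hD : 0 ≤ D) {n : ℕ} (μ : Fin n → Measure X) (hμ : ∀ i, μ i ∈ 𝓓) {w : ℝ} (hw : w₀ ≤ w)
    (h : ∀ i, ∃ φ ∈ Φ,
      Real.sqrt (∑ j ∈ Finset.univ.filter (· < i), (∫ x, φ x ∂(μ j)) ^ 2) ≤ w ∧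
      w ≤ |∫ x, φ x ∂(μ i)|) : (n : ℝ) ≤ D := by
  have h1 : (n : ℕ∞) ≤ distEluderDim Φ 𝓓 w₀ :=
    le_sSup ⟨n, rfl, μ, hμ, w, hw, h⟩
  have h2 : ((n : ℕ∞) : ENNReal) ≤ ENNReal.ofReal D := (ENat.toENNReal_le.2 h1).trans hdim
  rw [ENat.toENNReal_coe, ← ENNReal.ofReal_natCast] at h2
  exact (ENNReal.ofReal_le_ofReal_iff hD).1 h2

variable (hdim : (distEluderDim Φ 𝓓 w₀ : ENNReal) ≤ ENNReal.ofReal D) (hD : 0 ≤ D) (hw₀ : 0 < w₀)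
  {K : ℕ} {μ : ℕ → Measure X} (hμ : ∀ t < K, μ t ∈ 𝓓) {φ : ℕ → X → ℝ} (hφ : ∀ t < K, φ t ∈ Φ)
  {β : ℝ} (hβ0 : 0 ≤ β)
  (hβ : ∀ t < K, ∑ j ∈ Finset.range t, (∫ x, φ t x ∂(μ j)) ^ 2 ≤ β)
include hdim hD hw₀ hμ hφ hβ0 hβ

/-- Colour the times with ⌊β/w²⌋ + 1 colours so that past squared errors of the same colour sum to
at most w². The large times of one colour then form a sequence admissible for the Eluder dimension
at scale w, so there are at most `D` of them. -/
theorem card_large_le {w : ℝ} (hw : w₀ ≤ w) :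
    (((Finset.range K).filter fun t => w ≤ |∫ x, φ t x ∂(μ t)|).card : ℝ) ≤
      (β / w ^ 2 + 1) * D := by
  classical
  have hwpos : 0 < w := hw₀.trans_le hw
  set L : ℕ := ⌊β / w ^ 2⌋₊ + 1 with hL
  have hL1 : β < L * w ^ 2 := by
    have : β / w ^ 2 < L := by rw [hL]; push_cast; exact Nat.lt_floor_add_one _
    rwa [div_lt_iff₀ (by positivity)] at this
  have hL2 : (L : ℝ) ≤ β / w ^ 2 + 1 := by
    rw [hL]; push_cast
    linarith [Nat.floor_le (show 0 ≤ β / w ^ 2 by positivity)]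
  obtain ⟨c, hc⟩ := exists_coloring (fun j t => (∫ x, φ t x ∂(μ j)) ^ 2) hL1 hβ0 K hβ
  set T := (Finset.range K).filter fun t => w ≤ |∫ x, φ t x ∂(μ t)| with hT
  have hcard : T.card = ∑ l, (T.filter fun t => c t = l).card :=
    Finset.card_eq_sum_card_fiberwise fun _ _ => Finset.mem_univ _
  have hclass : ∀ l, ((T.filter fun t => c t = l).card : ℝ) ≤ D := by
    intro l
    set s := T.filter fun t => c t = l with hs
    set em := s.orderEmbOfFin rfl with hem
    have hmem : ∀ i, em i < K ∧ w ≤ |∫ x, φ (em i) x ∂(μ (em i))| ∧ c (em i) = l := by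
      intro i
      have h1 : em i ∈ T.filter fun t => c t = l := s.orderEmbOfFin_mem rfl i
      rw [Finset.mem_filter, hT, Finset.mem_filter, Finset.mem_range] at h1
      exact ⟨h1.1.1, h1.1.2, h1.2⟩
    refine length_le_of_distEluderDim_le hdim hD (fun i => μ (em i)) (fun i => hμ _ (hmem i).1) hw
      fun i => ⟨φ (em i), hφ _ (hmem i).1, ?_, (hmem i).2.1⟩
    refine Real.sqrt_le_iff.2 ⟨hwpos.le, le_trans ?_ (hc (em i) (hmem i).1)⟩
    refine (Finset.sum_map (Finset.univ.filter (· < i)) em.toEmbedding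
      (fun j => (∫ x, φ (em i) x ∂(μ j)) ^ 2)).symm.le.trans ?_
    -- Earlier members of the subsequence are among the earlier times of the same colour; enlarging
    -- a sum of squares to all of these is harmless.
    refine Finset.sum_le_sum_of_subset_of_nonneg ?_ fun _ _ _ => sq_nonneg _
    intro j hj
    rw [Finset.mem_map] at hj
    obtain ⟨k, hk, rfl⟩ := hj
    have hk' := (Finset.mem_filter.1 hk).2
    rw [Finset.mem_filter, Finset.mem_range]
    exact ⟨em.strictMono hk', (hmem k).2.2.trans (hmem i).2.2.symm⟩
  calc (T.card : ℝ) = ∑ l, ((T.filter fun t => c t = l).card : ℝ) := by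
        rw [hcard]; push_cast; rfl
    _ ≤ ∑ _l : Fin L, D := Finset.sum_le_sum fun l _ => hclass l
    _ = L * D := by simp
    _ ≤ _ := by gcongr

-- The weights 3·4^l w₀² are the increments of 4^l w₀², so the levels below |e| add up to a quantity
-- that dominates e². This replaces an integration over scales by `n` dyadic levels.
omit hdim hD hw₀ hμ hφ hβ0 hβ in
theorem sq_le_sum_dyadic {e : ℝ} (hw₀ : 0 ≤ w₀) (n : ℕ) (he : |e| ≤ 2 ^ n * w₀) :
    e ^ 2 ≤ w₀ ^ 2 + ∑ l ∈ Finset.range n, if 2 ^ l * w₀ ≤ |e| then 3 * 4 ^ l * w₀ ^ 2 else 0 := by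
  have hgeom : ∀ n : ℕ, ∑ l ∈ Finset.range n, 3 * (4 : ℝ) ^ l * w₀ ^ 2 = (4 ^ n - 1) * w₀ ^ 2 := by
    intro n
    induction n with
    | zero => simp
    | succ n ih => rw [Finset.sum_range_succ, ih]; ring
  induction n with
  | zero => simpa using sq_le_sq' (by linarith [neg_abs_le e]) ((le_abs_self e).trans (by simpa using he))
  | succ n ih =>
    rcases le_total (|e|) (2 ^ n * w₀) with h | h
    · refine (ih h).trans ?_
      rw [Finset.sum_range_succ, ← add_assoc]
      refine le_add_of_nonneg_right ?_
      split_ifs <;> positivity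
    · rw [Finset.sum_congr rfl (g := fun l => 3 * (4 : ℝ) ^ l * w₀ ^ 2), hgeom]
      · have : |e| ^ 2 ≤ (2 ^ (n + 1) * w₀) ^ 2 := by gcongr
        rw [sq_abs, mul_pow, ← pow_mul, mul_comm (n + 1), pow_mul] at this
        norm_num at this
        linarith
      · intro l hl
        rw [if_pos]
        refine le_trans ?_ h
        have := Finset.mem_range.1 hl
        gcongr
        · norm_num
        · omega

/-- In-sample errors bounded by `β` give a bound on the sum of the squared out-of-sample errors. -/
theorem sum_sq_le_of_distEluderDim_le {B : ℝ} (hB : ∀ t < K, |∫ x, φ t x ∂(μ t)| ≤ B) {n : ℕ}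
    (hn : B ≤ 2 ^ n * w₀) :
    ∑ t ∈ Finset.range K, (∫ x, φ t x ∂(μ t)) ^ 2 ≤ K * w₀ ^ 2 + 3 * n * (β + B ^ 2) * D := by
  set e : ℕ → ℝ := fun t => ∫ x, φ t x ∂(μ t) with he
  calc ∑ t ∈ Finset.range K, e t ^ 2
      ≤ ∑ t ∈ Finset.range K, (w₀ ^ 2 + ∑ l ∈ Finset.range n,
          if 2 ^ l * w₀ ≤ |e t| then 3 * 4 ^ l * w₀ ^ 2 else 0) :=
        Finset.sum_le_sum fun t ht => sq_le_sum_dyadic hw₀.le n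
          ((hB t (Finset.mem_range.1 ht)).trans hn)
    _ = K * w₀ ^ 2 + ∑ l ∈ Finset.range n, 3 * 4 ^ l * w₀ ^ 2 *
          ((Finset.range K).filter fun t => 2 ^ l * w₀ ≤ |e t|).card := by
        rw [Finset.sum_add_distrib, Finset.sum_comm]
        simp only [Finset.sum_const, Finset.card_range, nsmul_eq_mul]
        congr 1
        refine Finset.sum_congr rfl fun l _ => ?_
        rw [← Finset.sum_filter, Finset.sum_const, nsmul_eq_mul, mul_comm]
    _ ≤ K * w₀ ^ 2 + ∑ _l ∈ Finset.range n, 3 * (β + B ^ 2) * D := by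
        refine add_le_add le_rfl (Finset.sum_le_sum fun l hl => ?_)
        -- A level contributes only if some error reaches it, and then its scale is at most `B`.
        -- This keeps the cost of every level below 3(β + B²)D.
        rcases Nat.eq_zero_or_pos
          ((Finset.range K).filter fun t => 2 ^ l * w₀ ≤ |e t|).card with h0 | h0
        · rw [h0]; push_cast; rw [mul_zero]; positivity
        · obtain ⟨t, ht⟩ := Finset.card_pos.1 h0
          rw [Finset.mem_filter, Finset.mem_range] at ht
          have hlB : 2 ^ l * w₀ ≤ B := ht.2.trans (hB t ht.1)
          have hlw : w₀ ≤ 2 ^ l * w₀ := le_mul_of_one_le_left hw₀.le (one_le_pow₀ (by norm_num))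
          have h4 : (4 : ℝ) ^ l * w₀ ^ 2 = (2 ^ l * w₀) ^ 2 := by
            rw [mul_pow, ← pow_mul, mul_comm l, pow_mul]; norm_num
          have hpos : 0 < 2 ^ l * w₀ := hw₀.trans_le hlw
          calc 3 * 4 ^ l * w₀ ^ 2 * (((Finset.range K).filter fun t => 2 ^ l * w₀ ≤ |e t|).card : ℝ)
              ≤ 3 * 4 ^ l * w₀ ^ 2 * ((β / (2 ^ l * w₀) ^ 2 + 1) * D) := by
                gcongr
                exact card_large_le hdim hD hw₀ hμ hφ hβ0 hβ hlw
            _ = 3 * (β + (2 ^ l * w₀) ^ 2) * D := by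
                rw [mul_assoc 3, h4]; field_simp
            _ ≤ 3 * (β + B ^ 2) * D := by gcongr
    _ = _ := by
        rw [Finset.sum_const, Finset.card_range, nsmul_eq_mul]; ring

end Eluder

/-! ### Confidence sets -/

namespace APE

variable {S A : Type*} [MeasurableSpace S] [MeasurableSpace A] {H : ℕ}
  {F : Fin H → Finset (S × A → ℝ)} {Pol : Finset (MarkovPolicy S A H)} {β : ℝ}

theorem measurable_loss {k : ℕ} (h : Fin H) {g : S × A → ℝ} (hg : Measurable g)
    {f : Fin H → S × A → ℝ} (hf : ∀ h, Measurable (f h)) (ρ : MarkovPolicy S A H) :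
    Measurable fun D : Fin k → Fin H → S × A × ℝ => loss D h g f ρ := by
  unfold loss
  refine Finset.measurable_sum _ fun t _ => ?_
  have h1 : Measurable fun D : Fin k → Fin H → S × A × ℝ =>
      (if hh : h.1 + 1 < H then
        ρ.avg ⟨h.1 + 1, hh⟩ (f ⟨h.1 + 1, hh⟩) (D t ⟨h.1 + 1, hh⟩).1 else 0) := by
    split_ifs with hh
    · exact (ρ.measurable_avg _ (hf _)).comp
        (f := fun D : Fin k → Fin H → S × A × ℝ => (D t ⟨h.1 + 1, hh⟩).1) (by fun_prop)
    · exact measurable_const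
  fun_prop

/-- Unrolling the recursion shows membership as one constraint per prefix of the data. Survival
therefore needs bounds uniform in time, and nestedness is immediate. -/
theorem mem_confSet_iff (hβ : 0 ≤ β) {k : ℕ} (D : Fin k → Fin H → S × A × ℝ)
    (q : (Fin H → S × A → ℝ) × MarkovPolicy S A H) :
    q ∈ confSet F Pol β k D ↔ q.1 ∈ Fintype.piFinset F ∧ q.2 ∈ Pol ∧
      ∀ n, ∀ hn : n ≤ k, ∀ h, ∀ g ∈ F h, loss (fun j => D (Fin.castLE hn j)) h (q.1 h) q.1 q.2 ≤
        loss (fun j => D (Fin.castLE hn j)) h g q.1 q.2 + β := by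
  induction k with
  | zero =>
    simp only [confSet, Set.mem_ofPred_eq]
    refine ⟨fun h => ⟨h.1, h.2, fun n hn h g _ => ?_⟩, fun h => ⟨h.1, h.2.1⟩⟩
    -- Without data both losses are empty sums, so the constraint reads 0 ≤ β.
    obtain rfl : n = 0 := by omega
    simpa [loss] using hβ
  | succ k ih =>
    simp only [confSet, Set.mem_inter_iff, Set.mem_ofPred_eq, ih]
    constructor
    · rintro ⟨⟨h1, h2, h3⟩, -, -, h4⟩
      refine ⟨h1, h2, fun n hn => ?_⟩
      rcases Nat.lt_or_ge k n with h | h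
      · obtain rfl : n = k + 1 := by omega
        exact h3
      · exact h4 n h
    · rintro ⟨h1, h2, h3⟩
      exact ⟨⟨h1, h2, h3 (k + 1) le_rfl⟩, h1, h2, fun n hn => h3 n (by omega)⟩

theorem confSet_castLE_subset (hβ : 0 ≤ β) {k n : ℕ} (hn : n ≤ k)
    (D : Fin k → Fin H → S × A × ℝ) :
    confSet F Pol β k D ⊆ confSet F Pol β n (fun j => D (Fin.castLE hn j)) := by
  intro q hq
  rw [mem_confSet_iff hβ] at hq ⊢
  exact ⟨hq.1, hq.2.1, fun l hl => hq.2.2 l (hl.trans hn)⟩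

theorem confSet_subset {k : ℕ} (D : Fin k → Fin H → S × A × ℝ) :
    ∀ q ∈ confSet F Pol β k D, q.1 ∈ Fintype.piFinset F ∧ q.2 ∈ Pol := by
  cases k with
  | zero => exact fun q hq => hq
  | succ k => exact fun q hq => ⟨hq.1.1, hq.1.2.1⟩

theorem measurableSet_mem_confSet (hF : ∀ h, ∀ f ∈ F h, Measurable f) (k : ℕ)
    (q : (Fin H → S × A → ℝ) × MarkovPolicy S A H) :
    MeasurableSet {D | q ∈ confSet F Pol β k D} := by
  by_cases hq : q.1 ∈ Fintype.piFinset F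
  swap
  · convert MeasurableSet.empty using 1
    ext D
    simp only [Set.mem_ofPred_eq, Set.mem_empty_iff_false, iff_false]
    exact fun h => hq (confSet_subset D q h).1
  have hq1 : ∀ h, Measurable (q.1 h) := fun h => hF h _ (Fintype.mem_piFinset.1 hq h)
  induction k with
  | zero => exact MeasurableSet.const _
  | succ k ih =>
    have hset : {D | q ∈ confSet F Pol β (k + 1) D} =
        {D : Fin (k + 1) → Fin H → S × A × ℝ | q.1 ∈ Fintype.piFinset F ∧ q.2 ∈ Pol} ∩
        (⋂ h, ⋂ g ∈ F h, {D | loss D h (q.1 h) q.1 q.2 ≤ loss D h g q.1 q.2 + β}) ∩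
        (fun D j => D (Fin.castSucc j)) ⁻¹' {D | q ∈ confSet F Pol β k D} := by
      ext D
      simp only [confSet, Set.mem_inter_iff, Set.mem_ofPred_eq, Set.mem_iInter, Set.mem_preimage,
        and_assoc]
      rfl
    rw [hset]
    refine ((MeasurableSet.const _).inter ?_).inter (ih.preimage (by fun_prop))
    refine MeasurableSet.iInter fun h => Finset.measurableSet_biInter _ fun g hg => ?_
    exact measurableSet_le (measurable_loss h (hq1 h) hq1 _)
      ((measurable_loss h (hF h g hg) hq1 _).add_const _)

/-- The confidence set takes finitely many values, so everything that is computed from it depends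
measurably on the data. -/
theorem measurable_comp_confSet (hF : ∀ h, ∀ f ∈ F h, Measurable f) (k : ℕ) {Y : Type*}
    [MeasurableSpace Y] (Φ : Set ((Fin H → S × A → ℝ) × MarkovPolicy S A H) → Y) :
    Measurable fun D => Φ (confSet F Pol β k D) := by
  set st : (Fin k → Fin H → S × A × ℝ) → (Fintype.piFinset F × Pol → Prop) :=
    fun D q => (q.1.1, q.2.1) ∈ confSet F Pol β k D with hst
  have hstm : Measurable st := by
    rw [measurable_pi_iff]
    exact fun q => measurableSet_setOfPred.1 (measurableSet_mem_confSet hF k (q.1.1, q.2.1))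
  have : (fun D => Φ (confSet F Pol β k D)) =
      (fun p : Fintype.piFinset F × Pol → Prop => Φ {q | ∃ h1 h2, p (⟨q.1, h1⟩, ⟨q.2, h2⟩)}) ∘ st := by
    funext D
    simp only [Function.comp_apply]
    congr 1
    ext q
    simp only [hst, Set.mem_ofPred_eq]
    exact ⟨fun h => ⟨(confSet_subset D q h).1, (confSet_subset D q h).2, h⟩, fun ⟨_, _, h⟩ => h⟩
  rw [this]
  exact Measurable.of_discrete.comp hstm

/-- The joint form, for scores that pair the past with a fresh observation. The past matters only
through a membership pattern in a countable space, so measurability in the second argument suffices.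
-/
theorem measurable_uncurry_confSet (hF : ∀ h, ∀ f ∈ F h, Measurable f) (k : ℕ) {Y : Type*}
    [MeasurableSpace Y] {Φ : Set ((Fin H → S × A → ℝ) × MarkovPolicy S A H) → Y → ℝ}
    (hΦ : ∀ C, Measurable (Φ C)) :
    Measurable fun p : (Fin k → Fin H → S × A × ℝ) × Y => Φ (confSet F Pol β k p.1) p.2 := by
  set st : (Fin k → Fin H → S × A × ℝ) → (Fintype.piFinset F × Pol → Prop) :=
    fun D q => (q.1.1, q.2.1) ∈ confSet F Pol β k D with hst
  have hstm : Measurable st :=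
    measurable_comp_confSet hF k (fun C (q : Fintype.piFinset F × Pol) => (q.1.1, q.2.1) ∈ C)
  have : (fun p : (Fin k → Fin H → S × A × ℝ) × Y => Φ (confSet F Pol β k p.1) p.2) =
      (fun p : (Fintype.piFinset F × Pol → Prop) × Y =>
        Φ {q | ∃ h1 h2, p.1 (⟨q.1, h1⟩, ⟨q.2, h2⟩)} p.2) ∘ (fun p => (st p.1, p.2)) := by
    funext p
    simp only [Function.comp_apply]
    congr 1
    ext q
    simp only [hst, Set.mem_ofPred_eq]
    exact ⟨fun h => ⟨(confSet_subset _ q h).1, (confSet_subset _ q h).2, h⟩, fun ⟨_, _, h⟩ => h⟩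
  rw [this]
  refine Measurable.comp ?_ ((hstm.comp measurable_fst).prodMk measurable_snd)
  exact measurable_from_prod_countable_right fun p =>
    hΦ {q | ∃ h1 h2, p (⟨q.1, h1⟩, ⟨q.2, h2⟩)}

variable (s₁ : S) (Pol) in
/-- `candidates` as a function of the confidence set. -/
def candidatesOf (C : Set ((Fin H → S × A → ℝ) × MarkovPolicy S A H)) : Finset Pol := by
  classical
  exact Finset.univ.filter fun π => ∀ π' : Pol,
    (⨆ f : {f : Fin H → S × A → ℝ // (f, π'.1) ∈ C}, initValue s₁ f.1 π'.1) -
      (⨅ f : {f : Fin H → S × A → ℝ // (f, π'.1) ∈ C}, initValue s₁ f.1 π'.1) ≤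
    (⨆ f : {f : Fin H → S × A → ℝ // (f, π.1) ∈ C}, initValue s₁ f.1 π.1) -
      (⨅ f : {f : Fin H → S × A → ℝ // (f, π.1) ∈ C}, initValue s₁ f.1 π.1)

theorem candidates_eq (s₁ : S) {k : ℕ} (D : Fin k → Fin H → S × A × ℝ) :
    candidates s₁ F Pol β D = candidatesOf Pol s₁ (confSet F Pol β k D) := by
  unfold candidates candidatesOf upper lower
  congr

theorem candidates_nonempty (hPol : Pol.Nonempty) (s₁ : S) {k : ℕ}
    (D : Fin k → Fin H → S × A × ℝ) : (candidates s₁ F Pol β D).Nonempty := by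
  have : Nonempty Pol := hPol.to_subtype
  obtain ⟨π, -, hπ⟩ := Finset.exists_max_image (Finset.univ : Finset Pol)
    (fun π => upper s₁ F Pol β D π.1 - lower s₁ F Pol β D π.1) Finset.univ_nonempty
  exact ⟨π, by simpa [candidates] using fun a ha => hπ ⟨a, ha⟩ (Finset.mem_univ _)⟩

theorem le_of_mem_candidates {s₁ : S} {k : ℕ} {D : Fin k → Fin H → S × A × ℝ} {π : Pol}
    (hπ : π ∈ candidates s₁ F Pol β D) (π' : Pol) :
    upper s₁ F Pol β D π'.1 - lower s₁ F Pol β D π'.1 ≤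
      upper s₁ F Pol β D π.1 - lower s₁ F Pol β D π.1 := by
  classical
  unfold candidates at hπ
  exact (Finset.mem_filter.1 hπ).2 π'

variable {s₁ : S} {k : ℕ} {D : Fin k → Fin H → S × A × ℝ} {ρ : MarkovPolicy S A H}

instance : Finite {f : Fin H → S × A → ℝ // (f, ρ) ∈ confSet F Pol β k D} := by
  refine Finite.of_injective (β := Fintype.piFinset F)
    (fun f => ⟨f.1, (confSet_subset D _ f.2).1⟩) fun a b hab => ?_
  exact Subtype.ext (congrArg (fun x => x.1) hab)

theorem initValue_le_upper {f : Fin H → S × A → ℝ} (hf : (f, ρ) ∈ confSet F Pol β k D) :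
    initValue s₁ f ρ ≤ upper s₁ F Pol β D ρ :=
  le_ciSup (f := fun f : {f // (f, ρ) ∈ confSet F Pol β k D} => initValue s₁ f.1 ρ)
    (Set.finite_range _).bddAbove ⟨f, hf⟩

theorem lower_le_initValue {f : Fin H → S × A → ℝ} (hf : (f, ρ) ∈ confSet F Pol β k D) :
    lower s₁ F Pol β D ρ ≤ initValue s₁ f ρ :=
  ciInf_le (f := fun f : {f // (f, ρ) ∈ confSet F Pol β k D} => initValue s₁ f.1 ρ)
    (Set.finite_range _).bddBelow ⟨f, hf⟩

theorem exists_eq_upper (h : ∃ f, (f, ρ) ∈ confSet F Pol β k D) :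
    ∃ f, (f, ρ) ∈ confSet F Pol β k D ∧ initValue s₁ f ρ = upper s₁ F Pol β D ρ := by
  have : Nonempty {f // (f, ρ) ∈ confSet F Pol β k D} := ⟨⟨h.choose, h.choose_spec⟩⟩
  obtain ⟨f, hf⟩ := exists_eq_ciSup_of_finite
    (f := fun f : {f // (f, ρ) ∈ confSet F Pol β k D} => initValue s₁ f.1 ρ)
  exact ⟨f.1, f.2, hf⟩

theorem exists_eq_lower (h : ∃ f, (f, ρ) ∈ confSet F Pol β k D) :
    ∃ f, (f, ρ) ∈ confSet F Pol β k D ∧ initValue s₁ f ρ = lower s₁ F Pol β D ρ := by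
  have : Nonempty {f // (f, ρ) ∈ confSet F Pol β k D} := ⟨⟨h.choose, h.choose_spec⟩⟩
  obtain ⟨f, hf⟩ := exists_eq_ciInf_of_finite
    (f := fun f : {f // (f, ρ) ∈ confSet F Pol β k D} => initValue s₁ f.1 ρ)
  exact ⟨f.1, f.2, hf⟩

theorem upper_mem_Icc (hF : ∀ h, ∀ f ∈ F h, Measurable f ∧ ∀ x, f x ∈ Set.Icc (0 : ℝ) H) :
    upper s₁ F Pol β D ρ ∈ Set.Icc (0 : ℝ) H := by
  have hv : ∀ f : {f // (f, ρ) ∈ confSet F Pol β k D}, initValue s₁ f.1 ρ ∈ Set.Icc (0 : ℝ) H := by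
    intro f
    have hf := Fintype.mem_piFinset.1 (confSet_subset D _ f.2).1
    unfold initValue
    split_ifs with hh
    · exact ρ.avg_mem_Icc _ (hF _ _ (hf _)).1 (hF _ _ (hf _)).2 _
    · exact ⟨le_rfl, by positivity⟩
  -- These forms of the bounds also cover an empty index set, where the supremum is 0.
  exact ⟨Real.iSup_nonneg fun f => (hv f).1, Real.iSup_le (fun f => (hv f).2) (by positivity)⟩

end APE

/-! ### Explorative all-policy evaluation -/

theorem nextFn_mem_nextClass {X : Type*} {H : ℕ} {F : Fin H → Finset (X → ℝ)}
    {f : Fin H → X → ℝ} (hf : f ∈ Fintype.piFinset F) (h : Fin H) :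
    nextFn f h ∈ nextClass F h := by
  unfold nextFn nextClass
  split_ifs with hh
  · exact Fintype.mem_piFinset.1 hf _
  · exact Finset.mem_singleton_self _

namespace MarkovGame

variable {m H : ℕ} {S : Type*} [MeasurableSpace S] {A : Fin m → Type*}
  [∀ i, MeasurableSpace (A i)]

/-- The assumptions on the classes of player `i` for policy evaluation against `π_{-i}`. -/
structure EvalClass (G : MarkovGame m H S A) (i : Fin m) (Fi : Fin H → Finset (S × A i → ℝ))
    (Poli : Finset (MarkovPolicy S (A i) H)) (π : ∀ j, MarkovPolicy S (A j) H) : Prop where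
  nonempty : Poli.Nonempty
  regular : ∀ h, ∀ f ∈ Fi h, Measurable f ∧ ∀ x, f x ∈ Set.Icc (0 : ℝ) H
  complete : ∀ h, ∀ g ∈ nextClass Fi h, ∀ ρ ∈ Poli,
    G.bellman i (Function.update π i ρ) h g ∈ Fi h

variable (G : MarkovGame m H S A) (i : Fin m) (Fi : Fin H → Finset (S × A i → ℝ))
  (Poli : Finset (MarkovPolicy S (A i) H)) (sel : Finset Poli → Poli) (β : ℝ)
  (π : ∀ j, MarkovPolicy S (A j) H)

/-- The Bellman residual of `f` for the policy `ρ`. -/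
def residual (ρ : MarkovPolicy S (A i) H) (f : Fin H → S × A i → ℝ) (h : Fin H) :
    S × A i → ℝ :=
  fun x => f h x - G.bellman i (Function.update π i ρ) h (nextFn f h) x

/-- The exponent that controls the excess squared loss of `g` over the Bellman backup of `f`. -/
def excessScore (h : Fin H) (g : S × A i → ℝ) (f : Fin H → S × A i → ℝ)
    (ρ : MarkovPolicy S (A i) H) (x : Fin H → S × A i × ℝ) : ℝ :=
  -(1 / (4 * (H : ℝ) ^ 2)) * ((g ((x h).1, (x h).2.1) - (x h).2.2 -
      (if hh : h.1 + 1 < H then ρ.avg ⟨h.1 + 1, hh⟩ (f ⟨h.1 + 1, hh⟩) (x ⟨h.1 + 1, hh⟩).1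
        else 0)) ^ 2 -
    (G.bellman i (Function.update π i ρ) h (nextFn f h) ((x h).1, (x h).2.1) - (x h).2.2 -
      (if hh : h.1 + 1 < H then ρ.avg ⟨h.1 + 1, hh⟩ (f ⟨h.1 + 1, hh⟩) (x ⟨h.1 + 1, hh⟩).1
        else 0)) ^ 2) +
  1 / (4 * (H : ℝ) ^ 2) / 2 * (g ((x h).1, (x h).2.1) -
    G.bellman i (Function.update π i ρ) h (nextFn f h) ((x h).1, (x h).2.1)) ^ 2

theorem score_excessScore (h : Fin H) (g : S × A i → ℝ) (f : Fin H → S × A i → ℝ)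
    (ρ : MarkovPolicy S (A i) H) {n : ℕ} (D : Fin n → Fin H → S × A i × ℝ) :
    score (fun _ _ => G.excessScore i π h g f ρ) n D =
      -(1 / (4 * (H : ℝ) ^ 2)) * (APE.loss D h g f ρ -
        APE.loss D h (G.bellman i (Function.update π i ρ) h (nextFn f h)) f ρ) +
      1 / (4 * (H : ℝ) ^ 2) / 2 * ∑ j, (g ((D j h).1, (D j h).2.1) -
        G.bellman i (Function.update π i ρ) h (nextFn f h) ((D j h).1, (D j h).2.1)) ^ 2 := by
  simp only [score, excessScore, APE.loss]
  rw [Finset.sum_add_distrib, ← Finset.mul_sum, ← Finset.mul_sum, Finset.sum_sub_distrib]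

/-- The policy that is played when the confidence set is `C`. -/
def playedOf (C : Set ((Fin H → S × A i → ℝ) × MarkovPolicy S (A i) H)) : Poli :=
  sel (APE.candidatesOf Poli G.s₁ C)

/-- The exponent that compares the population and the empirical squared Bellman residuals of a
pair selected by means of the confidence set. -/
def residualScore (h : Fin H)
    (q : Set ((Fin H → S × A i → ℝ) × MarkovPolicy S (A i) H) → Fintype.piFinset Fi × Poli)
    (n : ℕ) (D : Fin n → Fin H → S × A i × ℝ) (x : Fin H → S × A i × ℝ) : ℝ :=
  -(G.residual i π (q (APE.confSet Fi Poli β n D)).2.1 (q (APE.confSet Fi Poli β n D)).1.1 h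
      ((x h).1, (x h).2.1) ^ 2 / (H : ℝ) ^ 2) +
    (∫ y, G.residual i π (q (APE.confSet Fi Poli β n D)).2.1
        (q (APE.confSet Fi Poli β n D)).1.1 h y ^ 2
      ∂(G.occupancy i (Function.update π i
        (G.playedOf i Poli sel (APE.confSet Fi Poli β n D)).1) h)) / (2 * (H : ℝ) ^ 2)

/-- The law of the observations of one episode of policy evaluation given the data. -/
def apeKernel (hF : ∀ h, ∀ f ∈ Fi h, Measurable f) (n : ℕ) :
    Kernel (Fin n → Fin H → S × A i × ℝ) (Fin H → S × A i × ℝ) where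
  toFun D := (G.episode (Function.update π i
    (G.playedOf i Poli sel (APE.confSet Fi Poli β n D)).1)).map (G.obs i)
  measurable' := APE.measurable_comp_confSet hF n fun C =>
    (G.episode (Function.update π i (G.playedOf i Poli sel C).1)).map (G.obs i)

theorem measurable_obs : Measurable (G.obs i) := by
  unfold obs
  rw [measurable_pi_iff]
  intro h
  have := (G.measurable_r i h).comp (measurable_pi_apply (X := fun _ => S × (∀ i, A i)) h)
  exact Measurable.prodMk (by fun_prop) (Measurable.prodMk (by fun_prop) this)

instance (hF : ∀ h, ∀ f ∈ Fi h, Measurable f) (n : ℕ) :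
    IsMarkovKernel (G.apeKernel i Fi Poli sel β π hF n) :=
  ⟨fun _ => Measure.isProbabilityMeasure_map (G.measurable_obs i).aemeasurable⟩

theorem isSequentialLaw_apeLaw (hF : ∀ h, ∀ f ∈ Fi h, Measurable f) :
    IsSequentialLaw (apeLaw G i Fi Poli sel β π) (G.apeKernel i Fi Poli sel β π hF) where
  zero := rfl
  succ n := by
    rw [apeLaw]
    congr 1
    funext D
    have hs : Measurable fun x : Fin H → S × A i × ℝ =>
        (Fin.snoc (α := fun _ => Fin H → S × A i × ℝ) D x : Fin (n + 1) → _) :=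
      measurable_fin_snoc.comp measurable_prodMk_left
    change _ = ((G.episode (Function.update π i
      (G.playedOf i Poli sel (APE.confSet Fi Poli β n D)).1)).map (G.obs i)).map _
    rw [Measure.map_map hs (G.measurable_obs i), playedOf, ← APE.candidates_eq]
    rfl
  markov n := inferInstance

/-- On [0, 1] one has exp(−u) ≤ 1 − u/2, and then (1 − v)exp(v) ≤ 1 with v half the mean of u. Its
use is a multiplicative comparison of squares, population at most twice empirical plus a constant,
without the square-root loss of an additive bound. -/
theorem lintegral_exp_sq_le_one {X : Type*} [MeasurableSpace X] (μ : Measure X)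
    [IsProbabilityMeasure μ] {φ : X → ℝ} (hφ : Measurable φ) {B : ℝ} (hB : 0 < B)
    (hφB : ∀ x, |φ x| ≤ B) :
    ∫⁻ x, ENNReal.ofReal (Real.exp (-(φ x ^ 2 / B ^ 2) + (∫ y, φ y ^ 2 ∂μ) / (2 * B ^ 2))) ∂μ
      ≤ 1 := by
  set v := (∫ y, φ y ^ 2 ∂μ) / (2 * B ^ 2) with hv
  have hu : ∀ x, φ x ^ 2 / B ^ 2 ∈ Set.Icc (0 : ℝ) 1 := by
    intro x
    refine ⟨by positivity, (div_le_one (by positivity)).2 ?_⟩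
    rw [← sq_abs]
    exact pow_le_pow_left₀ (abs_nonneg _) (hφB x) 2
  have hi : Integrable (fun x => φ x ^ 2 / B ^ 2) μ :=
    Integrable.of_mem_Icc 0 1 (by fun_prop) (ae_of_all _ hu)
  have hexp : ∀ x, Real.exp (-(φ x ^ 2 / B ^ 2)) ≤ 1 - φ x ^ 2 / B ^ 2 / 2 := by
    intro x
    obtain ⟨h0, h1⟩ := hu x
    set u := φ x ^ 2 / B ^ 2
    have h2 := Real.add_one_le_exp u
    rw [Real.exp_neg, inv_le_iff_one_le_mul₀ (Real.exp_pos _)]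
    nlinarith
  calc _ ≤ ∫⁻ x, ENNReal.ofReal ((1 - φ x ^ 2 / B ^ 2 / 2) * Real.exp v) ∂μ := by
        refine lintegral_mono fun x => ENNReal.ofReal_le_ofReal ?_
        rw [Real.exp_add]
        gcongr
        exact hexp x
    _ = ENNReal.ofReal (∫ x, (1 - φ x ^ 2 / B ^ 2 / 2) * Real.exp v ∂μ) := by
        refine (ofReal_integral_eq_lintegral_ofReal ?_ (ae_of_all _ fun x => ?_)).symm
        · exact ((integrable_const _).sub (hi.div_const 2)).mul_const _
        · have := hu x
          exact mul_nonneg (by linarith [this.2]) (Real.exp_pos _).le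
    _ = ENNReal.ofReal ((1 - v) * Real.exp v) := by
        rw [integral_mul_const, integral_sub (integrable_const _) (hi.div_const 2)]
        simp only [integral_const, probReal_univ, smul_eq_mul, mul_one, integral_div]
        congr 3
        rw [hv]; field_simp
    _ ≤ 1 := by
        rw [← ENNReal.ofReal_one]
        refine ENNReal.ofReal_le_ofReal ?_
        have := Real.add_one_le_exp (-v)
        calc (1 - v) * Real.exp v ≤ Real.exp (-v) * Real.exp v := by gcongr; linarith
          _ = 1 := by rw [← Real.exp_add]; simp

namespace EvalClass

variable {G i Fi Poli π}

variable (E : G.EvalClass i Fi Poli π)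
include E

theorem nextFn_regular {f : Fin H → S × A i → ℝ} (hf : f ∈ Fintype.piFinset Fi) (h : Fin H) :
    Measurable (nextFn f h) ∧ ∀ x, nextFn f h x ∈ Set.Icc (0 : ℝ) H := by
  unfold nextFn
  split_ifs with hh
  · exact E.regular _ _ (Fintype.mem_piFinset.1 hf _)
  · exact ⟨measurable_const, fun x => ⟨le_rfl, by simp⟩⟩

theorem bellman_mem {f : Fin H → S × A i → ℝ} (hf : f ∈ Fintype.piFinset Fi) (h : Fin H)
    {ρ : MarkovPolicy S (A i) H} (hρ : ρ ∈ Poli) :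
    G.bellman i (Function.update π i ρ) h (nextFn f h) ∈ Fi h :=
  E.complete h _ (nextFn_mem_nextClass hf h) ρ hρ

theorem measurable_residual {f : Fin H → S × A i → ℝ} (hf : f ∈ Fintype.piFinset Fi) (h : Fin H)
    {ρ : MarkovPolicy S (A i) H} (hρ : ρ ∈ Poli) : Measurable (G.residual i π ρ f h) :=
  (E.regular h _ (Fintype.mem_piFinset.1 hf h)).1.sub (E.regular h _ (E.bellman_mem hf h hρ)).1

theorem abs_residual_le {f : Fin H → S × A i → ℝ} (hf : f ∈ Fintype.piFinset Fi) (h : Fin H)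
    {ρ : MarkovPolicy S (A i) H} (hρ : ρ ∈ Poli) (x : S × A i) :
    |G.residual i π ρ f h x| ≤ H := by
  have h1 := (E.regular h _ (Fintype.mem_piFinset.1 hf h)).2 x
  have h2 := (E.regular h _ (E.bellman_mem hf h hρ)).2 x
  unfold residual
  rw [abs_le]
  constructor <;> linarith [h1.1, h1.2, h2.1, h2.2]

theorem measurable_excessScore (h : Fin H) {g : S × A i → ℝ} (hg : g ∈ Fi h)
    {f : Fin H → S × A i → ℝ} (hf : f ∈ Fintype.piFinset Fi)
    {ρ : MarkovPolicy S (A i) H} (hρ : ρ ∈ Poli) :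
    Measurable (G.excessScore i π h g f ρ) := by
  have hgm := (E.regular h _ hg).1
  have hb := (E.regular h _ (E.bellman_mem hf h hρ)).1
  have h1 : Measurable fun x : Fin H → S × A i × ℝ =>
      (if hh : h.1 + 1 < H then
        ρ.avg ⟨h.1 + 1, hh⟩ (f ⟨h.1 + 1, hh⟩) (x ⟨h.1 + 1, hh⟩).1 else 0) := by
    split_ifs with hh
    · exact (ρ.measurable_avg _ (E.regular _ _ (Fintype.mem_piFinset.1 hf _)).1).comp
        (f := fun D : Fin H → S × A i × ℝ => (D ⟨h.1 + 1, hh⟩).1) (by fun_prop)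
    · exact measurable_const
  unfold excessScore
  fun_prop

/-- The exploring policy `σ` is arbitrary, so the bound holds conditionally in every episode,
whatever policy the confidence set selects there. -/
theorem lintegral_exp_excessScore_le (h : Fin H) {g : S × A i → ℝ} (hg : g ∈ Fi h)
    {f : Fin H → S × A i → ℝ} (hf : f ∈ Fintype.piFinset Fi)
    {ρ : MarkovPolicy S (A i) H} (hρ : ρ ∈ Poli) (σ : MarkovPolicy S (A i) H) :
    ∫⁻ x, ENNReal.ofReal (Real.exp (G.excessScore i π h g f ρ x))
      ∂((G.episode (Function.update π i σ)).map (G.obs i)) ≤ 1 := by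
  have hm := E.measurable_excessScore h hg hf hρ
  rw [lintegral_map (by fun_prop) (G.measurable_obs i)]
  have key := G.lintegral_exp_excessLoss_le_one (i := i) (π := Function.update π i ρ)
    (π' := Function.update π i σ)
    (fun j hj => by rw [Function.update_of_ne hj, Function.update_of_ne hj]) h
    (E.nextFn_regular hf h).1 (E.nextFn_regular hf h).2 (E.regular h _ hg).1
    (E.regular h _ (E.bellman_mem hf h hρ)).1 rfl
  refine le_trans (le_of_eq ?_) key
  refine lintegral_congr fun τ => ?_
  have h1 : (if hh : h.1 + 1 < H then ρ.avg ⟨h.1 + 1, hh⟩ (f ⟨h.1 + 1, hh⟩)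
      (G.obs i τ ⟨h.1 + 1, hh⟩).1 else 0) = (if hj : h.1 + 1 < H then
        (Function.update π i ρ i).avgNext h (nextFn f h) (τ ⟨h.1 + 1, hj⟩).1 else 0) := by
    by_cases hh : h.1 + 1 < H
    · simp [hh, MarkovPolicy.avgNext, nextFn, obs]
    · simp [hh]
  simp only [excessScore, h1]
  simp only [obs]

theorem measurable_residualScore (h : Fin H)
    (q : Set ((Fin H → S × A i → ℝ) × MarkovPolicy S (A i) H) → Fintype.piFinset Fi × Poli)
    (n : ℕ) : Measurable fun p : (Fin n → Fin H → S × A i × ℝ) × (Fin H → S × A i × ℝ) =>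
      G.residualScore i Fi Poli sel β π h q n p.1 p.2 := by
  refine APE.measurable_uncurry_confSet (fun h f hf => (E.regular h f hf).1) n
    (Y := Fin H → S × A i × ℝ) (Φ := fun C (x : Fin H → S × A i × ℝ) => -(G.residual i π (q C).2.1 (q C).1.1 h ((x h).1, (x h).2.1) ^ 2 /
      (H : ℝ) ^ 2) + (∫ y, G.residual i π (q C).2.1 (q C).1.1 h y ^ 2
        ∂(G.occupancy i (Function.update π i (G.playedOf i Poli sel C).1) h)) /
      (2 * (H : ℝ) ^ 2)) fun C => ?_
  have hm := E.measurable_residual (q C).1.2 h (q C).2.2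
  fun_prop

variable (hH : 0 < H)
include hH

theorem lintegral_exp_residualScore_le (h : Fin H)
    (q : Set ((Fin H → S × A i → ℝ) × MarkovPolicy S (A i) H) → Fintype.piFinset Fi × Poli)
    (n : ℕ) (D : Fin n → Fin H → S × A i × ℝ) :
    ∫⁻ x, ENNReal.ofReal (Real.exp (G.residualScore i Fi Poli sel β π h q n D x))
      ∂(G.apeKernel i Fi Poli sel β π (fun h f hf => (E.regular h f hf).1) n D) ≤ 1 := by
  set C := APE.confSet Fi Poli β n D with hC
  have hm := E.measurable_residual (q C).1.2 h (q C).2.2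
  have key := lintegral_exp_sq_le_one
    (G.occupancy i (Function.update π i (G.playedOf i Poli sel C).1) h) hm
    (B := H) (by exact_mod_cast hH) (E.abs_residual_le (q C).1.2 h (q C).2.2)
  have hof : Measurable fun x : Fin H → S × A i × ℝ => ((x h).1, (x h).2.1) := by fun_prop
  have hocc : G.occupancy i (Function.update π i (G.playedOf i Poli sel C).1) h =
      (G.apeKernel i Fi Poli sel β π (fun h f hf => (E.regular h f hf).1) n D).map
        fun x => ((x h).1, (x h).2.1) := by
    change _ = ((G.episode (Function.update π i (G.playedOf i Poli sel C).1)).map (G.obs i)).map _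
    rw [Measure.map_map hof (G.measurable_obs i)]
    rfl
  refine le_trans (le_of_eq ?_) key
  conv_rhs => rw [hocc]
  rw [lintegral_map (by fun_prop) hof, ← hocc]
  rfl

/-- With high probability all scores stay small throughout the `K` episodes. -/
theorem apeLaw_large_score_le {ι : Type*} [Fintype ι]
    (q : ι → Set ((Fin H → S × A i → ℝ) × MarkovPolicy S (A i) H) → Fintype.piFinset Fi × Poli)
    {a : ℝ} (ha : 0 < a) (K : ℕ) :
    apeLaw G i Fi Poli sel β π K
      {D | (∃ h, ∃ f' : Fintype.piFinset Fi, ∃ f : Fintype.piFinset Fi, ∃ ρ : Poli,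
        ∃ n, ∃ hn : n ≤ K, a ≤ score (fun _ _ => G.excessScore i π h (f'.1 h) f.1 ρ.1) n
          (fun j => D (Fin.castLE hn j))) ∨
        ∃ h, ∃ l : ι, ∃ n, ∃ hn : n ≤ K,
          a ≤ score (G.residualScore i Fi Poli sel β π h (q l)) n
          (fun j => D (Fin.castLE hn j))} ≤
      ENNReal.ofReal ((H * (∏ h, (Fi h).card) ^ 2 * Poli.card + H * Fintype.card ι) *
        Real.exp (-a)) := by
  have hF : ∀ h, ∀ f ∈ Fi h, Measurable f := fun h f hf => (E.regular h f hf).1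
  have hseq := G.isSequentialLaw_apeLaw i Fi Poli sel β π hF
  have h1 : ∀ x : Fin H × Fintype.piFinset Fi × Fintype.piFinset Fi × Poli,
      apeLaw G i Fi Poli sel β π K {D | ∃ n, ∃ hn : n ≤ K,
        a ≤ score (fun _ _ => G.excessScore i π x.1 (x.2.1.1 x.1) x.2.2.1.1 x.2.2.2.1) n
          (fun j => D (Fin.castLE hn j))} ≤ ENNReal.ofReal (Real.exp (-a)) := by
    rintro ⟨h, f', f, ρ⟩
    have hg := Fintype.mem_piFinset.1 f'.2 h
    refine hseq.measure_exists_le_score_le (fun n => ?_) (fun n D => ?_) ha K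
    · exact (E.measurable_excessScore h hg f.2 ρ.2).comp measurable_snd
    · exact E.lintegral_exp_excessScore_le h hg f.2 ρ.2 _
  have h2 : ∀ x : Fin H × ι,
      apeLaw G i Fi Poli sel β π K {D | ∃ n, ∃ hn : n ≤ K,
        a ≤ score (G.residualScore i Fi Poli sel β π x.1 (q x.2)) n
          (fun j => D (Fin.castLE hn j))} ≤ ENNReal.ofReal (Real.exp (-a)) := fun x =>
    hseq.measure_exists_le_score_le (E.measurable_residualScore sel β x.1 (q x.2))
      (E.lintegral_exp_residualScore_le sel β hH x.1 (q x.2)) ha K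
  have hsub : {D : Fin K → Fin H → S × A i × ℝ | (∃ h, ∃ f' : Fintype.piFinset Fi, ∃ f : Fintype.piFinset Fi, ∃ ρ : Poli,
        ∃ n, ∃ hn : n ≤ K, a ≤ score (fun _ _ => G.excessScore i π h (f'.1 h) f.1 ρ.1) n
          (fun j => D (Fin.castLE hn j))) ∨
        ∃ h, ∃ l : ι, ∃ n, ∃ hn : n ≤ K,
          a ≤ score (G.residualScore i Fi Poli sel β π h (q l)) n
          (fun j => D (Fin.castLE hn j))} ⊆
      (⋃ x : Fin H × Fintype.piFinset Fi × Fintype.piFinset Fi × Poli,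
        {D | ∃ n, ∃ hn : n ≤ K,
        a ≤ score (fun _ _ => G.excessScore i π x.1 (x.2.1.1 x.1) x.2.2.1.1 x.2.2.2.1) n
          (fun j => D (Fin.castLE hn j))}) ∪
      ⋃ x : Fin H × ι, {D | ∃ n, ∃ hn : n ≤ K,
        a ≤ score (G.residualScore i Fi Poli sel β π x.1 (q x.2)) n
          (fun j => D (Fin.castLE hn j))} := by
    rintro D (⟨h, f', f, ρ, hD⟩ | ⟨h, l, hD⟩)
    · exact Or.inl (Set.mem_iUnion.2 ⟨(h, f', f, ρ), hD⟩)
    · exact Or.inr (Set.mem_iUnion.2 ⟨(h, l), hD⟩)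
  refine (measure_mono hsub).trans ((measure_union_le _ _).trans ?_)
  refine (add_le_add ((measure_iUnion_fintype_le _ _).trans (Finset.sum_le_sum fun x _ => h1 x))
    ((measure_iUnion_fintype_le _ _).trans (Finset.sum_le_sum fun x _ => h2 x))).trans ?_
  rw [Finset.sum_const, Finset.sum_const, ← add_smul, nsmul_eq_mul,
    ENNReal.ofReal_mul (by positivity)]
  refine le_of_eq ?_
  congr 1
  rw [← ENNReal.ofReal_natCast]
  congr 1
  simp only [Finset.card_univ, Fintype.card_prod, Fintype.card_fin, Fintype.card_coe,
    Fintype.card_piFinset]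
  push_cast
  ring

end EvalClass

end MarkovGame

/-- Nonnegativity of the variance. The Eluder dimension concerns squared means, whereas
concentration controls mean squares. -/
theorem sq_integral_le_integral_sq {X : Type*} [MeasurableSpace X] (μ : Measure X)
    [IsProbabilityMeasure μ] {φ : X → ℝ} (hφ : Measurable φ) {B : ℝ} (hB : ∀ x, |φ x| ≤ B) :
    (∫ x, φ x ∂μ) ^ 2 ≤ ∫ x, φ x ^ 2 ∂μ := by
  have h1 : Integrable φ μ :=
    Integrable.of_mem_Icc (-B) B hφ.aemeasurable (ae_of_all _ fun x => abs_le.1 (hB x))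
  have h2 : Integrable (fun x => φ x ^ 2) μ := by
    refine Integrable.of_mem_Icc 0 (B ^ 2) (by fun_prop) (ae_of_all _ fun x => ⟨sq_nonneg _, ?_⟩)
    rw [← sq_abs]
    exact pow_le_pow_left₀ (abs_nonneg _) (hB x) 2
  set v := ∫ x, φ x ∂μ with hv
  have h3 : 0 ≤ ∫ x, (φ x - v) ^ 2 ∂μ := integral_nonneg fun x => sq_nonneg _
  have h4 : ∀ x, (φ x - v) ^ 2 = φ x ^ 2 - 2 * v * φ x + v ^ 2 := fun x => by ring
  simp only [h4] at h3
  have h5 : Integrable (fun x => 2 * v * φ x) μ := h1.const_mul _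
  have h6 : Integrable (fun x => φ x ^ 2 - 2 * v * φ x) μ := h2.sub h5
  rw [integral_add h6 (integrable_const _), integral_sub h2 h5, integral_const_mul, ← hv] at h3
  simp only [integral_const, probReal_univ, smul_eq_mul, one_mul] at h3
  nlinarith

theorem score_eq_sum_range {X : Type*} (Z : ∀ n, (Fin n → X) → X → ℝ) (D : ℕ → X) (n : ℕ) :
    score Z n (fun j => D j) = ∑ j ∈ Finset.range n, Z j (fun l => D l) (D j) :=
  Fin.sum_univ_eq_sum_range (fun j => Z j (fun l => D l) (D j)) n

/-! ### From small scores to bounds on Bellman residuals -/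

namespace MarkovGame.EvalClass

variable {m H : ℕ} {S : Type*} [MeasurableSpace S] {A : Fin m → Type*}
  [∀ i, MeasurableSpace (A i)] {G : MarkovGame m H S A} {i : Fin m}
  {Fi : Fin H → Finset (S × A i → ℝ)} {Poli : Finset (MarkovPolicy S (A i) H)}
  {π : ∀ j, MarkovPolicy S (A j) H} (E : G.EvalClass i Fi Poli π)

include E in
/-- Completeness puts the value functions of every policy into the class. -/
theorem exists_bellman_solution {ρ : MarkovPolicy S (A i) H} (hρ : ρ ∈ Poli) :
    ∃ f ∈ Fintype.piFinset Fi, ∀ h, f h = G.bellman i (Function.update π i ρ) h (nextFn f h) := by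
  -- Backward induction indexed by the number of remaining steps: `v n` belongs to step H − n, and
  -- `v 0` is the zero function of the class after the last step.
  set v : ℕ → S × A i → ℝ := fun n => Nat.rec (fun _ => 0) (fun n u =>
    if hn : n + 1 ≤ H then
      G.bellman i (Function.update π i ρ) ⟨H - (n + 1), by omega⟩ u else fun _ => 0) n with hv
  have hv0 : v 0 = 0 := rfl
  have hvs : ∀ n (hn : n + 1 ≤ H), v (n + 1) =
      G.bellman i (Function.update π i ρ) ⟨H - (n + 1), by omega⟩ (v n) := by
    intro n hn
    change dite _ _ _ = _
    rw [dif_pos hn]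
  have hmem : ∀ n (hn : n + 1 ≤ H), v (n + 1) ∈ Fi ⟨H - (n + 1), by omega⟩ := by
    intro n
    induction n with
    | zero =>
      intro hn
      rw [hvs 0 hn]
      refine E.complete _ _ ?_ ρ hρ
      have : ¬ (H - (0 + 1) + 1 < H) := by omega
      simp [nextClass, hv0, this]
    | succ n ih =>
      intro hn
      rw [hvs (n + 1) hn]
      refine E.complete _ _ ?_ ρ hρ
      have h1 : H - (n + 1 + 1) + 1 < H := by omega
      simp only [nextClass, h1, dif_pos]
      have h2 : (⟨H - (n + 1 + 1) + 1, h1⟩ : Fin H) = ⟨H - (n + 1), by omega⟩ := by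
        ext; simp; omega
      rw [h2]
      exact ih (by omega)
  have hfin : ∀ h : Fin H, ∃ n, ∃ hn : n + 1 ≤ H, h = ⟨H - (n + 1), by omega⟩ ∧ H - h.1 = n + 1 :=
    fun h => ⟨H - h.1 - 1, by omega, by ext; simp; omega, by omega⟩
  refine ⟨fun h => v (H - h.1), Fintype.mem_piFinset.2 fun h => ?_, fun h => ?_⟩
  · obtain ⟨n, hn, h1, h2⟩ := hfin h
    rw [h2, h1]
    exact hmem n hn
  · obtain ⟨n, hn, h1, h2⟩ := hfin h
    change v (H - h.1) = _
    rw [h2, hvs n hn, ← h1]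
    congr 1
    unfold nextFn
    split_ifs with hh
    · congr 1; simp; omega
    · have : n = 0 := by omega
      rw [this, hv0]

include E in
theorem initValue_sub_value {ρ : MarkovPolicy S (A i) H} (hρ : ρ ∈ Poli)
    {f : Fin H → S × A i → ℝ} (hf : f ∈ Fintype.piFinset Fi) :
    APE.initValue G.s₁ f ρ - G.value i (Function.update π i ρ) =
      ∑ h, ∫ x, G.residual i π ρ f h x ∂(G.occupancy i (Function.update π i ρ) h) := by
  have h1 := fun h => E.regular h _ (Fintype.mem_piFinset.1 hf h)
  have h2 := fun h => E.regular h _ (E.bellman_mem hf h hρ)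
  have := G.sum_integral_residual (i := i) (Function.update π i ρ) (fun h => (h1 h).1)
    (fun h => (h1 h).2) (fun h => (h2 h).1) (fun h => (h2 h).2)
  rw [Function.update_self] at this
  exact this.symm

variable (G i Fi Poli) in
/-- An element of the confidence set of the policy that is played, with the largest or the smallest
initial value. -/
def extremal (sel : Finset Poli → Poli) [Nonempty (Fintype.piFinset Fi × Poli)] (b : Bool)
    (C : Set ((Fin H → S × A i → ℝ) × MarkovPolicy S (A i) H)) : Fintype.piFinset Fi × Poli :=
  Classical.epsilon fun x => (x.1.1, x.2.1) ∈ C ∧ x.2 = G.playedOf i Poli sel C ∧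
    ∀ f, (f, (G.playedOf i Poli sel C).1) ∈ C →
      if b then APE.initValue G.s₁ f x.2.1 ≤ APE.initValue G.s₁ x.1.1 x.2.1
      else APE.initValue G.s₁ x.1.1 x.2.1 ≤ APE.initValue G.s₁ f x.2.1

/-- When every policy has a survivor, the finite extrema are attained and the choice has the desired
properties. The selector is defined for all sets so that it is a function of the past confidence set
alone, as a supermartingale comparison requires. -/
theorem extremal_spec (sel : Finset Poli → Poli) [Nonempty (Fintype.piFinset Fi × Poli)] (b : Bool)
    {β : ℝ} {n : ℕ} (D : Fin n → Fin H → S × A i × ℝ)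
    (hne : ∀ ρ ∈ Poli, ∃ f, (f, ρ) ∈ APE.confSet Fi Poli β n D) :
    let C := APE.confSet Fi Poli β n D
    let σ := G.playedOf i Poli sel C
    let x := extremal G i Fi Poli sel b C
    (x.1.1, σ.1) ∈ C ∧ x.2 = σ ∧ APE.initValue G.s₁ x.1.1 σ.1 =
      if b then APE.upper G.s₁ Fi Poli β D σ.1 else APE.lower G.s₁ Fi Poli β D σ.1 := by
  intro C σ x
  have hex : ∃ x : Fintype.piFinset Fi × Poli, (x.1.1, x.2.1) ∈ C ∧ x.2 = σ ∧
    ∀ f, (f, σ.1) ∈ C →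
      if b then APE.initValue G.s₁ f x.2.1 ≤ APE.initValue G.s₁ x.1.1 x.2.1
      else APE.initValue G.s₁ x.1.1 x.2.1 ≤ APE.initValue G.s₁ f x.2.1 := by
    cases b
    · obtain ⟨f, hf, hv⟩ := APE.exists_eq_lower (s₁ := G.s₁) (hne σ.1 σ.2)
      refine ⟨(⟨f, (APE.confSet_subset D _ hf).1⟩, σ), hf, rfl, fun g hg => ?_⟩
      simpa [hv] using APE.lower_le_initValue (s₁ := G.s₁) hg
    · obtain ⟨f, hf, hv⟩ := APE.exists_eq_upper (s₁ := G.s₁) (hne σ.1 σ.2)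
      refine ⟨(⟨f, (APE.confSet_subset D _ hf).1⟩, σ), hf, rfl, fun g hg => ?_⟩
      simpa [hv] using APE.initValue_le_upper (s₁ := G.s₁) hg
  have hx : (x.1.1, x.2.1) ∈ C ∧ x.2 = σ ∧ ∀ f, (f, σ.1) ∈ C →
      if b then APE.initValue G.s₁ f x.2.1 ≤ APE.initValue G.s₁ x.1.1 x.2.1
      else APE.initValue G.s₁ x.1.1 x.2.1 ≤ APE.initValue G.s₁ f x.2.1 :=
    Classical.epsilon_spec hex
  obtain ⟨h1, h2, h3⟩ := hx
  rw [h2] at h1 h3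
  refine ⟨h1, h2, ?_⟩
  cases b
  · obtain ⟨f, hf, hv⟩ := APE.exists_eq_lower (s₁ := G.s₁) (hne σ.1 σ.2)
    refine le_antisymm ?_ (APE.lower_le_initValue h1)
    simpa [← hv] using h3 f hf
  · obtain ⟨f, hf, hv⟩ := APE.exists_eq_upper (s₁ := G.s₁) (hne σ.1 σ.2)
    refine le_antisymm (APE.initValue_le_upper h1) ?_
    simpa [← hv] using h3 f hf

/-! Consequences of small scores for a data sequence `D`. -/

variable (hH : 0 < H) {sel : Finset Poli → Poli} {a β : ℝ} (hβ : β = 4 * (H : ℝ) ^ 2 * a)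
  (D : ℕ → Fin H → S × A i × ℝ)

include hH hβ

/-- Discarding the nonnegative quadratic term of the score leaves the loss comparison; β is the
level `a` divided by the factor 1/(4H²). -/
theorem loss_bellman_le {n : ℕ} {h : Fin H} {g : S × A i → ℝ} {f : Fin H → S × A i → ℝ}
    {ρ : MarkovPolicy S (A i) H}
    (hs : score (fun _ _ => G.excessScore i π h g f ρ) n (fun j => D j) < a) :
    APE.loss (fun j : Fin n => D j) h (G.bellman i (Function.update π i ρ) h (nextFn f h)) f ρ ≤
      APE.loss (fun j : Fin n => D j) h g f ρ + β := by
  rw [score_excessScore] at hs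
  have hH' : (0 : ℝ) < H := by exact_mod_cast hH
  have h0 : 0 ≤ ∑ j : Fin n, (g ((D j h).1, (D j h).2.1) -
        G.bellman i (Function.update π i ρ) h (nextFn f h) ((D j h).1, (D j h).2.1)) ^ 2 :=
    Finset.sum_nonneg fun _ _ => sq_nonneg _
  set c := 1 / (4 * (H : ℝ) ^ 2) with hc
  have hc0 : 0 < c := by rw [hc]; positivity
  have hcβ : c * β = a := by rw [hc, hβ]; field_simp
  rw [← sub_nonneg]
  refine le_of_mul_le_mul_left ?_ hc0
  nlinarith [mul_nonneg hc0.le h0]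

/-- Here the quadratic term is kept. With c = 1/(4H²), it is at most a plus c times the excess loss,
hence 2cβ; dividing by c/2 gives 4β. -/
theorem sum_sq_residual_le {n : ℕ} {h : Fin H} {f : Fin H → S × A i → ℝ}
    {ρ : MarkovPolicy S (A i) H}
    (hs : score (fun _ _ => G.excessScore i π h (f h) f ρ) n (fun j => D j) < a)
    (hl : APE.loss (fun j : Fin n => D j) h (f h) f ρ ≤ APE.loss (fun j : Fin n => D j) h
      (G.bellman i (Function.update π i ρ) h (nextFn f h)) f ρ + β) :
    ∑ j ∈ Finset.range n, G.residual i π ρ f h ((D j h).1, (D j h).2.1) ^ 2 ≤ 4 * β := by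
  rw [score_excessScore] at hs
  have hH' : (0 : ℝ) < H := by exact_mod_cast hH
  rw [← Fin.sum_univ_eq_sum_range
    (fun j => G.residual i π ρ f h ((D j h).1, (D j h).2.1) ^ 2)]
  simp only [residual]
  set c := 1 / (4 * (H : ℝ) ^ 2) with hc
  have hc0 : 0 < c := by rw [hc]; positivity
  have hcβ : c * β = a := by rw [hc, hβ]; field_simp
  refine le_of_mul_le_mul_left ?_ hc0
  nlinarith [mul_le_mul_of_nonneg_left hl hc0.le]

theorem sum_integral_sq_residual_le (ha : 0 < a) {n : ℕ} {h : Fin H}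
    {q : Set ((Fin H → S × A i → ℝ) × MarkovPolicy S (A i) H) → Fintype.piFinset Fi × Poli}
    (hs : score (G.residualScore i Fi Poli sel β π h q) n (fun j => D j) < a) :
    ∑ j ∈ Finset.range n, ∫ y, G.residual i π (q (APE.confSet Fi Poli β j fun l => D l)).2.1
        (q (APE.confSet Fi Poli β j fun l => D l)).1.1 h y ^ 2
      ∂(G.occupancy i (Function.update π i
        (G.playedOf i Poli sel (APE.confSet Fi Poli β j fun l => D l)).1) h) ≤
    2 * ∑ j ∈ Finset.range n, G.residual i π (q (APE.confSet Fi Poli β j fun l => D l)).2.1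
        (q (APE.confSet Fi Poli β j fun l => D l)).1.1 h ((D j h).1, (D j h).2.1) ^ 2 + β := by
  have hH' : (0 : ℝ) < H := by exact_mod_cast hH
  rw [score_eq_sum_range] at hs
  simp only [residualScore] at hs
  rw [Finset.sum_add_distrib, Finset.sum_neg_distrib, ← Finset.sum_div, ← Finset.sum_div] at hs
  set x := ∑ j ∈ Finset.range n, ∫ y, G.residual i π
        (q (APE.confSet Fi Poli β j fun l => D l)).2.1
        (q (APE.confSet Fi Poli β j fun l => D l)).1.1 h y ^ 2
      ∂(G.occupancy i (Function.update π i
        (G.playedOf i Poli sel (APE.confSet Fi Poli β j fun l => D l)).1) h)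
  set y := ∑ j ∈ Finset.range n, G.residual i π
      (q (APE.confSet Fi Poli β j fun l => D l)).2.1
        (q (APE.confSet Fi Poli β j fun l => D l)).1.1 h ((D j h).1, (D j h).2.1) ^ 2
  have h1 : (x - 2 * y) / (2 * (H : ℝ) ^ 2) < a := by
    have : (x - 2 * y) / (2 * (H : ℝ) ^ 2) = -(y / (H : ℝ) ^ 2) + x / (2 * (H : ℝ) ^ 2) := by
      field_simp; ring
    rwa [this]
  rw [div_lt_iff₀ (by positivity)] at h1
  have h2 : 0 ≤ y := Finset.sum_nonneg fun _ _ => sq_nonneg _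
  have h3 : 0 ≤ (H : ℝ) ^ 2 * a := by positivity
  linarith

end MarkovGame.EvalClass

/-! ### Accuracy of policy evaluation when all scores are small -/

namespace MarkovGame.EvalClass

variable {m H : ℕ} {S : Type*} [MeasurableSpace S] {A : Fin m → Type*}
  [∀ i, MeasurableSpace (A i)] {G : MarkovGame m H S A} {i : Fin m}
  {Fi : Fin H → Finset (S × A i → ℝ)} {Poli : Finset (MarkovPolicy S (A i) H)}
  {π : ∀ j, MarkovPolicy S (A j) H} (E : G.EvalClass i Fi Poli π)
  (hH : 0 < H) {sel : Finset Poli → Poli} {a β : ℝ} (ha : 0 < a)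
  (hβ : β = 4 * (H : ℝ) ^ 2 * a)
  (D : ℕ → Fin H → S × A i × ℝ) {K : ℕ}
  (hs1 : ∀ h (f' f : Fintype.piFinset Fi) (ρ : Poli), ∀ n ≤ K,
    score (fun _ _ => G.excessScore i π h (f'.1 h) f.1 ρ.1) n (fun j => D j) < a)
include E hH ha hβ hs1

/-- The Bellman solution has zero residuals, so its initial value is exact; and being its own
backup, it never loses to a competitor by more than β. -/
theorem exists_mem_confSet {ρ : MarkovPolicy S (A i) H} (hρ : ρ ∈ Poli) :
    ∃ f, APE.initValue G.s₁ f ρ = G.value i (Function.update π i ρ) ∧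
      ∀ n ≤ K, (f, ρ) ∈ APE.confSet Fi Poli β n (fun j => D j) := by
  have hβ0 : 0 ≤ β := by rw [hβ]; positivity
  obtain ⟨f, hf, hfb⟩ := E.exists_bellman_solution hρ
  refine ⟨f, ?_, fun n hn => ?_⟩
  · rw [← sub_eq_zero, E.initValue_sub_value hρ hf]
    refine Finset.sum_eq_zero fun h _ => ?_
    have : G.residual i π ρ f h = fun _ => 0 := by
      funext x
      rw [residual, ← hfb h, sub_self]
    rw [this]; simp
  · rw [APE.mem_confSet_iff hβ0]
    refine ⟨hf, hρ, fun k hk h g hg => ?_⟩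
    -- The scores are indexed by full tuples of which only coordinate `h` is read, so a competitor
    -- at one step is embedded into a tuple.
    have hg' : Function.update f h g ∈ Fintype.piFinset Fi := by
      rw [Fintype.mem_piFinset]
      intro h'
      rcases eq_or_ne h' h with rfl | hne
      · simpa using hg
      · simpa [Function.update_of_ne hne] using Fintype.mem_piFinset.1 hf h'
    have h1 := hs1 h ⟨_, hg'⟩ ⟨f, hf⟩ ⟨ρ, hρ⟩ k (hk.trans hn)
    simp only [Function.update_self] at h1
    have h2 := loss_bellman_le hH hβ D h1
    rw [← hfb h] at h2
    exact h2

theorem sum_sq_residual_le_of_mem {f : Fin H → S × A i → ℝ} {ρ : MarkovPolicy S (A i) H} {n : ℕ}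
    (hn : n ≤ K) (hmem : (f, ρ) ∈ APE.confSet Fi Poli β n (fun j => D j)) (h : Fin H) :
    ∑ j ∈ Finset.range n, G.residual i π ρ f h ((D j h).1, (D j h).2.1) ^ 2 ≤ 4 * β := by
  have hβ0 : 0 ≤ β := by rw [hβ]; positivity
  obtain ⟨hf, hρ, hl⟩ := (APE.mem_confSet_iff hβ0 _ _).1 hmem
  exact sum_sq_residual_le hH hβ D (hs1 h ⟨f, hf⟩ ⟨f, hf⟩ ⟨ρ, hρ⟩ n hn)
    (hl n le_rfl h _ (E.bellman_mem hf h hρ))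

variable [Nonempty (Fintype.piFinset Fi × Poli)]
  (hs2 : ∀ h (x : Fintype.piFinset Fi × Poli), ∀ n ≤ K,
    score (G.residualScore i Fi Poli sel β π h fun _ => x) n (fun j => D j) < a)
  (hs3 : ∀ h b, score (G.residualScore i Fi Poli sel β π h
    (extremal G i Fi Poli sel b)) K (fun j => D j) < a)
  {ω Dim : ℝ} (hω : 0 < ω) (hDim : 0 ≤ Dim)
  (hdim : (G.bellmanEluderDim i Fi Poli π ω : ENNReal) ≤ ENNReal.ofReal Dim)
  {N : ℕ} (hN : (H : ℝ) ≤ 2 ^ N * ω)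
include hs2 hs3 hω hDim hdim hN

/-- Concentration and the Eluder argument are applied in opposite orders for the two families of
distributions. For roll-ins, past empirical squares are first made population squares; for point
masses, the Eluder bound is applied on the data themselves and the result is then made a population
bound. -/
theorem sum_sq_integral_extremal_le (b : Bool) (h : Fin H) :
    ∑ t ∈ Finset.range K,
      (∫ y, G.residual i π (extremal G i Fi Poli sel b (APE.confSet Fi Poli β t fun l => D l)).2.1
        (extremal G i Fi Poli sel b (APE.confSet Fi Poli β t fun l => D l)).1.1 h y
      ∂(G.occupancy i (Function.update π i
        (G.playedOf i Poli sel (APE.confSet Fi Poli β t fun l => D l)).1) h)) ^ 2 ≤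
      2 * (K * ω ^ 2 + 3 * N * (9 * β + (H : ℝ) ^ 2) * Dim) + β := by
  have hβ0 : 0 ≤ β := by rw [hβ]; positivity
  set C : ℕ → Set ((Fin H → S × A i → ℝ) × MarkovPolicy S (A i) H) :=
    fun t => APE.confSet Fi Poli β t fun l => D l with hC
  set x : ℕ → Fintype.piFinset Fi × Poli := fun t => extremal G i Fi Poli sel b (C t) with hx
  set μ : ℕ → Measure (S × A i) := fun t =>
    G.occupancy i (Function.update π i (G.playedOf i Poli sel (C t)).1) h with hμ
  set φ : ℕ → S × A i → ℝ := fun t => G.residual i π (x t).2.1 (x t).1.1 h with hφ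
  have hprob : ∀ t, IsProbabilityMeasure (μ t) := fun t => by rw [hμ]; infer_instance
  have hφm : ∀ t, Measurable (φ t) := fun t => E.measurable_residual (x t).1.2 h (x t).2.2
  have hφb : ∀ t y, |φ t y| ≤ H := fun t y => E.abs_residual_le (x t).1.2 h (x t).2.2 y
  have hφmem : ∀ t, φ t ∈ G.residuals i Fi Poli π h := fun t =>
    ⟨(x t).1.1, (x t).1.2, (x t).2.1, (x t).2.2, rfl⟩
  have hne : ∀ t ≤ K, ∀ ρ ∈ Poli, ∃ f, (f, ρ) ∈ C t := by
    intro t ht ρ hρ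
    obtain ⟨f, -, hf⟩ := E.exists_mem_confSet hH ha hβ D hs1 hρ
    exact ⟨f, hf t ht⟩
  have hmem : ∀ t ≤ K, ((x t).1.1, (x t).2.1) ∈ C t := by
    intro t ht
    have := extremal_spec (G := G) (i := i) sel b (fun j : Fin t => D j) (hne t ht)
    have h1 := this.1
    rw [← this.2.1] at h1
    exact h1
  have hin : ∀ t < K, ∑ j ∈ Finset.range t, φ t ((D j h).1, (D j h).2.1) ^ 2 ≤ 4 * β :=
    fun t ht => E.sum_sq_residual_le_of_mem hH ha hβ D hs1 ht.le (hmem t ht.le) h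
  have hint : ∀ t, |∫ y, φ t y ∂(μ t)| ≤ H := by
    intro t
    have := norm_integral_le_of_norm_le_const (μ := μ t) (f := φ t) (ae_of_all _ (hφb t))
    simpa using this
  change ∑ t ∈ Finset.range K, (∫ y, φ t y ∂(μ t)) ^ 2 ≤ _
  have hN0 : (0 : ℝ) ≤ 3 * N * (9 * β + (H : ℝ) ^ 2) * Dim := by positivity
  rw [bellmanEluderDim] at hdim
  rcases min_choice
    (⨆ h, distEluderDim (G.residuals i Fi Poli π h)
      {μ | ∃ ρ ∈ Poli, μ = G.occupancy i (Function.update π i ρ) h} ω)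
    (⨆ h, distEluderDim (G.residuals i Fi Poli π h)
      {μ | ∃ x : S × A i, μ = Measure.dirac x} ω) with hmin | hmin
  · rw [hmin] at hdim
    have hd := (ENat.toENNReal_le.2 (le_iSup (fun h => distEluderDim (G.residuals i Fi Poli π h)
      {μ | ∃ ρ ∈ Poli, μ = G.occupancy i (Function.update π i ρ) h} ω) h)).trans hdim
    have hout : ∀ t < K, ∑ j ∈ Finset.range t, (∫ y, φ t y ∂(μ j)) ^ 2 ≤ 9 * β := by
      intro t ht
      -- The pair chosen at time t is tested on earlier episodes, hence is not predictable there;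
      -- the bound uniform over all fixed pairs is needed. Together with the empirical bound 4β it
      -- gives 2·4β + β = 9β.
      have h1 := sum_integral_sq_residual_le hH hβ D ha (hs2 h (x t) t ht.le)
      have h2 := hin t ht
      calc ∑ j ∈ Finset.range t, (∫ y, φ t y ∂(μ j)) ^ 2
          ≤ ∑ j ∈ Finset.range t, ∫ y, φ t y ^ 2 ∂(μ j) :=
            Finset.sum_le_sum fun j _ => sq_integral_le_integral_sq _ (hφm t) (hφb t)
        _ ≤ 2 * ∑ j ∈ Finset.range t, φ t ((D j h).1, (D j h).2.1) ^ 2 + β := h1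
        _ ≤ 9 * β := by linarith
    have := sum_sq_le_of_distEluderDim_le hd hDim hω (K := K) (μ := μ)
      (fun t _ => ⟨_, (G.playedOf i Poli sel (C t)).2, rfl⟩) (φ := φ) (fun t _ => hφmem t)
      (β := 9 * β) (by positivity) hout (B := H) (fun t _ => hint t) hN
    have hK0 : (0 : ℝ) ≤ K * ω ^ 2 := by positivity
    linarith
  · rw [hmin] at hdim
    have hd := (ENat.toENNReal_le.2 (le_iSup (fun h => distEluderDim (G.residuals i Fi Poli π h)
      {μ | ∃ x : S × A i, μ = Measure.dirac x} ω) h)).trans hdim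
    have hdir : ∀ t y, ∫ z, φ t z ∂(Measure.dirac y) = φ t y := fun t y =>
      integral_dirac' _ _ (hφm t).stronglyMeasurable
    have h1 := sum_sq_le_of_distEluderDim_le hd hDim hω (K := K)
      (μ := fun t => Measure.dirac ((D t h).1, (D t h).2.1))
      (fun t _ => ⟨_, rfl⟩) (φ := φ) (fun t _ => hφmem t)
      (β := 4 * β) (by positivity) (by simpa only [hdir] using hin) (B := H)
      (fun t _ => by rw [hdir]; exact hφb t _) hN
    simp only [hdir] at h1
    -- Here the pair varies with the episode but is determined by the preceding data, so the score
    -- of the selector itself applies.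
    have h2 := sum_integral_sq_residual_le hH hβ D ha (hs3 h b)
    have h3 : (3 * N * (4 * β + (H : ℝ) ^ 2) * Dim) ≤ 3 * N * (9 * β + (H : ℝ) ^ 2) * Dim := by
      gcongr
      norm_num
    calc ∑ t ∈ Finset.range K, (∫ y, φ t y ∂(μ t)) ^ 2
        ≤ ∑ t ∈ Finset.range K, ∫ y, φ t y ^ 2 ∂(μ t) :=
          Finset.sum_le_sum fun j _ => sq_integral_le_integral_sq _ (hφm j) (hφb j)
      _ ≤ 2 * ∑ j ∈ Finset.range K, φ j ((D j h).1, (D j h).2.1) ^ 2 + β := h2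
      _ ≤ _ := by linarith

/-- If all scores are small, then the output of policy evaluation is accurate for every policy. -/
theorem abs_upper_sub_value_le (hsel : ∀ s : Finset Poli, s.Nonempty → sel s ∈ s) (hK : 0 < K)
    {ε : ℝ} (hε : 0 ≤ ε)
    (hnum : 4 * (H : ℝ) ^ 2 * (2 * (K * ω ^ 2 + 3 * N * (9 * β + (H : ℝ) ^ 2) * Dim) + β) ≤
      K * ε ^ 2) {ρ : MarkovPolicy S (A i) H} (hρ : ρ ∈ Poli) :
    |APE.upper G.s₁ Fi Poli β (fun j : Fin (K - 1) => D j) ρ -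
      G.value i (Function.update π i ρ)| ≤ ε := by
  have hβ0 : 0 ≤ β := by rw [hβ]; positivity
  set C : ℕ → Set ((Fin H → S × A i → ℝ) × MarkovPolicy S (A i) H) :=
    fun t => APE.confSet Fi Poli β t fun l => D l with hC
  set σ : ℕ → Poli := fun t => G.playedOf i Poli sel (C t) with hσ
  set gap : ℕ → MarkovPolicy S (A i) H → ℝ := fun t ρ =>
    APE.upper G.s₁ Fi Poli β (fun j : Fin t => D j) ρ -
      APE.lower G.s₁ Fi Poli β (fun j : Fin t => D j) ρ with hgap
  set e : Bool → Fin H → ℕ → ℝ := fun b h t =>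
    ∫ y, G.residual i π (extremal G i Fi Poli sel b (C t)).2.1
        (extremal G i Fi Poli sel b (C t)).1.1 h y
      ∂(G.occupancy i (Function.update π i (σ t).1) h) with he
  set E2 := 2 * (K * ω ^ 2 + 3 * N * (9 * β + (H : ℝ) ^ 2) * Dim) + β with hE2
  have hne : ∀ t ≤ K, ∀ ρ ∈ Poli, ∃ f, (f, ρ) ∈ C t := by
    intro t ht ρ hρ
    obtain ⟨f, -, hf⟩ := E.exists_mem_confSet hH ha hβ D hs1 hρ
    exact ⟨f, hf t ht⟩
  have hval : ∀ t ≤ K, ∀ b, APE.initValue G.s₁ (extremal G i Fi Poli sel b (C t)).1.1 (σ t).1 -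
      G.value i (Function.update π i (σ t).1) = ∑ h, e b h t := by
    intro t ht b
    have h1 := extremal_spec (G := G) (i := i) sel b (fun j : Fin t => D j) (hne t ht)
    rw [E.initValue_sub_value (σ t).2 (extremal G i Fi Poli sel b (C t)).1.2]
    simp only [he]
    rw [h1.2.1]
  have hplayed : ∀ t ≤ K, gap t (σ t).1 = ∑ h, (e true h t - e false h t) := by
    intro t ht
    have h1 := extremal_spec (G := G) (i := i) sel true (fun j : Fin t => D j) (hne t ht)
    have h2 := extremal_spec (G := G) (i := i) sel false (fun j : Fin t => D j) (hne t ht)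
    have h3 := h1.2.2
    have h4 := h2.2.2
    simp only [if_true, Bool.false_eq_true, if_false] at h3 h4
    rw [Finset.sum_sub_distrib, ← hval t ht true, ← hval t ht false]
    change APE.upper _ _ _ _ _ _ - APE.lower _ _ _ _ _ _ = _
    rw [← h3, ← h4]
    ring
  have hmax : ∀ t, ∀ ρ ∈ Poli, gap t ρ ≤ gap t (σ t).1 := by
    intro t ρ hρ
    have h1 := hsel _ (APE.candidates_nonempty (F := Fi) (β := β) E.nonempty G.s₁
      (fun j : Fin t => D j))
    have h2 := APE.le_of_mem_candidates h1 ⟨ρ, hρ⟩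
    rw [APE.candidates_eq] at h2
    exact h2
  -- Nested confidence sets have shrinking intervals; survival of the true value keeps the sets
  -- nonempty, away from the default value 0.
  have hanti : ∀ t ≤ K - 1, gap (K - 1) ρ ≤ gap t ρ := by
    intro t ht
    have hsub : C (K - 1) ⊆ C t := APE.confSet_castLE_subset hβ0 ht (fun j : Fin (K - 1) => D j)
    obtain ⟨f, hf, hfv⟩ := APE.exists_eq_upper (s₁ := G.s₁) (hne (K - 1) (by omega) ρ hρ)
    obtain ⟨g, hg, hgv⟩ := APE.exists_eq_lower (s₁ := G.s₁) (hne (K - 1) (by omega) ρ hρ)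
    change APE.upper _ _ _ _ _ _ - APE.lower _ _ _ _ _ _ ≤
      APE.upper _ _ _ _ _ _ - APE.lower _ _ _ _ _ _
    rw [← hfv, ← hgv]
    exact sub_le_sub (APE.initValue_le_upper (hsub hf)) (APE.lower_le_initValue (hsub hg))
  have hE20 : 0 ≤ E2 := by positivity
  -- Cauchy–Schwarz over the episodes converts the bound on squared errors into one on their sum.
  have hsum : ∀ b h, ∑ t ∈ Finset.range K, |e b h t| ≤ Real.sqrt (K * E2) := by
    intro b h
    refine Real.le_sqrt_of_sq_le ?_
    have h1 := E.sum_sq_integral_extremal_le hH ha hβ D hs1 hs2 hs3 hω hDim hdim hN b h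
    have h2 := sq_sum_le_card_mul_sum_sq (s := Finset.range K) (f := fun t => |e b h t|)
    simp only [sq_abs, Finset.card_range] at h2
    exact h2.trans (mul_le_mul_of_nonneg_left h1 (by positivity))
  -- The last width is at most every earlier width of `ρ`, hence at most that of the policy played
  -- at each time. The 2H error sequences come from two extremal functions at H steps.
  have hfin : (K : ℝ) * gap (K - 1) ρ ≤ 2 * H * Real.sqrt (K * E2) := by
    calc (K : ℝ) * gap (K - 1) ρ = ∑ _t ∈ Finset.range K, gap (K - 1) ρ := by simp
      _ ≤ ∑ t ∈ Finset.range K, ∑ h, (|e true h t| + |e false h t|) := by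
          refine Finset.sum_le_sum fun t ht => ?_
          have ht' := Finset.mem_range.1 ht
          refine (hanti t (by omega)).trans ((hmax t ρ hρ).trans ?_)
          rw [hplayed t ht'.le]
          refine Finset.sum_le_sum fun h _ => ?_
          linarith [le_abs_self (e true h t), neg_abs_le (e false h t)]
      _ = ∑ h, (∑ t ∈ Finset.range K, |e true h t| + ∑ t ∈ Finset.range K, |e false h t|) := by
          rw [Finset.sum_comm]
          simp only [Finset.sum_add_distrib]
      _ ≤ ∑ _h : Fin H, (Real.sqrt (K * E2) + Real.sqrt (K * E2)) :=
          Finset.sum_le_sum fun h _ => add_le_add (hsum true h) (hsum false h)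
      _ = _ := by simp; ring
  have hKr : (0 : ℝ) < K := by exact_mod_cast hK
  have hR : 2 * H * Real.sqrt (K * E2) ≤ K * ε := by
    refine abs_le_of_sq_le_sq' ?_ (by positivity) |>.2
    rw [mul_pow, Real.sq_sqrt (by positivity)]
    nlinarith [mul_le_mul_of_nonneg_left hnum hKr.le]
  have hle : gap (K - 1) ρ ≤ ε := le_of_mul_le_mul_left (hfin.trans hR) hKr
  -- The true value lies between the lower and the upper estimate, so the width bounds the error.
  obtain ⟨f, hfv, hf⟩ := E.exists_mem_confSet hH ha hβ D hs1 hρ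
  have h1 := APE.initValue_le_upper (s₁ := G.s₁) (hf (K - 1) (by omega))
  have h2 := APE.lower_le_initValue (s₁ := G.s₁) (hf (K - 1) (by omega))
  rw [hfv] at h1 h2
  rw [abs_of_nonneg (by linarith)]
  change APE.upper _ _ _ _ _ _ - APE.lower _ _ _ _ _ _ ≤ _ at hle
  linarith

end MarkovGame.EvalClass

/-! ### Measurability and finite range of the estimates -/

namespace APE

variable {S A : Type*} [MeasurableSpace S] [MeasurableSpace A] {H : ℕ}
  {F : Fin H → Finset (S × A → ℝ)} {Pol : Finset (MarkovPolicy S A H)} {β : ℝ}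

theorem measurable_output (hF : ∀ h, ∀ f ∈ F h, Measurable f) (s₁ : S) {K : ℕ} (ρ : Pol) :
    Measurable fun D : Fin K → Fin H → S × A × ℝ => output s₁ F Pol β D ρ :=
  (measurable_comp_confSet hF (K - 1)
    fun C => ⨆ f : {f : Fin H → S × A → ℝ // (f, ρ.1) ∈ C}, initValue s₁ f.1 ρ.1).comp
    (f := fun (D : Fin K → Fin H → S × A × ℝ) j => D (Fin.castLE (Nat.sub_le K 1) j))
    (by fun_prop)

/-- An estimate is a function of a subset of a finite set. Hence any function of the estimates,
Hedge weights included, is measurable without further regularity. -/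
theorem finite_range_output (s₁ : S) (K : ℕ) (ρ : Pol) :
    (Set.range fun D : Fin K → Fin H → S × A × ℝ => output s₁ F Pol β D ρ).Finite := by
  have hfin : (𝒫 ((Fintype.piFinset F : Set (Fin H → S × A → ℝ)) ×ˢ
      (Pol : Set (MarkovPolicy S A H)))).Finite :=
    (Set.Finite.prod (Finset.finite_toSet _) (Finset.finite_toSet _)).powerset
  refine (hfin.image
    fun C => ⨆ f : {f : Fin H → S × A → ℝ // (f, ρ.1) ∈ C}, initValue s₁ f.1 ρ.1).subset ?_
  rintro _ ⟨D, rfl⟩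
  exact ⟨confSet F Pol β (K - 1) fun j => D (Fin.castLE (Nat.sub_le K 1) j),
    fun q hq => ⟨(confSet_subset _ q hq).1, (confSet_subset _ q hq).2⟩, rfl⟩

end APE

/-! ### The failure probability of one policy evaluation -/

namespace MarkovGame.EvalClass

variable {m H : ℕ} {S : Type*} [MeasurableSpace S] {A : Fin m → Type*}
  [∀ i, MeasurableSpace (A i)] {G : MarkovGame m H S A} {i : Fin m}
  {Fi : Fin H → Finset (S × A i → ℝ)} {Poli : Finset (MarkovPolicy S (A i) H)}
  {π : ∀ j, MarkovPolicy S (A j) H}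

/-- Policy evaluation is accurate for all policies with high probability. -/
theorem apeLaw_error_le (E : G.EvalClass i Fi Poli π) (hH : 0 < H) {sel : Finset Poli → Poli}
    (hsel : ∀ s : Finset Poli, s.Nonempty → sel s ∈ s) {a β : ℝ} (ha : 0 < a)
    (hβ : β = 4 * (H : ℝ) ^ 2 * a) {K : ℕ} (hK : 0 < K) {ω Dim : ℝ} (hω : 0 < ω) (hDim : 0 ≤ Dim)
    (hdim : (G.bellmanEluderDim i Fi Poli π ω : ENNReal) ≤ ENNReal.ofReal Dim)
    {N : ℕ} (hN : (H : ℝ) ≤ 2 ^ N * ω) {ε : ℝ} (hε : 0 ≤ ε)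
    (hnum : 4 * (H : ℝ) ^ 2 * (2 * (K * ω ^ 2 + 3 * N * (9 * β + (H : ℝ) ^ 2) * Dim) + β) ≤
      K * ε ^ 2) :
    apeLaw G i Fi Poli sel β π K {D | ∃ ρ : Poli,
      ε < |APE.output G.s₁ Fi Poli β D ρ - G.value i (Function.update π i ρ.1)|} ≤
      ENNReal.ofReal (4 * H * (∏ h, (Fi h).card : ℕ) ^ 2 * Poli.card * Real.exp (-a)) := by
  classical
  obtain ⟨ρ₀, hρ₀⟩ := E.nonempty
  obtain ⟨f₀, hf₀, -⟩ := E.exists_bellman_solution hρ₀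
  have hne : Nonempty (Fintype.piFinset Fi × Poli) := ⟨(⟨f₀, hf₀⟩, ⟨ρ₀, hρ₀⟩)⟩
  have hNP : (1 : ℝ) ≤ Poli.card := by exact_mod_cast Finset.card_pos.2 E.nonempty
  have hNF : (1 : ℝ) ≤ (∏ h, (Fi h).card : ℕ) := by
    have : 0 < ∏ h, (Fi h).card := Finset.prod_pos fun h _ =>
      Finset.card_pos.2 ⟨_, Fintype.mem_piFinset.1 hf₀ h⟩
    exact_mod_cast this
  -- The selectors needed are all constant pairs, for the roll-in case, and the two extremal ones,
  -- for the point-mass case.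
  have key := E.apeLaw_large_score_le sel β hH (ι := (Fintype.piFinset Fi × Poli) ⊕ Bool)
    (Sum.elim (fun x _ => x) fun b => extremal G i Fi Poli sel b) ha K
  refine le_trans (measure_mono ?_) (key.trans (ENNReal.ofReal_le_ofReal ?_))
  · intro D hD
    by_contra hgood
    simp only [Set.mem_ofPred_eq, not_or, not_exists, not_le] at hgood
    obtain ⟨hg1, hg2⟩ := hgood
    -- Entries from `K` on are placeholders that are never read; an infinite sequence avoids casts
    -- between prefixes.
    set D' : ℕ → Fin H → S × A i × ℝ := fun t => if ht : t < K then D ⟨t, ht⟩ else D ⟨0, hK⟩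
      with hD'
    have hpre : ∀ n (hn : n ≤ K), (fun j : Fin n => D' j) = fun j => D (Fin.castLE hn j) := by
      intro n hn
      funext j
      have : j.1 < K := j.2.trans_le hn
      simp only [hD', this, dif_pos]
      rfl
    obtain ⟨ρ, hρ⟩ := hD
    refine absurd hρ (not_lt.2 ?_)
    have h1 := E.abs_upper_sub_value_le hH ha hβ D' (K := K)
      (fun h f' f ρ n hn => by rw [hpre n hn]; exact hg1 h f' f ρ n hn)
      (fun h x n hn => by rw [hpre n hn]; exact hg2 h (Sum.inl x) n hn)
      (fun h b => by rw [hpre K le_rfl]; exact hg2 h (Sum.inr b) K le_rfl)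
      hω hDim hdim hN hsel hK hε hnum ρ.2
    rw [hpre (K - 1) (Nat.sub_le K 1)] at h1
    exact h1
  · refine mul_le_mul_of_nonneg_right ?_ (Real.exp_pos _).le
    simp only [Fintype.card_sum, Fintype.card_prod, Fintype.card_coe, Fintype.card_bool,
      Fintype.card_piFinset]
    push_cast at hNF ⊢
    set x : ℝ := ∏ h, ((Fi h).card : ℝ)
    set y : ℝ := (Poli.card : ℝ)
    have hx : x ≤ x ^ 2 := le_self_pow₀ hNF two_ne_zero
    have h1 : x * y ≤ x ^ 2 * y := by gcongr
    have h2 : 1 ≤ x ^ 2 * y := one_le_mul_of_one_le_of_one_le (hNF.trans hx) hNP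
    have h3 : x ^ 2 * y + (x * y + 2) ≤ 4 * (x ^ 2 * y) := by linarith
    calc (H : ℝ) * x ^ 2 * y + H * (x * y + 2) = H * (x ^ 2 * y + (x * y + 2)) := by ring
      _ ≤ H * (4 * (x ^ 2 * y)) := by gcongr
      _ = 4 * H * x ^ 2 * y := by ring

end MarkovGame.EvalClass

/-! ### Distributions on finite sets and Hedge -/

section Finite

variable {X : Type*} [Fintype X]

instance [MeasurableSpace X] (w : X → ℝ) : IsFiniteMeasure (weightMeasure w) := by
  refine ⟨?_⟩
  simp only [weightMeasure, Measure.coe_finsetSum, Finset.sum_apply, Measure.smul_apply,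
    measure_univ, smul_eq_mul, mul_one]
  exact ENNReal.sum_lt_top.2 fun x _ => ENNReal.ofReal_lt_top

theorem weightMeasure_singleton [MeasurableSpace X] [MeasurableSingletonClass X] (w : X → ℝ)
    (x : X) : weightMeasure w {x} = ENNReal.ofReal (w x) := by
  classical
  simp only [weightMeasure, Measure.coe_finsetSum, Finset.sum_apply, Measure.smul_apply,
    smul_eq_mul]
  rw [Finset.sum_eq_single x]
  · simp
  · intro y _ hy
    simp [hy]
  · simp

theorem isProbabilityMeasure_weightMeasure [MeasurableSpace X] {w : X → ℝ}
    (hw : w ∈ stdSimplex ℝ X) : IsProbabilityMeasure (weightMeasure w) := by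
  refine ⟨?_⟩
  simp only [weightMeasure, Measure.coe_finsetSum, Finset.sum_apply, Measure.smul_apply,
    measure_univ, smul_eq_mul, mul_one]
  rw [← ENNReal.ofReal_sum_of_nonneg fun x _ => hw.1 x, hw.2, ENNReal.ofReal_one]

theorem integral_weightMeasure [MeasurableSpace X] [MeasurableSingletonClass X] {w : X → ℝ}
    (hw : ∀ x, 0 ≤ w x) (f : X → ℝ) : ∫ x, f x ∂(weightMeasure w) = ∑ x, w x * f x := by
  rw [integral_fintype .of_finite]
  refine Finset.sum_congr rfl fun x _ => ?_
  rw [Measure.real, weightMeasure_singleton, ENNReal.toReal_ofReal (hw x), smul_eq_mul]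

/-- Hoeffding's lemma for a finite distribution. -/
theorem sum_mul_exp_le {w : X → ℝ} (hw : w ∈ stdSimplex ℝ X) {v : X → ℝ} {a b : ℝ}
    (hv : ∀ x, v x ∈ Set.Icc a b) (t : ℝ) :
    ∑ x, w x * Real.exp (t * v x) ≤
      Real.exp (t * ∑ x, w x * v x + t ^ 2 * (b - a) ^ 2 / 8) := by
  let _ : MeasurableSpace X := ⊤
  have := isProbabilityMeasure_weightMeasure hw
  have h1 := (hasSubgaussianMGF_of_mem_Icc (μ := weightMeasure w) (X := v)
    measurable_from_top.aemeasurable (ae_of_all _ hv)).mgf_le t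
  rw [mgf, integral_weightMeasure hw.1, integral_weightMeasure hw.1] at h1
  rw [Real.exp_add, mul_comm]
  have h2 : ∀ x, w x * Real.exp (t * v x) = Real.exp (t * ∑ x, w x * v x) *
      (w x * Real.exp (t * (v x - ∑ x, w x * v x))) := by
    intro x
    rw [mul_sub, Real.exp_sub]
    field_simp
  simp only [h2, ← Finset.mul_sum]
  rw [mul_comm]
  gcongr
  refine h1.trans (le_of_eq ?_)
  congr 1
  simp only [NNReal.coe_pow, NNReal.coe_div, coe_nnnorm, NNReal.coe_ofNat, Real.norm_eq_abs,
    div_pow, sq_abs]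
  ring

theorem hedge_pos [Nonempty X] (η : ℝ) (t : ℕ) (v : Fin t → X → ℝ) (x : X) :
    0 < hedge η t v x := by
  induction t generalizing x with
  | zero => simp only [hedge]; positivity
  | succ t ih =>
    rw [hedge]
    refine div_pos (mul_pos (ih _ _) (Real.exp_pos _)) ?_
    exact Finset.sum_pos (fun y _ => mul_pos (ih _ _) (Real.exp_pos _)) Finset.univ_nonempty

theorem hedge_mem_stdSimplex [Nonempty X] (η : ℝ) (t : ℕ) (v : Fin t → X → ℝ) :
    hedge η t v ∈ stdSimplex ℝ X := by
  refine ⟨fun x => (hedge_pos η t v x).le, ?_⟩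
  cases t with
  | zero => simp [hedge]
  | succ t =>
    simp only [hedge]
    rw [← Finset.sum_div, div_self]
    exact (Finset.sum_pos (fun y _ => mul_pos (hedge_pos _ _ _ _) (Real.exp_pos _))
      Finset.univ_nonempty).ne'

/-- The regret bound of Hedge. -/
theorem hedge_regret [Nonempty X] (η : ℝ) {B : ℝ} (T : ℕ) (v : Fin T → X → ℝ)
    (hv : ∀ t x, v t x ∈ Set.Icc 0 B) (x : X) :
    η * (∑ t, v t x - ∑ t : Fin T, ∑ y, hedge η t (fun j : Fin t => v (Fin.castLE t.2.le j)) y *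
      v t y) ≤ Real.log (Fintype.card X) + T * (η ^ 2 * B ^ 2 / 8) := by
  -- The log-weight of `x` is the potential. One round changes it by η·v(x) minus the log
  -- normalizer, which Hoeffding's lemma compares with η times the mean payoff; the uniform start
  -- cancels the log-cardinality.
  have key : η * (∑ t, v t x - score (fun n u z => ∑ y, hedge η n u y * z y) T v) ≤
      Real.log (Fintype.card X) + Real.log (hedge η T v x) + T * (η ^ 2 * B ^ 2 / 8) := by
    induction T with
    | zero =>
      simp [hedge, score]
    | succ T ih =>
      have h1 := ih (Fin.init v) (fun t y => hv _ y)
      have hvl := fun y => hv (Fin.last T) y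
      rw [score_init, Fin.sum_univ_castSucc]
      simp only [hedge]
      set w := hedge η T (Fin.init v) with hw
      have hwpos : ∀ y, 0 < w y := fun y => hedge_pos η T _ y
      have h2 := sum_mul_exp_le (hedge_mem_stdSimplex η T (Fin.init v)) hvl η
      rw [← hw, sub_zero] at h2
      have hZ : 0 < ∑ y, w y * Real.exp (η * v (Fin.last T) y) :=
        Finset.sum_pos (fun y _ => mul_pos (hwpos y) (Real.exp_pos _)) Finset.univ_nonempty
      have h3 := Real.log_le_log hZ h2
      rw [Real.log_exp] at h3
      rw [Real.log_div (mul_pos (hwpos x) (Real.exp_pos _)).ne' hZ.ne',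
        Real.log_mul (hwpos x).ne' (Real.exp_pos _).ne', Real.log_exp]
      have h4 : ∀ t : Fin T, Fin.init v t = v t.castSucc := fun t => rfl
      simp only [h4] at h1
      push_cast
      linarith
  have hle : Real.log (hedge η T v x) ≤ 0 := by
    refine Real.log_nonpos (hedge_pos η T v x).le ?_
    have h1 := hedge_mem_stdSimplex η T v
    rw [← h1.2]
    exact Finset.single_le_sum (fun y _ => h1.1 y) (Finset.mem_univ x)
  have h2 : score (fun n u z => ∑ y, hedge η n u y * z y) T v = ∑ t : Fin T, ∑ y,
    hedge η t (fun j : Fin t => v (Fin.castLE t.2.le j)) y * v t y := rfl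
  rw [← h2]
  linarith

/-- A measurable map with finitely many values may be composed with any function. -/
theorem Measurable.comp_of_finite_range {Y Z W : Type*} [MeasurableSpace Y] [MeasurableSpace Z]
    [MeasurableSingletonClass Z] [MeasurableSpace W] {f : Y → Z} (hf : Measurable f)
    (hfin : (Set.range f).Finite) (Φ : Z → W) : Measurable fun y => Φ (f y) := by
  intro s _
  have : (fun y => Φ (f y)) ⁻¹' s = f ⁻¹' (Set.range f ∩ Φ ⁻¹' s) := by
    ext y; simp
  rw [this]
  exact hf (hfin.subset Set.inter_subset_left).measurableSet

end Finite

section Product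

variable {ι : Type*} [Fintype ι] [DecidableEq ι] {X : ι → Type*} [∀ i, Fintype (X i)]

theorem prod_mem_stdSimplex {w : ∀ i, X i → ℝ} (hw : ∀ i, w i ∈ stdSimplex ℝ (X i)) :
    (fun x : ∀ i, X i => ∏ i, w i (x i)) ∈ stdSimplex ℝ (∀ i, X i) := by
  refine ⟨fun x => Finset.prod_nonneg fun i _ => (hw i).1 _, ?_⟩
  rw [← Fintype.piFinset_univ, ← Finset.prod_univ_sum]
  exact Finset.prod_eq_one fun i _ => (hw i).2

/-- Resampling one coordinate of a product of finite distributions does not change averages. -/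
theorem sum_prod_mul_sum_update {w : ∀ i, X i → ℝ} (hw : ∀ i, w i ∈ stdSimplex ℝ (X i)) (i : ι)
    (V : (∀ i, X i) → ℝ) :
    ∑ x : ∀ i, X i, (∏ j, w j (x j)) * ∑ y, w i y * V (Function.update x i y) =
      ∑ x : ∀ i, X i, (∏ j, w j (x j)) * V x := by
  -- Exchanging coordinate `i` with the extra sample is an involution that preserves the product
  -- weights.
  have hinv : Function.Involutive fun p : (∀ i, X i) × X i => (Function.update p.1 i p.2, p.1 i) := by
    rintro ⟨x, y⟩
    simp
  have h1 : ∀ (x : ∀ i, X i) (y : X i),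
      (∏ j, w j (Function.update x i y j)) * w i (x i) = (∏ j, w j (x j)) * w i y := by
    intro x y
    rw [← Finset.mul_prod_erase _ _ (Finset.mem_univ i),
      ← Finset.mul_prod_erase (s := Finset.univ) (fun j => w j (x j)) (Finset.mem_univ i)]
    have : ∏ j ∈ Finset.univ.erase i, w j (Function.update x i y j) =
        ∏ j ∈ Finset.univ.erase i, w j (x j) :=
      Finset.prod_congr rfl fun j hj => by rw [Function.update_of_ne (Finset.ne_of_mem_erase hj)]
    rw [this, Function.update_self]
    ring
  calc ∑ x : ∀ i, X i, (∏ j, w j (x j)) * ∑ y, w i y * V (Function.update x i y)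
      = ∑ p : (∀ i, X i) × X i, (∏ j, w j (p.1 j)) * w i p.2 * V (Function.update p.1 i p.2) := by
        rw [Fintype.sum_prod_type]
        simp only [Finset.mul_sum, mul_assoc]
    _ = ∑ p : (∀ i, X i) × X i, (∏ j, w j (p.1 j)) * w i p.2 * V p.1 := by
        rw [← Equiv.sum_comp hinv.toPerm
          (fun p : (∀ i, X i) × X i => (∏ j, w j (p.1 j)) * w i p.2 * V p.1)]
        refine Finset.sum_congr rfl fun p _ => ?_
        change _ = (∏ j, w j (Function.update p.1 i p.2 j)) * w i (p.1 i) *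
          V (Function.update p.1 i p.2)
        rw [h1]
    _ = ∑ x : ∀ i, X i, (∏ j, w j (x j)) * V x := by
        rw [Fintype.sum_prod_type]
        refine Finset.sum_congr rfl fun x _ => ?_
        dsimp only
        rw [← Finset.sum_mul, ← Finset.mul_sum, (hw i).2, mul_one]

theorem lintegral_pi_weightMeasure [∀ i, MeasurableSpace (X i)]
    [∀ i, MeasurableSingletonClass (X i)] {w : ∀ i, X i → ℝ} (hw : ∀ i x, 0 ≤ w i x)
    {f : (∀ i, X i) → ℝ} (hf : ∀ x, 0 ≤ f x) :
    ∫⁻ x, ENNReal.ofReal (f x) ∂(Measure.pi fun i => weightMeasure (w i)) =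
      ENNReal.ofReal (∑ x : ∀ i, X i, (∏ j, w j (x j)) * f x) := by
  classical
  rw [lintegral_fintype, ENNReal.ofReal_sum_of_nonneg fun x _ =>
    mul_nonneg (Finset.prod_nonneg fun i _ => hw i _) (hf x)]
  refine Finset.sum_congr rfl fun x _ => ?_
  rw [Measure.pi_singleton, mul_comm, ENNReal.ofReal_mul (Finset.prod_nonneg fun i _ => hw i _),
    ENNReal.ofReal_prod_of_nonneg fun i _ => hw i _]
  simp only [weightMeasure_singleton]

end Product

/-! ### The law of the learning process -/

instance {S A : Type*} [MeasurableSpace S] [MeasurableSpace A] {H : ℕ} :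
    DiscreteMeasurableSpace (MarkovPolicy S A H) := ⟨fun _ => MeasurableSpace.measurableSet_top⟩

namespace DOPMD

variable {m H : ℕ} {S : Type*} [MeasurableSpace S] {A : Fin m → Type*}
  [∀ i, MeasurableSpace (A i)]
  (G : MarkovGame m H S A) (F : ∀ i, Fin H → Finset (S × A i → ℝ))
  (Pol : ∀ i, Finset (MarkovPolicy S (A i) H)) (sel : ∀ i, Finset (Pol i) → Pol i)
  (K : Fin m → ℕ) (β η : Fin m → ℝ)

/-- The outputs of policy evaluation in the first `t` rounds. -/
def outputs {t : ℕ} (ω : Fin t → Round Pol K) : Fin t → ∀ i, Pol i → ℝ :=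
  fun j i => APE.output G.s₁ (F i) (Pol i) (β i) ((ω j).2 i)

/-- The distributions of the players as a function of the outputs of policy evaluation. -/
def mixtureOf {t : ℕ} (o : Fin t → ∀ i, Pol i → ℝ) (i : Fin m) : Pol i → ℝ :=
  hedge (η i) t fun j => o j i

theorem mixture_mem_stdSimplex [∀ i, Nonempty (Pol i)] {t : ℕ} (ω : Fin t → Round Pol K)
    (i : Fin m) : mixture G F Pol K β η ω i ∈ stdSimplex ℝ (Pol i) :=
  hedge_mem_stdSimplex _ _ _

theorem output_mem_stdSimplex [∀ i, Nonempty (Pol i)] {T : ℕ} (hT : 0 < T)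
    (ω : Fin T → Round Pol K) :
    DOPMD.output G F Pol K β η ω ∈ stdSimplex ℝ (∀ i, Pol i) := by
  have hp := fun t : Fin T => prod_mem_stdSimplex fun i => mixture_mem_stdSimplex G F Pol K β η
    (fun j : Fin t => ω (Fin.castLE t.2.le j)) i
  have hT' : (0 : ℝ) < T := by exact_mod_cast hT
  refine ⟨fun π => mul_nonneg (by positivity) (Finset.sum_nonneg fun t _ => (hp t).1 π), ?_⟩
  simp only [DOPMD.output]
  rw [← Finset.mul_sum, Finset.sum_comm, Finset.sum_congr rfl fun t _ => (hp t).2]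
  simp only [Finset.sum_const, Finset.card_univ, Fintype.card_fin, nsmul_eq_mul, mul_one]
  field_simp

section Measurability

variable (hF : ∀ i h, ∀ f ∈ F i h, Measurable f)
include hF

theorem measurable_outputs (t : ℕ) :
    Measurable fun ω : Fin t → Round Pol K => outputs G F Pol K β ω := by
  rw [measurable_pi_iff]
  intro j
  rw [measurable_pi_iff]
  intro i
  rw [measurable_pi_iff]
  intro ρ
  exact (APE.measurable_output (hF i) G.s₁ ρ).comp
    (f := fun ω : Fin t → Round Pol K => (ω j).2 i) (by fun_prop)

omit hF in
theorem finite_range_outputs (t : ℕ) :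
    (Set.range fun ω : Fin t → Round Pol K => outputs G F Pol K β ω).Finite := by
  have h1 : (Set.pi Set.univ fun _ : Fin t => Set.pi Set.univ fun i => Set.pi Set.univ
      fun ρ : Pol i => Set.range fun D : Fin (K i) → Fin H → S × A i × ℝ =>
        APE.output G.s₁ (F i) (Pol i) (β i) D ρ).Finite :=
    Set.Finite.pi fun _ => Set.Finite.pi fun i => Set.Finite.pi fun ρ =>
      APE.finite_range_output G.s₁ (K i) ρ
  refine h1.subset ?_
  rintro _ ⟨ω, rfl⟩ j _ i _ ρ _
  exact ⟨(ω j).2 i, rfl⟩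

theorem measurable_comp_outputs (t : ℕ) {W : Type*} [MeasurableSpace W]
    (Φ : (Fin t → ∀ i, Pol i → ℝ) → W) :
    Measurable fun ω : Fin t → Round Pol K => Φ (outputs G F Pol K β ω) :=
  (measurable_outputs G F Pol K β hF t).comp_of_finite_range
    (finite_range_outputs G F Pol K β t) Φ

/-- The law of the next round. -/
def roundKernel (t : ℕ) : Kernel (Fin t → Round Pol K) (Round Pol K) where
  toFun ω := (Measure.pi fun i => weightMeasure (mixture G F Pol K β η ω i)).bind fun π =>
    (Measure.pi fun i => apeLaw G i (F i) (Pol i) (sel i) (β i) (fun j => (π j).1) (K i)).map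
      fun D => (π, D)
  measurable' := measurable_comp_outputs G F Pol K β hF t fun o =>
    (Measure.pi fun i => weightMeasure (mixtureOf Pol η o i)).bind fun π =>
    (Measure.pi fun i => apeLaw G i (F i) (Pol i) (sel i) (β i) (fun j => (π j).1) (K i)).map
      fun D => ((π, D) : Round Pol K)

theorem isProbabilityMeasure_apeLaw (i : Fin m) (π : ∀ j, MarkovPolicy S (A j) H) (k : ℕ) :
    IsProbabilityMeasure (apeLaw G i (F i) (Pol i) (sel i) (β i) π k) :=
  (G.isSequentialLaw_apeLaw i (F i) (Pol i) (sel i) (β i) π (hF i)).isProbabilityMeasure k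

theorem lintegral_roundKernel (t : ℕ) (ω : Fin t → Round Pol K) {f : Round Pol K → ENNReal}
    (hf : Measurable f) :
    ∫⁻ x, f x ∂(roundKernel G F Pol sel K β η hF t ω) =
      ∫⁻ π, ∫⁻ D, f (π, D) ∂(Measure.pi fun i =>
        apeLaw G i (F i) (Pol i) (sel i) (β i) (fun j => (π j).1) (K i))
        ∂(Measure.pi fun i => weightMeasure (mixture G F Pol K β η ω i)) := by
  change ∫⁻ x, f x ∂((Measure.pi fun i => weightMeasure (mixture G F Pol K β η ω i)).bind _) = _
  rw [Measure.lintegral_bind Measurable.of_discrete.aemeasurable hf.aemeasurable]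
  refine lintegral_congr fun π => ?_
  rw [lintegral_map hf measurable_prodMk_left]

variable [∀ i, Nonempty (Pol i)]

theorem isSequentialLaw_law :
    IsSequentialLaw (law G F Pol sel K β η) (roundKernel G F Pol sel K β η hF) where
  zero := rfl
  succ t := by
    rw [law]
    congr 1
    funext ω
    have hs : Measurable fun x : Round Pol K =>
        (Fin.snoc (α := fun _ => Round Pol K) ω x : Fin (t + 1) → _) :=
      measurable_fin_snoc.comp measurable_prodMk_left
    refine Measure.ext_of_lintegral _ fun f hf => ?_
    have hg : Measurable fun x : Round Pol K => f (Fin.snoc (α := fun _ => Round Pol K) ω x) :=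
      hf.comp hs
    rw [lintegral_map hf hs, lintegral_roundKernel _ _ _ _ _ _ _ _ _ _ hg,
      Measure.lintegral_bind Measurable.of_discrete.aemeasurable hf.aemeasurable]
    refine lintegral_congr fun π => ?_
    exact lintegral_map hf (hs.comp measurable_prodMk_left)
  markov t := by
    refine ⟨fun ω => ⟨?_⟩⟩
    have h1 := fun i => isProbabilityMeasure_weightMeasure
      (mixture_mem_stdSimplex G F Pol K β η ω i)
    have h2 := fun (π : ∀ i, Pol i) i => isProbabilityMeasure_apeLaw G F Pol sel β hF i
      (fun j => (π j).1) (K i)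
    rw [← lintegral_one, lintegral_roundKernel (f := fun _ => 1) _ _ _ _ _ _ _ _ _ _
      measurable_const]
    simp

/-- A bound on the probability that policy evaluation fails in some round. -/
theorem law_exists_mem_le {B : ∀ i, (∀ j, Pol j) → Set (Fin (K i) → Fin H → S × A i × ℝ)}
    (hB : ∀ i π, MeasurableSet (B i π)) {δ : Fin m → ENNReal}
    (hδ : ∀ i (π : ∀ j, Pol j),
      apeLaw G i (F i) (Pol i) (sel i) (β i) (fun j => (π j).1) (K i) (B i π) ≤ δ i) (T : ℕ) :
    law G F Pol sel K β η T {ω | ∃ t, ∃ i, (ω t).2 i ∈ B i (ω t).1} ≤ T * ∑ i, δ i := by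
  have h2 := fun (π : ∀ i, Pol i) i => isProbabilityMeasure_apeLaw G F Pol sel β hF i
      (fun j => (π j).1) (K i)
  set Bad : Set (Round Pol K) := {x | ∃ i, x.2 i ∈ B i x.1} with hBad
  have hBadm : MeasurableSet Bad := by
    -- The failure set depends on the sampled profile; as there are finitely many profiles, fixing
    -- the profile first gives measurability.
    have : Bad = ⋃ π : ∀ i, Pol i, ⋃ i,
        (Prod.fst ⁻¹' {π}) ∩ (fun x : Round Pol K => x.2 i) ⁻¹' B i π := by
      ext ⟨π, D⟩
      simp only [hBad, Set.mem_ofPred_eq, Set.mem_iUnion, Set.mem_inter_iff, Set.mem_preimage,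
        Set.mem_singleton_iff]
      constructor
      · rintro ⟨i, hi⟩; exact ⟨π, i, rfl, hi⟩
      · rintro ⟨π', i, rfl, hi⟩; exact ⟨i, hi⟩
    rw [this]
    refine MeasurableSet.iUnion fun π => MeasurableSet.iUnion fun i => ?_
    refine MeasurableSet.inter (measurable_fst (measurableSet_singleton π)) ?_
    exact (hB i π).preimage (by fun_prop)
  refine (isSequentialLaw_law G F Pol sel K β η hF).measure_exists_mem_le hBadm (fun t ω => ?_) T
  rw [← lintegral_indicator_one hBadm, lintegral_roundKernel _ _ _ _ _ _ _ _ _ _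
    (measurable_one.indicator hBadm)]
  have h1 := fun i => isProbabilityMeasure_weightMeasure
      (mixture_mem_stdSimplex G F Pol K β η ω i)
  calc _ ≤ ∫⁻ _, ∑ i, δ i
        ∂(Measure.pi fun i => weightMeasure (mixture G F Pol K β η ω i)) := by
        refine lintegral_mono fun π => ?_
        have h3 : ∀ D, Bad.indicator (1 : Round Pol K → ENNReal) (π, D) ≤
            ∑ i, (B i π).indicator 1 (D i) := by
          intro D
          by_cases hD : (π, D) ∈ Bad
          · rw [Set.indicator_of_mem hD]
            obtain ⟨i, hi⟩ := hD
            refine le_trans ?_ (Finset.single_le_sum (fun _ _ => zero_le) (Finset.mem_univ i))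
            rw [Set.indicator_of_mem hi]
            rfl
          · rw [Set.indicator_of_notMem hD]; exact zero_le
        refine (lintegral_mono h3).trans ?_
        rw [lintegral_finsetSum]
        · refine Finset.sum_le_sum fun i _ => ?_
          have h4 := (measurePreserving_eval (fun i => apeLaw G i (F i) (Pol i) (sel i) (β i)
            (fun j => (π j).1) (K i)) i).lintegral_comp
            (f := (B i π).indicator 1) (measurable_one.indicator (hB i π))
          refine (le_of_eq h4).trans ?_
          rw [lintegral_indicator_one (hB i π)]
          exact hδ i π
        · intro i _
          exact (measurable_one.indicator (hB i π)).comp (measurable_pi_apply i)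
    _ = ∑ i, δ i := by simp

end Measurability

/-- The advantage of the deviation `ρ` of player `i` over her current distribution `w i`, against
the opponents' sampled policies. -/
def advantage (i : Fin m) (ρ : Pol i) (w : ∀ i, Pol i → ℝ) (π : ∀ i, Pol i) : ℝ :=
  G.value i (Function.update (fun j => (π j).1) i ρ.1) -
    ∑ ρ', w i ρ' * G.value i (Function.update (fun j => (π j).1) i ρ'.1)

variable {Pol} in
theorem advantage_mem_Icc (i : Fin m) (ρ : Pol i) {w : ∀ i, Pol i → ℝ}
    (hw : ∀ i, w i ∈ stdSimplex ℝ (Pol i)) (π : ∀ i, Pol i) :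
    advantage G Pol i ρ w π ∈ Set.Icc (-(H : ℝ)) H := by
  have h1 := G.value_mem_Icc (i := i) (Function.update (fun j => (π j).1) i ρ.1)
  have h2 : ∑ ρ', w i ρ' * G.value i (Function.update (fun j => (π j).1) i ρ'.1) ≤ H := by
    calc _ ≤ ∑ ρ', w i ρ' * (H : ℝ) := Finset.sum_le_sum fun ρ' _ =>
          mul_le_mul_of_nonneg_left (G.value_mem_Icc _).2 ((hw i).1 ρ')
      _ = H := by rw [← Finset.sum_mul, (hw i).2, one_mul]
  have h3 : 0 ≤ ∑ ρ', w i ρ' * G.value i (Function.update (fun j => (π j).1) i ρ'.1) :=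
    Finset.sum_nonneg fun ρ' _ => mul_nonneg ((hw i).1 ρ') (G.value_mem_Icc _).1
  unfold advantage
  constructor <;> linarith [h1.1, h1.2]

/-- The exponent that controls the sampling error of the advantage. -/
def advantageScore (l : ℝ) (i : Fin m) (ρ : Pol i) (t : ℕ) (ω : Fin t → Round Pol K)
    (x : Round Pol K) : ℝ :=
  l * (∑ π, (∏ j, mixture G F Pol K β η ω j (π j)) *
      advantage G Pol i ρ (mixture G F Pol K β η ω) π -
    advantage G Pol i ρ (mixture G F Pol K β η ω) x.1) - l ^ 2 * (H : ℝ) ^ 2 / 2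

/-- Given the past, the profile is drawn from the product of the mixtures and the advantage lies in
[−H, H]. Hoeffding's lemma yields the correction l²(2H)²/8 = l²H²/2, and the union bound runs over
all players and deviations. -/
theorem law_large_advantageScore_le [∀ i, Nonempty (Pol i)]
    (hF : ∀ i h, ∀ f ∈ F i h, Measurable f) (l : ℝ) {a : ℝ} (ha : 0 < a) (T : ℕ) :
    law G F Pol sel K β η T {ω | ∃ i, ∃ ρ : Pol i,
      a ≤ score (advantageScore G F Pol K β η l i ρ) T ω} ≤
      ENNReal.ofReal ((∑ i, ((Pol i).card : ℝ)) * Real.exp (-a)) := by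
  have hseq := isSequentialLaw_law G F Pol sel K β η hF
  have h1 : ∀ x : Σ i, Pol i, law G F Pol sel K β η T
      {ω | ∃ n, ∃ hn : n ≤ T, a ≤ score (advantageScore G F Pol K β η l x.1 x.2) n
        (fun j => ω (Fin.castLE hn j))} ≤ ENNReal.ofReal (Real.exp (-a)) := by
    rintro ⟨i, ρ⟩
    have hm : ∀ t, Measurable fun p : (Fin t → Round Pol K) × Round Pol K =>
        advantageScore G F Pol K β η l i ρ t p.1 p.2 := by
      intro t
      have h2 := (measurable_outputs G F Pol K β hF t).comp measurable_fst |>.prodMk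
        (measurable_fst.comp measurable_snd : Measurable fun p :
          (Fin t → Round Pol K) × Round Pol K => p.2.1)
      have h3 : (Set.range fun p : (Fin t → Round Pol K) × Round Pol K =>
          (outputs G F Pol K β p.1, p.2.1)).Finite := by
        refine ((finite_range_outputs G F Pol K β t).prod (Set.finite_univ)).subset ?_
        rintro _ ⟨p, rfl⟩
        exact ⟨⟨p.1, rfl⟩, Set.mem_univ _⟩
      exact h2.comp_of_finite_range h3 fun z => l * (∑ π, (∏ j, mixtureOf Pol η z.1 j (π j)) *
          advantage G Pol i ρ (mixtureOf Pol η z.1) π -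
        advantage G Pol i ρ (mixtureOf Pol η z.1) z.2) - l ^ 2 * (H : ℝ) ^ 2 / 2
    refine hseq.measure_exists_le_score_le hm (fun t ω => ?_) ha T
    have hw := mixture_mem_stdSimplex G F Pol K β η ω
    set w := mixture G F Pol K β η ω with hwdef
    have hapl := fun (π : ∀ i, Pol i) i => isProbabilityMeasure_apeLaw G F Pol sel β hF i
      (fun j => (π j).1) (K i)
    have hadv := advantage_mem_Icc G i ρ hw
    have hsum := sum_mul_exp_le (prod_mem_stdSimplex hw) hadv (-l)
    set M := ∑ π, (∏ j, w j (π j)) * advantage G Pol i ρ w π with hM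
    have hexpm : Measurable fun x : Round Pol K =>
        ENNReal.ofReal (Real.exp (advantageScore G F Pol K β η l i ρ t ω x)) :=
      (Real.measurable_exp.comp ((hm t).comp measurable_prodMk_left)).ennreal_ofReal
    rw [lintegral_roundKernel _ _ _ _ _ _ _ _ _ _ hexpm]
    simp only [advantageScore, ← hwdef, ← hM, lintegral_const, measure_univ, mul_one]
    rw [lintegral_pi_weightMeasure (fun i => (hw i).1) fun π => (Real.exp_pos _).le,
      ← ENNReal.ofReal_one]
    refine ENNReal.ofReal_le_ofReal ?_
    have h4 : ∀ π : ∀ i, Pol i, (∏ j, w j (π j)) *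
        Real.exp (l * (M - advantage G Pol i ρ w π) - l ^ 2 * (H : ℝ) ^ 2 / 2) =
        Real.exp (l * M - l ^ 2 * (H : ℝ) ^ 2 / 2) *
          ((∏ j, w j (π j)) * Real.exp (-l * advantage G Pol i ρ w π)) := by
      intro π
      rw [mul_left_comm, ← Real.exp_add]
      congr 2
      ring
    rw [Finset.sum_congr rfl fun π _ => h4 π, ← Finset.mul_sum]
    calc _ ≤ Real.exp (l * M - l ^ 2 * (H : ℝ) ^ 2 / 2) *
          Real.exp (-l * M + (-l) ^ 2 * (H - -H) ^ 2 / 8) := by gcongr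
      _ = 1 := by
        rw [← Real.exp_add, Real.exp_eq_one_iff]
        ring
  have hsub : {ω | ∃ i, ∃ ρ : Pol i, a ≤ score (advantageScore G F Pol K β η l i ρ) T ω} ⊆
      ⋃ x : Σ i, Pol i, {ω | ∃ n, ∃ hn : n ≤ T,
        a ≤ score (advantageScore G F Pol K β η l x.1 x.2) n
        (fun j => ω (Fin.castLE hn j))} := by
    rintro ω ⟨i, ρ, h⟩
    exact Set.mem_iUnion.2 ⟨⟨i, ρ⟩, T, le_rfl, h⟩
  refine (measure_mono hsub).trans ((measure_iUnion_fintype_le _ _).trans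
    ((Finset.sum_le_sum fun x _ => h1 x).trans (le_of_eq ?_)))
  rw [Finset.sum_const, nsmul_eq_mul, ENNReal.ofReal_mul (by positivity),
    ← ENNReal.ofReal_natCast]
  congr 2
  simp

end DOPMD

/-! ### From small regret to a small equilibrium gap -/

/-- With a single policy the prescribed learning rate is 0, as log 1 = 0, and the regret inequality
cannot be divided by it; but then the regret vanishes. -/
theorem hedge_regret_le {X : Type*} [Fintype X] [Nonempty X] {η B r : ℝ} (T : ℕ)
    (v : Fin T → X → ℝ) (hv : ∀ t x, v t x ∈ Set.Icc 0 B) (hr : 0 ≤ r)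
    (h : Fintype.card X = 1 ∨ (0 < η ∧
      Real.log (Fintype.card X) + T * (η ^ 2 * B ^ 2 / 8) ≤ η * (T * r))) (x : X) :
    ∑ t, v t x - ∑ t : Fin T, ∑ y, hedge η t (fun j : Fin t => v (Fin.castLE t.2.le j)) y *
      v t y ≤ T * r := by
  rcases h with h | ⟨hη, h⟩
  · have := Fintype.card_le_one_iff_subsingleton.1 h.le
    have h1 : ∀ t : Fin T, ∑ y, hedge η t (fun j : Fin t => v (Fin.castLE t.2.le j)) y * v t y =
        v t x := by
      intro t
      have h2 := (hedge_mem_stdSimplex η t (fun j : Fin t => v (Fin.castLE t.2.le j))).2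
      calc _ = ∑ y, hedge η t (fun j : Fin t => v (Fin.castLE t.2.le j)) y * v t x :=
            Finset.sum_congr rfl fun y _ => by rw [Subsingleton.elim y x]
        _ = v t x := by rw [← Finset.sum_mul, h2, one_mul]
    rw [Finset.sum_congr rfl fun t _ => h1 t, sub_self]
    positivity
  · exact le_of_mul_le_mul_left ((hedge_regret η T v hv x).trans h) hη

namespace DOPMD

variable {m H : ℕ} {S : Type*} [MeasurableSpace S] {A : Fin m → Type*}
  [∀ i, MeasurableSpace (A i)]
  (G : MarkovGame m H S A) (F : ∀ i, Fin H → Finset (S × A i → ℝ))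
  (Pol : ∀ i, Finset (MarkovPolicy S (A i) H))
  (K : Fin m → ℕ) (β η : Fin m → ℝ) [∀ i, Nonempty (Pol i)]

-- Averaging over the whole profile restores the value of the mixture, because player i's own
-- coordinate may be resampled from her marginal.
variable {Pol} in
omit [∀ i, Nonempty (Pol i)] in
theorem sum_prod_mul_advantage (i : Fin m) (ρ : Pol i) {w : ∀ i, Pol i → ℝ}
    (hw : ∀ i, w i ∈ stdSimplex ℝ (Pol i)) :
    ∑ π, (∏ j, w j (π j)) * advantage G Pol i ρ w π =
      ∑ π : ∀ j, Pol j, (∏ j, w j (π j)) * G.value i (Function.update (fun j => (π j).1) i ρ.1) -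
        ∑ π : ∀ j, Pol j, (∏ j, w j (π j)) * G.value i fun j => (π j).1 := by
  have h1 : ∀ (π : ∀ j, Pol j) (ρ' : Pol i), Function.update (fun j => (π j).1) i ρ'.1 =
      fun j => (Function.update π i ρ' j).1 := by
    intro π ρ'
    funext j
    by_cases hj : j = i
    · subst hj; simp
    · simp [hj]
  rw [← sum_prod_mul_sum_update hw i fun π : ∀ j, Pol j => G.value i fun j => (π j).1,
    ← Finset.sum_sub_distrib]
  refine Finset.sum_congr rfl fun π _ => ?_
  rw [advantage, mul_sub]
  congr 2
  exact Finset.sum_congr rfl fun ρ' _ => by rw [h1]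

variable {G F Pol K β η}

/-- Pass from expected to sampled advantages through the score, from values to estimates at the cost
of e for the deviation and e for the mixture, and then apply the Hedge regret. Division by l·T
produces the last two terms. -/
theorem devValue_sub_mixValue_le
    (hF : ∀ i h, ∀ f ∈ F i h, Measurable f ∧ ∀ x, f x ∈ Set.Icc (0 : ℝ) H)
    {T : ℕ} (hT : 0 < T) {ω : Fin T → Round Pol K} {e l a r : ℝ} (hl : 0 < l) (hr : 0 ≤ r)
    {i : Fin m}
    (herr : ∀ t (ρ : Pol i), |APE.output G.s₁ (F i) (Pol i) (β i) ((ω t).2 i) ρ -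
      G.value i (Function.update (fun j => ((ω t).1 j).1) i ρ.1)| ≤ e)
    (hreg : (Pol i).card = 1 ∨ (0 < η i ∧
      Real.log (Pol i).card + T * (η i ^ 2 * (H : ℝ) ^ 2 / 8) ≤ η i * (T * r)))
    {ρ : Pol i} (hscore : score (advantageScore G F Pol K β η l i ρ) T ω < a) :
    G.devValue i ρ (DOPMD.output G F Pol K β η ω) - G.mixValue i (DOPMD.output G F Pol K β η ω) ≤
      r + 2 * e + a / (l * T) + l * (H : ℝ) ^ 2 / 2 := by
  have hT' : (0 : ℝ) < T := by exact_mod_cast hT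
  set w : Fin T → ∀ i, Pol i → ℝ := fun t =>
    mixture G F Pol K β η (fun j : Fin t => ω (Fin.castLE t.2.le j)) with hwdef
  have hw : ∀ t i, w t i ∈ stdSimplex ℝ (Pol i) := fun t i =>
    mixture_mem_stdSimplex G F Pol K β η _ i
  set v : Fin T → Pol i → ℝ := fun t => APE.output G.s₁ (F i) (Pol i) (β i) ((ω t).2 i) with hv
  have hvm : ∀ t ρ, v t ρ ∈ Set.Icc (0 : ℝ) H := fun t ρ => APE.upper_mem_Icc (hF i)
  have hregret := hedge_regret_le T v hvm hr (η := η i) (by simpa using hreg) ρ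
  have hwv : ∀ t : Fin T, hedge (η i) t (fun j : Fin t => v (Fin.castLE t.2.le j)) = w t i :=
    fun t => rfl
  simp only [hwv] at hregret
  set gbar : Fin T → ℝ := fun t => ∑ π, (∏ j, w t j (π j)) * advantage G Pol i ρ (w t) π
    with hgbar
  have hgap : G.devValue i ρ (DOPMD.output G F Pol K β η ω) -
      G.mixValue i (DOPMD.output G F Pol K β η ω) = 1 / T * ∑ t, gbar t := by
    have hlin : ∀ V : (∀ j, Pol j) → ℝ, ∑ π, DOPMD.output G F Pol K β η ω π * V π =
        1 / T * ∑ t, ∑ π, (∏ j, w t j (π j)) * V π := by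
      intro V
      rw [Finset.sum_comm, Finset.mul_sum]
      refine Finset.sum_congr rfl fun π _ => ?_
      rw [DOPMD.output, mul_assoc, Finset.sum_mul]
    rw [MarkovGame.devValue, MarkovGame.mixValue, hlin, hlin, ← mul_sub, ← Finset.sum_sub_distrib]
    congr 1
    exact Finset.sum_congr rfl fun t _ => (sum_prod_mul_advantage G i ρ (hw t)).symm
  have hadv : ∀ t, advantage G Pol i ρ (w t) (ω t).1 ≤
      v t ρ - ∑ y, w t i y * v t y + 2 * e := by
    intro t
    have h1 := (abs_le.1 (herr t ρ)).1
    have h2 : ∑ y, w t i y * v t y - e ≤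
        ∑ y, w t i y * G.value i (Function.update (fun j => ((ω t).1 j).1) i y.1) := by
      calc ∑ y, w t i y * v t y - e = ∑ y, w t i y * (v t y - e) := by
            simp only [mul_sub, Finset.sum_sub_distrib, ← Finset.sum_mul, (hw t i).2, one_mul]
        _ ≤ _ := Finset.sum_le_sum fun y _ => mul_le_mul_of_nonneg_left
            (by linarith [(abs_le.1 (herr t y)).2]) ((hw t i).1 y)
    unfold advantage
    linarith
  have hsc : score (advantageScore G F Pol K β η l i ρ) T ω =
      l * (∑ t, gbar t - ∑ t, advantage G Pol i ρ (w t) (ω t).1) -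
        T * (l ^ 2 * (H : ℝ) ^ 2 / 2) := by
    simp only [score, advantageScore, Finset.sum_sub_distrib, ← Finset.mul_sum, Finset.sum_const,
      Finset.card_univ, Fintype.card_fin, nsmul_eq_mul, hgbar, hwdef]
  have hsum : ∑ t, advantage G Pol i ρ (w t) (ω t).1 ≤ T * r + T * (2 * e) := by
    refine (Finset.sum_le_sum fun t _ => hadv t).trans ?_
    rw [Finset.sum_add_distrib, Finset.sum_sub_distrib]
    simp only [Finset.sum_const, Finset.card_univ, Fintype.card_fin, nsmul_eq_mul]
    linarith
  rw [hsc] at hscore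
  rw [hgap, one_div_mul_eq_div, div_le_iff₀ hT']
  have h3 : ∑ t, gbar t - ∑ t, advantage G Pol i ρ (w t) (ω t).1 ≤
      (a + T * (l ^ 2 * (H : ℝ) ^ 2 / 2)) / l := by
    rw [le_div_iff₀ hl]
    linarith
  have h4 : (a + T * (l ^ 2 * (H : ℝ) ^ 2 / 2)) / l = (a / (l * T) + l * (H : ℝ) ^ 2 / 2) * T := by
    field_simp
  linarith

theorem isApproxCCE_output {ε : ℝ} (hε : 0 ≤ ε) {T : ℕ} (hT : 0 < T) {ω : Fin T → Round Pol K}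
    (h : ∀ i (ρ : Pol i), G.devValue i ρ (DOPMD.output G F Pol K β η ω) -
      G.mixValue i (DOPMD.output G F Pol K β η ω) ≤ ε) :
    G.IsApproxCCE ε (DOPMD.output G F Pol K β η ω) := by
  refine ⟨output_mem_stdSimplex G F Pol K β η hT ω, Real.iSup_le (fun i => ?_) hε⟩
  rw [sub_le_iff_le_add]
  exact ciSup_le fun ρ => by linarith [h i ρ]

end DOPMD

/-! ### The guarantee in terms of the parameters -/

namespace DOPMD

variable {m H : ℕ} {S : Type*} [MeasurableSpace S] {A : Fin m → Type*}
  [∀ i, MeasurableSpace (A i)]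
  {G : MarkovGame m H S A} {F : ∀ i, Fin H → Finset (S × A i → ℝ)}
  {Pol : ∀ i, Finset (MarkovPolicy S (A i) H)}

theorem evalClass (hPol : ∀ i, (Pol i).Nonempty)
    (hF : ∀ i h, ∀ f ∈ F i h, Measurable f ∧ ∀ x, f x ∈ Set.Icc (0 : ℝ) H)
    (hcomp : G.Complete F Pol) (i : Fin m) (π : ∀ j, Pol j) :
    G.EvalClass i (F i) (Pol i) fun j => (π j).1 where
  nonempty := hPol i
  regular := hF i
  complete h g hg ρ hρ := by
    refine hcomp i h g hg _ fun j => ?_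
    by_cases hj : j = i
    · subst hj; simpa using hρ
    · simp [hj]

variable {sel : ∀ i, Finset (Pol i) → Pol i} {K : Fin m → ℕ} {β η : Fin m → ℝ}

theorem le_law_of_forall [∀ i, Nonempty (Pol i)] {δ : ℝ} (hδ : 0 < δ)
    (hF : ∀ i h, ∀ f ∈ F i h, Measurable f) {T : ℕ} {s : Set (Fin T → Round Pol K)}
    (h : ∀ ω, ω ∈ s) : ENNReal.ofReal (1 - δ) ≤ law G F Pol sel K β η T s := by
  have := (isSequentialLaw_law G F Pol sel K β η hF).isProbabilityMeasure T
  rw [Set.eq_univ_of_forall h, measure_univ]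
  exact ENNReal.ofReal_le_one.2 (by linarith)

/-- The output is good unless some evaluation fails in some round or some sampling score is large.
The numerical hypotheses are what the later choice of parameters has to meet. -/
theorem le_law_isApproxCCE (hH : 0 < H) (hPol : ∀ i, (Pol i).Nonempty)
    (hF : ∀ i h, ∀ f ∈ F i h, Measurable f ∧ ∀ x, f x ∈ Set.Icc (0 : ℝ) H)
    (hsel : ∀ i (s : Finset (Pol i)), s.Nonempty → sel i s ∈ s)
    (hcomp : G.Complete F Pol) {ε δ a b e l r x : ℝ} {T N : ℕ} {Dim : Fin m → ℝ}
    (hε : 0 ≤ ε) (hT : 0 < T) (hK : ∀ i, 0 < K i) (ha : 0 < a)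
    (hβ : ∀ i, β i = 4 * (H : ℝ) ^ 2 * a) (hx : 0 < x) (hDim : ∀ i, 0 ≤ Dim i)
    (hdim : ∀ i, (G.decBellmanEluderDim F Pol i x : ENNReal) ≤ ENNReal.ofReal (Dim i))
    (hN : (H : ℝ) ≤ 2 ^ N * x) (he : 0 ≤ e)
    (hnum : ∀ i, 4 * (H : ℝ) ^ 2 * (2 * (K i * x ^ 2 + 3 * N * (9 * β i + (H : ℝ) ^ 2) * Dim i) +
      β i) ≤ K i * e ^ 2)
    (hl : 0 < l) (hb : 0 < b) (hr : 0 ≤ r)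
    (hreg : ∀ i, (Pol i).card = 1 ∨ (0 < η i ∧
      Real.log (Pol i).card + T * (η i ^ 2 * (H : ℝ) ^ 2 / 8) ≤ η i * (T * r)))
    (hgap : r + 2 * e + b / (l * T) + l * (H : ℝ) ^ 2 / 2 ≤ ε)
    (hprob : T * ∑ i, 4 * H * ((∏ h, (F i h).card : ℕ) : ℝ) ^ 2 * (Pol i).card * Real.exp (-a) +
      (∑ i, ((Pol i).card : ℝ)) * Real.exp (-b) ≤ δ) :
    ENNReal.ofReal (1 - δ) ≤ law G F Pol sel K β η T
      {ω | G.IsApproxCCE ε (DOPMD.output G F Pol K β η ω)} := by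
  have hne : ∀ i, Nonempty (Pol i) := fun i => (hPol i).to_subtype
  have hFm : ∀ i h, ∀ f ∈ F i h, Measurable f := fun i h f hf => (hF i h f hf).1
  set B : ∀ i, (∀ j, Pol j) → Set (Fin (K i) → Fin H → S × A i × ℝ) := fun i π =>
    {D | ∃ ρ : Pol i, e < |APE.output G.s₁ (F i) (Pol i) (β i) D ρ -
      G.value i (Function.update (fun j => (π j).1) i ρ.1)|} with hBdef
  have hB : ∀ i π, MeasurableSet (B i π) := by
    intro i π
    simp only [hBdef, Set.ofPred_exists]
    refine MeasurableSet.iUnion fun ρ => measurableSet_lt measurable_const ?_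
    exact ((APE.measurable_output (hFm i) G.s₁ ρ).sub_const _).abs
  have h1 := law_exists_mem_le G F Pol sel K β η hFm hB
    (δ := fun i => ENNReal.ofReal (4 * H * ((∏ h, (F i h).card : ℕ) : ℝ) ^ 2 * (Pol i).card *
      Real.exp (-a))) (fun i π => by
      refine (evalClass hPol hF hcomp i π).apeLaw_error_le hH (hsel i) ha (hβ i) (hK i) hx
        (hDim i) (le_trans ?_ (hdim i)) hN he (hnum i)
      exact ENat.toENNReal_le.2 (le_iSup
        (fun π : ∀ j, Pol j => G.bellmanEluderDim i (F i) (Pol i) (fun j => (π j).1) x) π)) T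
  have h2 := law_large_advantageScore_le G F Pol sel K β η hFm l hb T
  have := (isSequentialLaw_law G F Pol sel K β η hFm).isProbabilityMeasure T
  set good := {ω | G.IsApproxCCE ε (DOPMD.output G F Pol K β η (T := T) ω)} with hgood
  have hsub : goodᶜ ⊆ {ω : Fin T → Round Pol K | ∃ t, ∃ i, (ω t).2 i ∈ B i (ω t).1} ∪
      {ω | ∃ i, ∃ ρ : Pol i, b ≤ score (advantageScore G F Pol K β η l i ρ) T ω} := by
    intro ω hω
    by_contra hcon
    refine hω (isApproxCCE_output hε hT fun i ρ => ?_)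
    refine (devValue_sub_mixValue_le hF hT hl hr (fun t ρ => ?_) (hreg i) (?_ : _ < b)).trans hgap
    · exact not_lt.1 fun h => hcon (Or.inl ⟨t, i, ρ, h⟩)
    · exact not_le.1 fun h => hcon (Or.inr ⟨i, ρ, h⟩)
  have h3 : ∀ i, 0 ≤ 4 * H * ((∏ h, (F i h).card : ℕ) : ℝ) ^ 2 * (Pol i).card * Real.exp (-a) :=
    fun i => mul_nonneg (mul_nonneg (mul_nonneg (mul_nonneg zero_le_four (Nat.cast_nonneg _))
      (sq_nonneg _)) (Nat.cast_nonneg _)) (Real.exp_pos _).le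
  have h4 : 0 ≤ (∑ i, ((Pol i).card : ℝ)) * Real.exp (-b) :=
    mul_nonneg (Finset.sum_nonneg fun i _ => Nat.cast_nonneg _) (Real.exp_pos _).le
  have hbad : law G F Pol sel K β η T goodᶜ ≤ ENNReal.ofReal δ := by
    refine (measure_mono hsub).trans ((measure_union_le _ _).trans ((add_le_add h1 h2).trans ?_))
    refine le_trans (le_of_eq ?_) (ENNReal.ofReal_le_ofReal hprob)
    rw [ENNReal.ofReal_add (mul_nonneg (Nat.cast_nonneg T) (Finset.sum_nonneg fun i _ => h3 i)) h4,
      ENNReal.ofReal_mul (Nat.cast_nonneg T), ENNReal.ofReal_natCast,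
      ENNReal.ofReal_sum_of_nonneg fun i _ => h3 i]
  have hδ : 0 ≤ δ := le_trans
    (add_nonneg (mul_nonneg (Nat.cast_nonneg T) (Finset.sum_nonneg fun i _ => h3 i)) h4) hprob
  rw [ENNReal.ofReal_sub _ hδ, ENNReal.ofReal_one, tsub_le_iff_right]
  calc (1 : ENNReal) = law G F Pol sel K β η T Set.univ := measure_univ.symm
    _ = law G F Pol sel K β η T (good ∪ goodᶜ) := by rw [Set.union_compl_self]
    _ ≤ _ := (measure_union_le _ _).trans (by gcongr)

end DOPMD

/-! ### Choice of the parameters -/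

theorem exists_nat_mem_Icc_two_mul {x : ℝ} (hx : 1 ≤ x) :
    ∃ n : ℕ, 1 ≤ n ∧ x ≤ n ∧ (n : ℝ) ≤ 2 * x :=
  ⟨⌈x⌉₊, Nat.one_le_ceil_iff.2 (by linarith), Nat.le_ceil x,
    by linarith [Nat.ceil_lt_add_one (by linarith : 0 ≤ x)]⟩

theorem two_le_exp_one : (2 : ℝ) ≤ Real.exp 1 := by linarith [Real.exp_one_gt_d9]

theorem two_pow_le_exp (n : ℕ) : (2 : ℝ) ^ n ≤ Real.exp n := by
  rw [← Real.exp_one_pow]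
  exact pow_le_pow_left₀ zero_le_two two_le_exp_one n

namespace DOPMD

section LogFactor

variable {m H : ℕ} {NP NF : Fin m → ℕ} {d : Fin m → ℝ} {ε δ : ℝ}

theorem le_exp_logFactor (hε : 0 < ε) (hδ : 0 < δ) :
    3 + (m : ℝ) + H + 1 / ε + 1 / δ + ∑ i, Real.log (NP i) ≤
      Real.exp (logFactor m H NP NF d ε δ) := by
  have h1 : ∑ i, Real.log (NP i) ≤
      ∑ i, (max 1 (d i) + Real.log (NP i) + Real.log (NF i)) := by
    refine Finset.sum_le_sum fun i _ => ?_
    linarith [le_max_left 1 (d i), Real.log_natCast_nonneg (NF i)]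
  have h2 : 0 ≤ ∑ i, Real.log (NP i : ℝ) :=
    Finset.sum_nonneg fun i _ => Real.log_natCast_nonneg _
  have h3 : 0 < 1 / ε := by positivity
  have h4 : 0 < 1 / δ := by positivity
  have h5 : (0 : ℝ) ≤ m := Nat.cast_nonneg m
  have h6 : (0 : ℝ) ≤ H := Nat.cast_nonneg H
  rw [logFactor, Real.exp_log (by linarith)]
  linarith

theorem one_le_logFactor (hε : 0 < ε) (hδ : 0 < δ) : 1 ≤ logFactor m H NP NF d ε δ := by
  rw [← Real.exp_le_exp]
  refine le_trans ?_ (le_exp_logFactor hε hδ)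
  have h2 : 0 ≤ ∑ i, Real.log (NP i : ℝ) :=
    Finset.sum_nonneg fun i _ => Real.log_natCast_nonneg _
  have h3 : 0 < 1 / ε := by positivity
  have h4 : 0 < 1 / δ := by positivity
  have h5 : (0 : ℝ) ≤ m := Nat.cast_nonneg m
  have h6 : (0 : ℝ) ≤ H := Nat.cast_nonneg H
  linarith [Real.exp_one_lt_d9]

theorem log_sum_le_exp_logFactor (hε : 0 < ε) (hδ : 0 < δ) (hNP : ∀ i, 1 ≤ NP i) (hm : 0 < m) :
    Real.log (∑ i, (NP i : ℝ)) ≤ Real.exp (logFactor m H NP NF d ε δ) := by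
  have hm' : (0 : ℝ) < m := by exact_mod_cast hm
  have h0 : ∀ i, (0 : ℝ) < NP i := fun i => by exact_mod_cast hNP i
  have h1 : ∀ i, (NP i : ℝ) ≤ Real.exp (∑ i, Real.log (NP i)) := by
    intro i
    rw [← Real.log_le_iff_le_exp (h0 i)]
    exact Finset.single_le_sum (f := fun i => Real.log (NP i : ℝ))
      (fun i _ => Real.log_natCast_nonneg _) (Finset.mem_univ i)
  have h2 : ∑ i, (NP i : ℝ) ≤ m * Real.exp (∑ i, Real.log (NP i)) := by
    refine (Finset.sum_le_sum fun i _ => h1 i).trans ?_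
    simp
  have h3 : 0 < ∑ i, (NP i : ℝ) :=
    Finset.sum_pos (fun i _ => h0 i) ⟨⟨0, hm⟩, Finset.mem_univ _⟩
  refine (Real.log_le_log h3 h2).trans ?_
  rw [Real.log_mul hm'.ne' (Real.exp_pos _).ne', Real.log_exp]
  refine le_trans ?_ (le_exp_logFactor hε hδ)
  have h4 : 0 < 1 / ε := by positivity
  have h5 : 0 < 1 / δ := by positivity
  have h6 : (0 : ℝ) ≤ H := Nat.cast_nonneg H
  linarith [Real.log_le_self hm'.le]

end LogFactor

/-! ### Numerical inequalities behind the constants -/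

section Numerics

variable {H ε ι L d : ℝ}

/-- The scale ε/(32H) uses half of Kε²/64, namely Kε²/128. All other terms are at most
2206288·ι³H⁴dL, and 128·2206288 < 3·10⁸ fits them into the other half. -/
theorem evaluation_budget (hH : 0 < H) (hε : 0 < ε) (hι : 1 ≤ ι) (hL : 1 / 2 ≤ L)
    (hd : 1 ≤ d) {N K : ℝ} (hN : N ≤ 13 * ι)
    (hK : 3 * 10 ^ 8 * (ι ^ 3 * (H ^ 4 * d * L / ε ^ 2)) ≤ K) :
    4 * H ^ 2 * (2 * (K * (ε / (32 * H)) ^ 2 + 3 * N * (9 * (4 * H ^ 2 * (28 * (ι * L))) + H ^ 2) *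
      (d * (7 * ι))) + 4 * H ^ 2 * (28 * (ι * L))) ≤ K * (ε / 8) ^ 2 := by
  have h1 : 3 * 10 ^ 8 * (ι ^ 3 * (H ^ 4 * d * L)) ≤ K * ε ^ 2 := by
    rw [← div_le_iff₀ (by positivity)]
    refine le_trans (le_of_eq ?_) hK
    ring
  have hιL : 1 / 2 ≤ ι * L := by nlinarith
  have hH2 : 0 < H ^ 2 := by positivity
  have h2 : 9 * (4 * H ^ 2 * (28 * (ι * L))) + H ^ 2 ≤ 1010 * (H ^ 2 * (ι * L)) := by nlinarith
  have h3 : 3 * N * (9 * (4 * H ^ 2 * (28 * (ι * L))) + H ^ 2) * (d * (7 * ι)) ≤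
      3 * (13 * ι) * (1010 * (H ^ 2 * (ι * L))) * (d * (7 * ι)) := by gcongr
  have h4 : 4 * H ^ 2 * (28 * (ι * L)) ≤ 112 * (ι ^ 3 * H ^ 2 * d * L) := by
    have : 1 ≤ ι ^ 2 * d := by
      have := one_le_pow₀ hι (n := 2)
      nlinarith
    have h5 : 0 ≤ H ^ 2 * (ι * L) := by positivity
    nlinarith
  have h5 : 4 * H ^ 2 * (2 * (K * (ε / (32 * H)) ^ 2)) = K * ε ^ 2 / 128 := by
    field_simp
    ring
  have h6 : 0 ≤ ι ^ 3 * (H ^ 4 * d * L) := by positivity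
  calc _ = 4 * H ^ 2 * (2 * (K * (ε / (32 * H)) ^ 2)) + 4 * H ^ 2 *
        (2 * (3 * N * (9 * (4 * H ^ 2 * (28 * (ι * L))) + H ^ 2) * (d * (7 * ι))) +
          4 * H ^ 2 * (28 * (ι * L))) := by ring
    _ ≤ K * ε ^ 2 / 128 + 4 * H ^ 2 *
        (2 * (3 * (13 * ι) * (1010 * (H ^ 2 * (ι * L))) * (d * (7 * ι))) +
          112 * (ι ^ 3 * H ^ 2 * d * L)) := by
        rw [h5]; gcongr
    _ = K * ε ^ 2 / 128 + 2206288 * (ι ^ 3 * (H ^ 4 * d * L)) := by ring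
    _ ≤ _ := by nlinarith

/-- The learning rate satisfies η²H²T = P, so the left side is 9P/8 = η·T·(9/8)ηH²; the lower bound
on T makes (9/8)ηH² at most ε/4. -/
theorem hedge_budget (hH : 0 < H) (hε : 0 < ε) (hι : 1 ≤ ι) {T P L₀ : ℝ}
    (hT : 32 * (H ^ 2 * L₀ * ι / ε ^ 2) ≤ T) (hP : 0 < P) (hPL : P ≤ L₀) :
    0 < Real.sqrt (P / (H ^ 2 * T)) ∧
      P + T * (Real.sqrt (P / (H ^ 2 * T)) ^ 2 * H ^ 2 / 8) ≤
        Real.sqrt (P / (H ^ 2 * T)) * (T * (ε / 4)) := by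
  have hL₀ : 0 < L₀ := hP.trans_le hPL
  have hT0 : 0 < T := lt_of_lt_of_le (by positivity) hT
  have hT' : 32 * (H ^ 2 * L₀ * ι) ≤ T * ε ^ 2 := by
    rw [← div_le_iff₀ (by positivity)]
    refine le_trans (le_of_eq ?_) hT
    ring
  set η := Real.sqrt (P / (H ^ 2 * T)) with hη
  have hη0 : 0 < η := Real.sqrt_pos.2 (by positivity)
  have hη2 : η ^ 2 * (H ^ 2 * T) = P := by
    rw [hη, Real.sq_sqrt (by positivity), div_mul_cancel₀ _ (by positivity)]
  refine ⟨hη0, ?_⟩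
  have h1 : (9 / 8 * (η * H ^ 2)) ^ 2 ≤ (ε / 4) ^ 2 := by
    refine le_of_mul_le_mul_right ?_ hT0
    have h2 : (9 / 8 * (η * H ^ 2)) ^ 2 * T = 81 / 64 * (H ^ 2 * P) := by
      rw [← hη2]; ring
    have h3 : H ^ 2 * P ≤ H ^ 2 * L₀ * ι := by
      calc H ^ 2 * P ≤ H ^ 2 * L₀ * 1 := by rw [mul_one]; gcongr
        _ ≤ _ := by gcongr
    have h4 : 0 ≤ H ^ 2 * P := by positivity
    rw [h2]
    nlinarith
  have h2 := le_of_sq_le_sq h1 (by positivity)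
  calc P + T * (η ^ 2 * H ^ 2 / 8) = η * (T * (9 / 8 * (η * H ^ 2))) := by
        rw [← hη2]; ring
    _ ≤ _ := by gcongr

/-- Four quarters of ε: Hedge regret, evaluation error, sampling deviation and its variance
correction. The factor 32 in T is what the third one requires. -/
theorem sampling_budget (hH : 0 < H) (hε : 0 < ε) (hι : 1 ≤ ι) {T L₀ : ℝ} (hL₀ : 0 < L₀)
    (hT : 32 * (H ^ 2 * L₀ * ι / ε ^ 2) ≤ T) :
    ε / 4 + 2 * (ε / 8) + 4 * (L₀ * ι) / (ε / (2 * H ^ 2) * T) + ε / (2 * H ^ 2) * H ^ 2 / 2 ≤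
      ε := by
  have hT0 : 0 < T := lt_of_lt_of_le (by positivity) hT
  have hT' : 32 * (H ^ 2 * L₀ * ι) ≤ T * ε ^ 2 := by
    rw [← div_le_iff₀ (by positivity)]
    refine le_trans (le_of_eq ?_) hT
    ring
  have h1 : 4 * (L₀ * ι) / (ε / (2 * H ^ 2) * T) ≤ ε / 4 := by
    rw [div_le_iff₀ (by positivity)]
    have : ε / 4 * (ε / (2 * H ^ 2) * T) = T * ε ^ 2 / (8 * H ^ 2) := by field_simp; norm_num
    rw [this, le_div_iff₀ (by positivity)]
    linarith
  have h2 : ε / (2 * H ^ 2) * H ^ 2 / 2 = ε / 4 := by field_simp; norm_num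
  linarith

/-- `Q` bounds all the parameters except the cardinality `M`. -/
theorem failure_le (hι : 1 ≤ ι) {δ m T M L₀ : ℝ} (hδ : 0 < δ) (hm : 0 ≤ m) (hH : 0 < H)
    (hε : 0 < ε) (hmQ : m ≤ Real.exp ι) (hHQ : H ≤ Real.exp ι) (hεQ : 1 / ε ≤ Real.exp ι)
    (hδQ : 1 / δ ≤ Real.exp ι) (hL₀Q : L₀ ≤ Real.exp ι) (hL₀ : 0 ≤ L₀) (hM : 2 ≤ M)
    (hT : T ≤ 64 * (H ^ 2 * L₀ * ι / ε ^ 2)) :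
    T * (m * (4 * H * M ^ 2)) * Real.exp (-(28 * (ι * Real.log M))) ≤ δ / 2 := by
  set Q := Real.exp ι with hQ
  have hQ0 : 0 < Q := Real.exp_pos _
  have hιQ : ι ≤ Q := by linarith [Real.add_one_le_exp ι]
  have hT' : T ≤ 64 * Q ^ 6 := by
    refine hT.trans ?_
    have : H ^ 2 * L₀ * ι / ε ^ 2 = H ^ 2 * L₀ * ι * (1 / ε) ^ 2 := by ring
    rw [this]
    have h1 : H ^ 2 * L₀ * ι * (1 / ε) ^ 2 ≤ Q ^ 2 * Q * Q * Q ^ 2 := by gcongr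
    linarith [show Q ^ 2 * Q * Q * Q ^ 2 = Q ^ 6 by ring]
  have hM0 : 0 < M := by linarith
  have hlog : 0.693 ≤ Real.log M := by
    have := Real.log_le_log two_pos hM
    linarith [Real.log_two_gt_d9]
  have h1 : T * (m * (4 * H * M ^ 2)) * 2 ≤ (2 : ℝ) ^ 9 * (Q ^ 8 * M ^ 2) := by
    calc T * (m * (4 * H * M ^ 2)) * 2 ≤ 64 * Q ^ 6 * (Q * (4 * Q * M ^ 2)) * 2 := by gcongr
      _ = _ := by ring
  have h2 : 1 ≤ δ * Q := by
    rw [div_le_iff₀ hδ] at hδQ; linarith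
  have h3 : (2 : ℝ) ^ 9 * (Q ^ 9 * M ^ 2) ≤ Real.exp (28 * (ι * Real.log M)) := by
    calc (2 : ℝ) ^ 9 * (Q ^ 9 * M ^ 2) ≤ Real.exp (9 : ℕ) * (Q ^ 9 * M ^ 2) := by
          gcongr; exact two_pow_le_exp 9
      _ = Real.exp (9 + (9 * ι + 2 * Real.log M)) := by
          have e1 : Q ^ 9 = Real.exp (9 * ι) := by rw [hQ, ← Real.exp_nat_mul]; norm_num
          have e2 : M ^ 2 = Real.exp (2 * Real.log M) := by
            conv_lhs => rw [← Real.exp_log hM0, ← Real.exp_nat_mul]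
            norm_num
          rw [Real.exp_add, Real.exp_add, e1, e2]
          norm_num
      _ ≤ _ := by
          -- Here 9 + 9ι ≤ 18ι and 18/0.693 < 26, so 26 + 2 = 28 multiples of ι·log M suffice; this
          -- is the origin of the constant 28.
          refine Real.exp_le_exp.2 ?_
          have e1 : 0.693 * ι ≤ ι * Real.log M := by nlinarith
          have e2 : Real.log M ≤ ι * Real.log M := by nlinarith
          linarith
  rw [Real.exp_neg, ← div_eq_mul_inv, div_le_iff₀ (Real.exp_pos _)]
  have h4 : (2 : ℝ) ^ 9 * (Q ^ 8 * M ^ 2) ≤ δ * Real.exp (28 * (ι * Real.log M)) := by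
    calc (2 : ℝ) ^ 9 * (Q ^ 8 * M ^ 2) ≤ δ * Q * ((2 : ℝ) ^ 9 * (Q ^ 8 * M ^ 2)) :=
          le_mul_of_one_le_left (by positivity) h2
      _ = δ * ((2 : ℝ) ^ 9 * (Q ^ 9 * M ^ 2)) := by ring
      _ ≤ _ := by gcongr
  linarith

theorem sampling_failure_le (hι : 1 ≤ ι) {δ M : ℝ} (hδ : 0 < δ) (hδQ : 1 / δ ≤ Real.exp ι)
    (hM : 2 ≤ M) : M * Real.exp (-(4 * (Real.log M * ι))) ≤ δ / 2 := by
  have hM0 : 0 < M := by linarith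
  have hlog : 0.693 ≤ Real.log M := by
    have := Real.log_le_log two_pos hM
    linarith [Real.log_two_gt_d9]
  have h2 : 1 ≤ δ * Real.exp ι := by
    rw [div_le_iff₀ hδ] at hδQ; linarith
  have h3 : M * M * Real.exp ι ≤ Real.exp (4 * (Real.log M * ι)) := by
    calc M * M * Real.exp ι = Real.exp (Real.log M + Real.log M + ι) := by
          rw [Real.exp_add, Real.exp_add, Real.exp_log hM0]
      _ ≤ _ := Real.exp_le_exp.2 (by nlinarith)
  rw [Real.exp_neg, ← div_eq_mul_inv, div_le_iff₀ (Real.exp_pos _)]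
  have h4 : 2 * M ≤ δ * Real.exp (4 * (Real.log M * ι)) := by
    calc 2 * M ≤ M * M := by nlinarith
      _ ≤ δ * Real.exp ι * (M * M) := le_mul_of_one_le_left (by positivity) h2
      _ = δ * (M * M * Real.exp ι) := by ring
      _ ≤ _ := by gcongr
  linarith

/-- Both quantities are polynomial in exp ι: the inverse scale is at most exp(5 + 2ι), and H over
the scale at most exp(5 + 3ι) ≤ exp(8ι), which 12ι doublings reach since 12·log 2 > 8. -/
theorem scale_le (hι : 1 ≤ ι) (hε : 0 < ε) (hH : 0 < H) (hHQ : H ≤ Real.exp ι)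
    (hεQ : 1 / ε ≤ Real.exp ι) : Real.log (1 / (ε / (32 * H))) ≤ 7 * ι ∧
      H ≤ 2 ^ ⌈12 * ι⌉₊ * (ε / (32 * H)) := by
  have h1 : 32 * H ^ 2 * (1 / ε) ≤ Real.exp (5 + 3 * ι) := by
    calc 32 * H ^ 2 * (1 / ε) ≤ 2 ^ 5 * Real.exp ι ^ 2 * Real.exp ι := by
          gcongr; norm_num
      _ ≤ Real.exp (5 : ℕ) * Real.exp ι ^ 2 * Real.exp ι := by
          gcongr; exact two_pow_le_exp 5
      _ = _ := by
          rw [Real.exp_add, ← Real.exp_nat_mul, mul_assoc, ← Real.exp_add]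
          norm_num
          ring_nf
  have h2 : 32 * H * (1 / ε) ≤ Real.exp (5 + 2 * ι) := by
    calc 32 * H * (1 / ε) ≤ 2 ^ 5 * Real.exp ι * Real.exp ι := by
          gcongr; norm_num
      _ ≤ Real.exp (5 : ℕ) * Real.exp ι * Real.exp ι := by
          gcongr; exact two_pow_le_exp 5
      _ = _ := by
          rw [Real.exp_add, mul_assoc, ← Real.exp_add]
          norm_num
          ring_nf
  constructor
  · rw [Real.log_le_iff_le_exp (by positivity)]
    refine le_trans (le_of_eq ?_) (h2.trans (Real.exp_le_exp.2 (by linarith)))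
    field_simp
  · have h3 : Real.exp (5 + 3 * ι) ≤ 2 ^ ⌈12 * ι⌉₊ := by
      rw [← Real.le_log_iff_exp_le (by positivity), Real.log_pow]
      have h4 := Nat.le_ceil (12 * ι)
      nlinarith [Real.log_two_gt_d9]
    calc H = 32 * H ^ 2 * (1 / ε) * (ε / (32 * H)) := by field_simp
      _ ≤ _ := by gcongr; exact h1.trans h3

end Numerics

end DOPMD

/-! ### Degenerate games, and rounding of the parameters -/

namespace DOPMD

section Trivial

variable {m H : ℕ} {S : Type*} [MeasurableSpace S] {A : Fin m → Type*}
  [∀ i, MeasurableSpace (A i)]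
  {G : MarkovGame m H S A} {F : ∀ i, Fin H → Finset (S × A i → ℝ)}
  {Pol : ∀ i, Finset (MarkovPolicy S (A i) H)} {sel : ∀ i, Finset (Pol i) → Pol i}
  {K : Fin m → ℕ} {β η : Fin m → ℝ}

/-- Values lie in [0, H], so no gap exceeds H; and with singleton classes every deviation is the
policy already in use. No learning is needed in either case. -/
theorem le_law_isApproxCCE_of_trivial (hPol : ∀ i, (Pol i).Nonempty)
    (hF : ∀ i h, ∀ f ∈ F i h, Measurable f) {ε δ : ℝ} (hε : 0 ≤ ε) (hδ : 0 < δ)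
    (h : (H : ℝ) ≤ ε ∨ ∀ i, (Pol i).card ≤ 1) {T : ℕ} (hT : 0 < T) :
    ENNReal.ofReal (1 - δ) ≤ law G F Pol sel K β η T
      {ω | G.IsApproxCCE ε (DOPMD.output G F Pol K β η ω)} := by
  have hne : ∀ i, Nonempty (Pol i) := fun i => (hPol i).to_subtype
  refine le_law_of_forall hδ hF fun ω => isApproxCCE_output hε hT fun i ρ => ?_
  have hΛ := output_mem_stdSimplex G F Pol K β η hT ω
  rw [MarkovGame.devValue, MarkovGame.mixValue, ← Finset.sum_sub_distrib]
  rcases h with h | h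
  · calc _ ≤ ∑ π, DOPMD.output G F Pol K β η ω π * (H : ℝ) := by
          refine Finset.sum_le_sum fun π _ => ?_
          rw [← mul_sub]
          refine mul_le_mul_of_nonneg_left ?_ (hΛ.1 π)
          linarith [(G.value_mem_Icc (i := i) (Function.update (fun j => (π j).1) i ρ.1)).2,
            (G.value_mem_Icc (i := i) fun j => (π j).1).1]
      _ = H := by rw [← Finset.sum_mul, hΛ.2, one_mul]
      _ ≤ ε := h
  · refine le_trans (le_of_eq (Finset.sum_eq_zero fun π _ => ?_)) hε
    have h1 : ρ = π i := Subtype.ext (Finset.card_le_one.1 (h i) _ ρ.2 _ (π i).2)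
    rw [h1, Function.update_eq_self i fun j => (π j).1, sub_self]

end Trivial

/-- Rounding up at most doubles a number that is at least 1. This is where ε ≤ H and at least two
policies in total, which keeps the logarithms above 1/2, are used. -/
theorem exists_parameters (m H : ℕ) (NP NF : Fin m → ℕ) (d : Fin m → ℝ) {ε δ : ℝ} (hε : 0 < ε)
    (hδ : 0 < δ) (hH : 0 < H) (hNF : ∀ i, 1 ≤ NF i)
    (hεH : ε ≤ H) (hsum : 2 ≤ ∑ i, NP i) :
    ∃ (T : ℕ) (K : Fin m → ℕ), 1 ≤ T ∧ (∀ i, 1 ≤ K i) ∧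
      32 * ((H : ℝ) ^ 2 * Real.log (∑ i, (NP i : ℝ)) * logFactor m H NP NF d ε δ / ε ^ 2) ≤ T ∧
      (T : ℝ) ≤ 64 * ((H : ℝ) ^ 2 * Real.log (∑ i, (NP i : ℝ)) * logFactor m H NP NF d ε δ /
        ε ^ 2) ∧
      (∀ i, 3 * 10 ^ 8 * (logFactor m H NP NF d ε δ ^ 3 * ((H : ℝ) ^ 4 * max 1 (d i) *
        Real.log (∑ j, (NP j : ℝ) * (NF j : ℝ)) / ε ^ 2)) ≤ K i) ∧
      (∀ i, (K i : ℝ) ≤ 6 * 10 ^ 8 * (logFactor m H NP NF d ε δ ^ 3 * ((H : ℝ) ^ 4 * max 1 (d i) *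
        Real.log (∑ j, (NP j : ℝ) * (NF j : ℝ)) / ε ^ 2))) ∧
      1 / 2 ≤ Real.log (∑ i, (NP i : ℝ)) ∧
      Real.log (∑ i, (NP i : ℝ)) ≤ Real.log (∑ j, (NP j : ℝ) * (NF j : ℝ)) := by
  set ι := logFactor m H NP NF d ε δ
  have hι : 1 ≤ ι := one_le_logFactor hε hδ
  have hs : (2 : ℝ) ≤ ∑ i, (NP i : ℝ) := by exact_mod_cast hsum
  have hL₀ : 1 / 2 ≤ Real.log (∑ i, (NP i : ℝ)) := by
    have := Real.log_le_log two_pos hs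
    linarith [Real.log_two_gt_d9]
  have hL : Real.log (∑ i, (NP i : ℝ)) ≤ Real.log (∑ j, (NP j : ℝ) * (NF j : ℝ)) := by
    refine Real.log_le_log (by linarith) (Finset.sum_le_sum fun i _ => ?_)
    exact le_mul_of_one_le_right (Nat.cast_nonneg _) (by exact_mod_cast hNF i)
  have hH1 : (1 : ℝ) ≤ H := by exact_mod_cast hH
  have hHε : 1 ≤ (H : ℝ) ^ 2 / ε ^ 2 := by
    rw [one_le_div (by positivity)]
    gcongr
  obtain ⟨T, hT1, hT2, hT3⟩ := exists_nat_mem_Icc_two_mul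
    (x := 32 * ((H : ℝ) ^ 2 * Real.log (∑ i, (NP i : ℝ)) * ι / ε ^ 2)) (by
      rw [show 32 * ((H : ℝ) ^ 2 * Real.log (∑ i, (NP i : ℝ)) * ι / ε ^ 2) =
        32 * ((H : ℝ) ^ 2 / ε ^ 2 * (Real.log (∑ i, (NP i : ℝ)) * ι)) by ring]
      have h1 : 1 / 2 ≤ Real.log (∑ i, (NP i : ℝ)) * ι := by nlinarith
      nlinarith)
  have hK : ∀ i, ∃ k : ℕ, 1 ≤ k ∧ 3 * 10 ^ 8 * (ι ^ 3 * ((H : ℝ) ^ 4 * max 1 (d i) *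
        Real.log (∑ j, (NP j : ℝ) * (NF j : ℝ)) / ε ^ 2)) ≤ k ∧
      (k : ℝ) ≤ 2 * (3 * 10 ^ 8 * (ι ^ 3 * ((H : ℝ) ^ 4 * max 1 (d i) *
        Real.log (∑ j, (NP j : ℝ) * (NF j : ℝ)) / ε ^ 2))) := by
    intro i
    refine exists_nat_mem_Icc_two_mul ?_
    have h1 : 1 * (1 * (1 * (1 * 1))) ≤ ι ^ 3 * ((H : ℝ) ^ 2 * ((H : ℝ) ^ 2 / ε ^ 2 *
        (max 1 (d i) * (2 * Real.log (∑ j, (NP j : ℝ) * (NF j : ℝ)))))) := by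
      gcongr
      · exact one_le_pow₀ hι
      · exact one_le_pow₀ hH1
      · exact le_max_left _ _
      · linarith
    have h2 : ι ^ 3 * ((H : ℝ) ^ 2 * ((H : ℝ) ^ 2 / ε ^ 2 *
        (max 1 (d i) * (2 * Real.log (∑ j, (NP j : ℝ) * (NF j : ℝ)))))) =
        2 * (ι ^ 3 * ((H : ℝ) ^ 4 * max 1 (d i) *
        Real.log (∑ j, (NP j : ℝ) * (NF j : ℝ)) / ε ^ 2)) := by ring
    linarith
  choose K hK1 hK2 hK3 using hK
  refine ⟨T, K, hT1, hK1, hT2, by linarith, hK2, fun i => by linarith [hK3 i], hL₀, hL⟩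

theorem mul_sum_le {m : ℕ} {K : Fin m → ℕ} {d : Fin m → ℝ} {T H ε ι L₀ L : ℝ} (hε : 0 < ε)
    (hι : 0 ≤ ι) (hL₀ : 0 ≤ L₀) (hL : L₀ ≤ L) (hT : T ≤ 64 * (H ^ 2 * L₀ * ι / ε ^ 2))
    (hK : ∀ i, (K i : ℝ) ≤ 6 * 10 ^ 8 * (ι ^ 3 * (H ^ 4 * max 1 (d i) * L / ε ^ 2))) :
    T * ∑ i, (K i : ℝ) ≤ 10 ^ 11 * ι ^ 4 * (H ^ 6 * (∑ i, max 1 (d i)) * L ^ 2 / ε ^ 4) := by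
  have hd : 0 ≤ ∑ i, max 1 (d i) := Finset.sum_nonneg fun i _ => le_trans zero_le_one
    (le_max_left _ _)
  have h0 : 0 ≤ L := hL₀.trans hL
  have hH6 : 0 ≤ H ^ 6 := by positivity
  have h1 : ∑ i, (K i : ℝ) ≤ 6 * 10 ^ 8 * (ι ^ 3 * (H ^ 4 * (∑ i, max 1 (d i)) * L / ε ^ 2)) := by
    refine (Finset.sum_le_sum fun i _ => hK i).trans (le_of_eq ?_)
    rw [← Finset.mul_sum, ← Finset.mul_sum, ← Finset.sum_div, ← Finset.sum_mul, ← Finset.mul_sum]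
  calc T * ∑ i, (K i : ℝ) ≤ 64 * (H ^ 2 * L * ι / ε ^ 2) *
        (6 * 10 ^ 8 * (ι ^ 3 * (H ^ 4 * (∑ i, max 1 (d i)) * L / ε ^ 2))) := by
        refine mul_le_mul (hT.trans ?_) h1 (Finset.sum_nonneg fun i _ => Nat.cast_nonneg _)
          (by positivity)
        gcongr
    _ = 3.84 * 10 ^ 10 * (ι ^ 4 * (H ^ 6 * (∑ i, max 1 (d i)) * L ^ 2 / ε ^ 4)) := by ring
    _ ≤ 10 ^ 11 * (ι ^ 4 * (H ^ 6 * (∑ i, max 1 (d i)) * L ^ 2 / ε ^ 4)) := by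
        gcongr; norm_num
    _ = _ := by ring

end DOPMD

end

/-! ### Assembly of the guarantee -/

theorem mainTheorem3 :
    ∃ (C : ℝ) (p : ℕ), 0 < C ∧
    ∀ (m H : ℕ) (NP NF : Fin m → ℕ) (d : Fin m → ℝ) (ε δ : ℝ), 0 < ε → 0 < δ → δ < 1 →
    ∃ (T : ℕ) (K : Fin m → ℕ) (β : Fin m → ℝ),
      (1 ≤ T ∧ (T : ℝ) ≤ max 1 (C * DOPMD.logFactor m H NP NF d ε δ ^ p *
        ((H : ℝ) ^ 2 * Real.log (∑ i, (NP i : ℝ)) / ε ^ 2))) ∧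
      (∀ i, 1 ≤ K i ∧ (K i : ℝ) ≤ max 1 (C * DOPMD.logFactor m H NP NF d ε δ ^ p *
        ((H : ℝ) ^ 4 * max 1 (d i) * Real.log (∑ j, (NP j : ℝ) * (NF j : ℝ)) / ε ^ 2))) ∧
      (∀ i, 0 ≤ β i ∧ β i ≤ C * DOPMD.logFactor m H NP NF d ε δ ^ p *
        ((H : ℝ) ^ 2 * Real.log (∑ j, (NP j : ℝ) * (NF j : ℝ)))) ∧
      ((T : ℝ) * ∑ i, (K i : ℝ) ≤ max (m : ℝ) (C * DOPMD.logFactor m H NP NF d ε δ ^ p *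
        ((H : ℝ) ^ 6 * (∑ i, max 1 (d i)) *
          Real.log (∑ j, (NP j : ℝ) * (NF j : ℝ)) ^ 2 / ε ^ 4))) ∧
      ∀ (S : Type*) [MeasurableSpace S] (A : Fin m → Type*) [∀ i, MeasurableSpace (A i)]
        (G : MarkovGame m H S A) (F : ∀ i, Fin H → Finset (S × A i → ℝ))
        (Pol : ∀ i, Finset (MarkovPolicy S (A i) H))
        (sel : ∀ i, Finset (Pol i) → Pol i),
        (∀ i, (Pol i).Nonempty) →
        (∀ i, (Pol i).card = NP i) →
        (∀ i, ∏ h, (F i h).card = NF i) →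
        (∀ i h, ∀ f ∈ F i h, Measurable f ∧ ∀ x, f x ∈ Set.Icc (0 : ℝ) H) →
        (∀ i (s : Finset (Pol i)), s.Nonempty → sel i s ∈ s) →
        G.Complete F Pol →
        (∀ i (x : ℝ), 0 < x → x ≤ 1 / 2 →
          (G.decBellmanEluderDim F Pol i x : ENNReal) ≤ ENNReal.ofReal (d i * Real.log (1 / x))) →
        ENNReal.ofReal (1 - δ) ≤
          DOPMD.law G F Pol sel K β
            (fun i => Real.sqrt (Real.log (NP i) / ((H : ℝ) ^ 2 * T))) T
            {ω | G.IsApproxCCE ε (DOPMD.output G F Pol K β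
              (fun i => Real.sqrt (Real.log (NP i) / ((H : ℝ) ^ 2 * T))) ω)} := by
  refine ⟨10 ^ 11, 4, by norm_num, fun m H NP NF d ε δ hε hδ hδ1 => ?_⟩
  -- Parameters for which one round suffices or no admissible classes exist. Here the stated bounds
  -- may fall below 1, so T = K = 1 is taken.
  by_cases htriv : (H : ℝ) ≤ ε ∨ (∃ i, NP i = 0) ∨ (∃ i, NF i = 0) ∨ ∑ i, NP i ≤ 1
  · have hι := DOPMD.one_le_logFactor (m := m) (H := H) (NP := NP) (NF := NF) (d := d) hε hδ
    have hlog : 0 ≤ Real.log (∑ j, (NP j : ℝ) * (NF j : ℝ)) := by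
      exact_mod_cast Real.log_natCast_nonneg (∑ j, NP j * NF j)
    refine ⟨1, fun _ => 1, fun _ => 0, ⟨le_rfl, by simp⟩, fun i => ⟨le_rfl, by simp⟩,
      fun i => ⟨le_rfl, by positivity⟩, by simp, ?_⟩
    intro S _ A _ G F Pol sel hPol hcardP hcardF hF hsel hcomp hdim
    refine DOPMD.le_law_isApproxCCE_of_trivial hPol (fun i h f hf => (hF i h f hf).1) hε.le hδ ?_
      one_pos
    rcases htriv with h | ⟨i, hi⟩ | ⟨i, hi⟩ | h
    · exact Or.inl h
    · exact absurd (hcardP i ▸ hi) (hPol i).card_pos.ne'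
    · exfalso
      -- An empty value class contradicts completeness, which produces a Bellman solution in the
      -- class.
      choose π hπ using fun j => (hPol j)
      obtain ⟨f, hf, -⟩ := (DOPMD.evalClass hPol hF hcomp i
        fun j => ⟨π j, hπ j⟩).exists_bellman_solution (hπ i)
      rw [← hcardF i, Finset.prod_eq_zero_iff] at hi
      obtain ⟨h, -, hh⟩ := hi
      exact Finset.card_ne_zero_of_mem (Fintype.mem_piFinset.1 hf h) hh
    · exact Or.inr fun i => (hcardP i).le.trans
        ((Finset.single_le_sum (fun _ _ => Nat.zero_le _) (Finset.mem_univ i)).trans h)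
  simp only [not_or, not_exists, not_le] at htriv
  obtain ⟨hεH, hNP, hNF, hsum⟩ := htriv
  replace hNP : ∀ i, 1 ≤ NP i := fun i => Nat.one_le_iff_ne_zero.2 (hNP i)
  replace hNF : ∀ i, 1 ≤ NF i := fun i => Nat.one_le_iff_ne_zero.2 (hNF i)
  have hH' : (0 : ℝ) < H := hε.trans hεH
  have hH : 0 < H := by exact_mod_cast hH'
  have hm : 0 < m := by
    rcases Nat.eq_zero_or_pos m with rfl | h
    · simp at hsum
    · exact h
  obtain ⟨T, K, hT1, hK1, hT2, hT3, hK2, hK3, hL₀, hLL⟩ :=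
    DOPMD.exists_parameters m H NP NF d hε hδ hH hNF hεH.le hsum
  have hι := DOPMD.one_le_logFactor (m := m) (H := H) (NP := NP) (NF := NF) (d := d) hε hδ
  have hQ := DOPMD.le_exp_logFactor (m := m) (H := H) (NP := NP) (NF := NF) (d := d) hε hδ
  have hL₀Q := DOPMD.log_sum_le_exp_logFactor (H := H) (NF := NF) (d := d) hε hδ hNP hm
  set ι := DOPMD.logFactor m H NP NF d ε δ with hιdef
  set L₀ := Real.log (∑ i, (NP i : ℝ)) with hL₀def
  set L := Real.log (∑ j, (NP j : ℝ) * (NF j : ℝ)) with hLdef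
  have hL : 1 / 2 ≤ L := hL₀.trans hLL
  have hL0 : 0 < L := by linarith
  have hL₀0 : 0 < L₀ := by linarith
  have hι0 : 0 < ι := by linarith
  have hd0 : ∀ i, 0 < max 1 (d i) := fun i => lt_of_lt_of_le one_pos (le_max_left _ _)
  have hT0 : (0 : ℝ) < T := by exact_mod_cast hT1
  have hs2 : (2 : ℝ) ≤ ∑ i, (NP i : ℝ) := by exact_mod_cast hsum
  have hlogNP : 0 ≤ ∑ i, Real.log (NP i : ℝ) :=
    Finset.sum_nonneg fun i _ => Real.log_natCast_nonneg _
  have hε1 : 0 < 1 / ε := by positivity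
  have hδ1' : 0 < 1 / δ := by positivity
  have hm0 : (0 : ℝ) < m := by exact_mod_cast hm
  have hmQ : (m : ℝ) ≤ Real.exp ι := by linarith
  have hHQ : (H : ℝ) ≤ Real.exp ι := by linarith
  have hεQ : 1 / ε ≤ Real.exp ι := by linarith
  have hδQ : 1 / δ ≤ Real.exp ι := by linarith
  refine ⟨T, K, fun _ => 4 * (H : ℝ) ^ 2 * (28 * (ι * L)), ⟨hT1, le_max_of_le_right ?_⟩,
    fun i => ⟨hK1 i, le_max_of_le_right ?_⟩, fun i => ⟨by positivity, ?_⟩,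
    le_max_of_le_right (DOPMD.mul_sum_le hε hι0.le hL₀0.le hLL hT3 hK3), ?_⟩
  · refine hT3.trans ?_
    have h1 : ι ^ 1 ≤ ι ^ 4 := pow_le_pow_right₀ hι (by norm_num)
    calc 64 * ((H : ℝ) ^ 2 * L₀ * ι / ε ^ 2) = 64 * ι ^ 1 * ((H : ℝ) ^ 2 * L₀ / ε ^ 2) := by ring
      _ ≤ _ := by gcongr; norm_num
  · refine (hK3 i).trans ?_
    have h1 : ι ^ 3 ≤ ι ^ 4 := pow_le_pow_right₀ hι (by norm_num)
    have h2 := hd0 i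
    rw [← mul_assoc]
    gcongr
    norm_num
  · have h1 : ι ^ 1 ≤ ι ^ 4 := pow_le_pow_right₀ hι (by norm_num)
    calc 4 * (H : ℝ) ^ 2 * (28 * (ι * L)) = 112 * ι ^ 1 * ((H : ℝ) ^ 2 * L) := by ring
      _ ≤ _ := by gcongr; norm_num
  intro S _ A _ G F Pol sel hPol hcardP hcardF hF hsel hcomp hdim
  obtain ⟨hscale, hN⟩ := DOPMD.scale_le hι hε hH' hHQ hεQ
  refine DOPMD.le_law_isApproxCCE hH hPol hF hsel hcomp (a := 28 * (ι * L)) (b := 4 * (L₀ * ι))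
    (e := ε / 8) (l := ε / (2 * (H : ℝ) ^ 2)) (r := ε / 4) (x := ε / (32 * H)) (N := ⌈12 * ι⌉₊)
    (Dim := fun i => max 1 (d i) * (7 * ι)) hε.le hT1 hK1 (by positivity) (fun _ => rfl)
    (by positivity) (fun i => mul_nonneg (hd0 i).le (by positivity)) (fun i => ?_) hN
    (by positivity) (fun i => ?_) (by positivity) (by positivity) (by positivity) (fun i => ?_)
    (DOPMD.sampling_budget hH' hε hι hL₀0 hT2) ?_
  · have hx2 : ε / (32 * H) ≤ 1 / 2 := by
      rw [div_le_div_iff₀ (by positivity) two_pos]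
      linarith
    refine (hdim i _ (by positivity) hx2).trans (ENNReal.ofReal_le_ofReal ?_)
    -- Nonnegativity allows `d i`, possibly negative, to be replaced by its maximum with 1.
    have hlog : 0 ≤ Real.log (1 / (ε / (32 * H))) := by
      refine Real.log_nonneg ?_
      rw [le_div_iff₀ (by positivity)]
      linarith
    calc d i * Real.log (1 / (ε / (32 * H))) ≤ max 1 (d i) * Real.log (1 / (ε / (32 * H))) := by
          gcongr; exact le_max_right _ _
      _ ≤ _ := by
          have h2 := hd0 i
          gcongr
  · refine DOPMD.evaluation_budget hH' hε hι hL (le_max_left _ _) ?_ (hK2 i)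
    linarith [Nat.ceil_lt_add_one (by positivity : 0 ≤ 12 * ι)]
  · rcases (hNP i).eq_or_lt with h | h
    · exact Or.inl ((hcardP i).trans h.symm)
    · right
      rw [hcardP i]
      have h2 : (1 : ℝ) < NP i := by exact_mod_cast h
      refine DOPMD.hedge_budget hH' hε hι hT2 (Real.log_pos h2) (Real.log_le_log (by linarith) ?_)
      exact Finset.single_le_sum (f := fun i => (NP i : ℝ)) (fun i _ => Nat.cast_nonneg _)
        (Finset.mem_univ i)
  · simp only [hcardP, hcardF]
    set M := ∑ j, (NP j : ℝ) * (NF j : ℝ) with hM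
    have hterm : ∀ i, (NP i : ℝ) ≤ NP i * NF i := fun i =>
      le_mul_of_one_le_right (Nat.cast_nonneg _) (by exact_mod_cast hNF i)
    have hM2 : 2 ≤ M := hs2.trans (Finset.sum_le_sum fun i _ => hterm i)
    have h1 := DOPMD.failure_le hι hδ hm0.le hH' hε hmQ hHQ hεQ hδQ hL₀Q hL₀0.le hM2 hT3
    have h2 := DOPMD.sampling_failure_le hι hδ hδQ hs2
    -- Bounding every player's count by the square of the common `M` makes the union over players
    -- cost only a factor m.
    have h3 : ∀ i, 4 * (H : ℝ) * (NF i : ℝ) ^ 2 * NP i ≤ 4 * H * M ^ 2 := by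
      intro i
      have h4 : (NP i : ℝ) * NF i ≤ M := Finset.single_le_sum
        (f := fun j => (NP j : ℝ) * NF j) (fun j _ => by positivity) (Finset.mem_univ i)
      have h5 : (1 : ℝ) ≤ NP i := by exact_mod_cast hNP i
      calc 4 * (H : ℝ) * (NF i : ℝ) ^ 2 * NP i ≤ 4 * (H : ℝ) * (NF i : ℝ) ^ 2 * (NP i) ^ 2 := by
            gcongr
            exact le_self_pow₀ h5 two_ne_zero
        _ = 4 * H * ((NP i : ℝ) * NF i) ^ 2 := by ring
        _ ≤ _ := by gcongr
    have h6 : (T : ℝ) * ∑ i, 4 * (H : ℝ) * (NF i : ℝ) ^ 2 * NP i * Real.exp (-(28 * (ι * L))) ≤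
        T * (m * (4 * H * M ^ 2)) * Real.exp (-(28 * (ι * L))) := by
      rw [← Finset.sum_mul, mul_assoc (T : ℝ)]
      gcongr
      refine (Finset.sum_le_sum fun i _ => h3 i).trans ?_
      simp
    linarith
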